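/- **Setting.** Let $(X,A,Y)\sim P$ with features $X\in\mathcal X$, attribute $A\in\{0,1\}$ and (fully observed) outcome $Y\in\mathcal Y\subseteq[0,1]$. Let $\mathcal F$ be a class of measurable functions $f:\mathcal X\to[0,1]$ (with the usual measurability of suprema over the class), and let $l:\mathcal Y\times[0,1]\to[0,1]$ be $1$-Lipschitz for the $l_1$-norm, extended by $l(y,u)=l(y,\min\{u,1\})$ for $u>1$. Let $\mathcal E_0,\mathcal E_1$ be events of positive probability determined by $(A,Y)$, and let $\beta_0,\beta_1\in\mathbb R$. Put $\mathrm{loss}(f)=\mathbb E[l(Y,f(X))]$ and $\mathrm{disparity}(f)=\beta_0\mathbb E[f(X)\mid\mathcal E_0]+\beta_1\mathbb E[f(X)\mid\mathcal E_1]$. For a discrete distribution $Q$ on $\mathcal F$ put $\mathrm{loss}(Q)=\sum_f Q(f)\,\mathrm{loss}(f)$ and $\mathrm{disparity}(Q)=\sum_f Q(f)\,\mathrm{disparity}(f)$. Fix a loss tolerance $\epsilon\ge 0$; $Q$ is *feasible* if $\mathrm{loss}(Q)\le\epsilon$. **Discretization.** Let $N\ge1$, $\alpha=1/N$, let $Z$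 be uniform on $\{\alpha,2\alpha,\dots,1\}$ and independent of the data, and put $h_f(x,z)=1\{f(x)\ge z\}$, $\mathcal H=\{h_f:f\in\mathcal F\}$. Fix a finite $\frac\alpha2$-cover of $\mathcal Y$ by points of $\mathcal Y$, let $\underline y$ be its smallest element within $\frac\alpha2$ of $y$, and put $c(y,z)=N\,(l(y,z+\frac\alpha2)-l(y,z-\frac\alpha2))$. From $n$ i.i.d. observations form the sample averages $\widehat{\mathrm{cost}}(h_f)=\hat{\mathbb E}\,\mathbb E_Z[c(\underline Y,Z)h_f(X,Z)]$, $\hat c_0=\hat{\mathbb E}[l(\underline Y,\frac\alpha2)]$ and $\widehat{\mathrm{disparity}}(h_f)=\sum_a\beta_a\hat{\mathbb E}[\mathbb E_Z h_f(X,Z)\mid\mathcal E_a]$, extended linearly to distributions over $\mathcal H$. Let $n_a$ be the number of observations in $\mathcal E_a$ (an empirical average over no observations is read as $0$). **Algorithm.** Let $$L(\xi,Q,\lambda)=\xi+\lambda_+(\widehat{\mathrm{disparity}}(Q)-\xi)+\lambda_-(-\widehat{\mathrm{disparity}}(Q)-\xi)+\lambda_{\mathrm{cost}}(\widehat{\mathrm{cost}}(Q)-\hat\epsilon),$$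 with $\xi\in[0,B_\xi]$, $\lambda\ge0$ and $\lambda_++\lambda_-+\lambda_{\mathrm{cost}}\le B_\lambda$; here $B_\xi>0$ bounds the absolute disparity, i.e. $|\beta_0p+\beta_1q|\le B_\xi$ for all $p,q\in[0,1]$. Start with $\theta_1=0\in\mathbb R^3$. In round $t$ set $\lambda_{t,k}=B_\lambda e^{\theta_{t,k}}/(1+\sum_{k'}e^{\theta_{t,k'}})$; let $h_t$ be an exact best response in $h$ to $\lambda_t$, and $\xi_t=B_\xi$ if $1-\lambda_{t,+}-\lambda_{t,-}<0$, otherwise $\xi_t=0$. Let $\hat\xi_t,\hat Q_t,\hat\lambda_t$ be the averages over the rounds so far, and let $\nu_t$ be the larger of the two gains in $L$ at $(\hat\xi_t,\hat Q_t,\hat\lambda_t)$ that best responses of the $(\xi,Q)$-player to $\hat\lambda_t$ and of the $\lambda$-player to $(\hat\xi_t,\hat Q_t)$ achieve. If $\nu_t\le\nu$, stop, and return $(\hat\xi_t,\hat Q_t,\hat\lambda_t)$ if $\widehat{\mathrm{cost}}(\hat Q_t)\le\hat\epsilon+(B_\xi+2\nu)/B_\lambda$ and $null$ otherwise. If $\nu_t>\nu$,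 add to $\theta_t$ the vector $\eta\,(\widehat{\mathrm{disparity}}(h_t)-\xi_t,\,-\widehat{\mathrm{disparity}}(h_t)-\xi_t,\,\widehat{\mathrm{cost}}(h_t)-\hat\epsilon)$. The learning rate is $\eta=\nu/(2\rho^2B_\lambda)$, where $\rho$ is the supremum over $h\in\mathcal H$ and $\xi\in[0,B_\xi]$ of the largest absolute value of a coordinate of $(\widehat{\mathrm{disparity}}(h)-\xi,\,-\widehat{\mathrm{disparity}}(h)-\xi,\,\widehat{\mathrm{cost}}(h)-\hat\epsilon)$. **Theorem.** Let $0<\phi\le\frac12$, $C>0$, and suppose that the Rademacher complexity satisfies $R_k(\mathcal H)\le Ck^{-\phi}$ for all $k\ge1$. Let $\delta\in(0,1)$ and $$\hat\epsilon=\epsilon-\hat c_0+C'n^{-\phi}-C''n^{-1/2},$$ where $C''\ge\sqrt{-\log(\delta/8)/2}$ is a constant and $C'\ge2C+2+\sqrt{2\ln(8N/\delta)}$ is bounded by a polynomial in $\ln n$ and $\ln(1/\delta)$. Let $\nu=\kappa_\nu n^{-\phi}$, $B_\lambda=\kappa_Bn^{\phi}$ and $\kappa_1n^\phi\le N\le\kappa_2n^\phi$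 with fixed positive constants. Then there is an $\bar n$, depending only on $\delta$, $C''$ and the constants of the problem ($\phi$, $C$, $\beta_0$, $\beta_1$, $B_\xi$, the $\kappa$'s, the polynomial bounding $C'$ and an upper bound for $\epsilon$), such that for all $n\ge\bar n$ the following holds. The algorithm terminates, on every sample, after at most $O(n^{4\phi})$ iterations. With probability at least $1-\delta$, one of the following holds: 1. the output is not $null$, $\mathrm{loss}(\hat Q)\le\epsilon+\tilde O(n^{-\phi})$, and $|\mathrm{disparity}(\hat Q)|\le|\mathrm{disparity}(\tilde Q)|+\tilde O(n_0^{-\phi})+\tilde O(n_1^{-\phi})$ for every feasible $\tilde Q$, where $\hat Q$ is viewed as a distribution over $\mathcal F$; or 2. the output is $null$ and no distribution on $\mathcal F$ is feasible. The constants in $O$ and $\tilde O$ depend only on the constants of the problem, not on $n$, $\delta$, $C''$, $P$ or $\mathcal F$, and $\tilde O$ hides polynomial factors in $\ln n$ and $\ln(1/\delta)$. In the last bound $n_a$ is read as $\max\{n_a,1\}$. -/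

import Mathlib

open MeasureTheory Set

universe u

namespace FairRashomon

/-- The population and the learning problem. An observation is `(x, a, y)`: features, sensitive
attribute in `{0, 1}`, outcome in a set `outcomes ⊆ [0, 1]`. Predictors take values in `[0, 1]`,
the loss is `[0, 1]`-valued and `1`-Lipschitz for the `l₁` norm, and the two conditioning events
are determined by `(a, y)` and have positive probability. -/
structure Setting (𝒳 : Type u) [MeasurableSpace 𝒳] where
  outcomes : Set ℝ
  outcomes_subset : outcomes ⊆ Icc 0 1
  law : Measure (𝒳 × Fin 2 × outcomes)
  law_prob : IsProbabilityMeasure law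
  predictors : Set (𝒳 → unitInterval)
  predictors_measurable : ∀ f ∈ predictors, Measurable f
  lossFn : outcomes → unitInterval → unitInterval
  lossFn_lipschitz : ∀ y y' u u',
    |(lossFn y u : ℝ) - (lossFn y' u' : ℝ)| ≤ |(y : ℝ) - (y' : ℝ)| + |(u : ℝ) - (u' : ℝ)|
  event : Fin 2 → Set (Fin 2 × outcomes)
  event_measurable : ∀ a, MeasurableSet (event a)
  event_pos : ∀ a, law {o | o.2 ∈ event a} ≠ 0

/-- Mean of `g` under a (discrete) distribution `Q` over the index set:
`∑ f, Q(f) g(f)`. -/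
noncomputable def mean {ι : Type*} (Q : PMF ι) (g : ι → ℝ) : ℝ :=
  ∑' f, (Q f).toReal * g f

namespace Setting

variable {𝒳 : Type u} [MeasurableSpace 𝒳] (S : Setting 𝒳)

/-- One observation `(x, a, y)`. -/
abbrev Obs : Type u := 𝒳 × Fin 2 × S.outcomes

/-! ### Population quantities -/

/-- `loss(f) = E[l(Y, f(X))]`. -/
noncomputable def loss (f : S.predictors) : ℝ :=
  ∫ o, (S.lossFn o.2.2 (f.1 o.1) : ℝ) ∂S.law

/-- `disparity(f) = β₀ E[f(X) | 𝓔₀] + β₁ E[f(X) | 𝓔₁]`. -/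
noncomputable def disp (β : Fin 2 → ℝ) (f : S.predictors) : ℝ :=
  ∑ a, β a * ∫ o, (f.1 o.1 : ℝ) ∂(ProbabilityTheory.cond S.law {o | o.2 ∈ S.event a})

/-- `Q` satisfies the loss constraint `loss(Q) ≤ ε` of the population problem
`min |disparity(Q)| s.t. loss(Q) ≤ ε`. -/
def Feasible (ε : ℝ) (Q : PMF S.predictors) : Prop :=
  mean Q S.loss ≤ ε

/-! ### Threshold classifiers and complexity -/

/-- The threshold classifier `h_f(x, z) = 1{f(x) ≥ z}`. -/
noncomputable def thr (f : S.predictors) (x : 𝒳) (z : ℝ) : ℝ :=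
  if z ≤ (f.1 x : ℝ) then 1 else 0

/-- Rademacher complexity `R_m` of the class of threshold classifiers on `𝒳 × [0, 1]`:
`sup_{u₁,…,u_m} E_σ [ sup_f | (1/m) ∑ σᵢ h_f(uᵢ) | ]` with independent uniform signs `σᵢ`. -/
noncomputable def rademacher (m : ℕ) : ℝ :=
  ⨆ v : Fin m → 𝒳 × unitInterval,
    (1 / 2 ^ m : ℝ) * ∑ σ : Fin m → Bool,
      ⨆ f : S.predictors,
        |(1 / (m : ℝ)) * ∑ i, (if σ i then (1 : ℝ) else -1) * S.thr f (v i).1 (v i).2|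

/-- Measurability convention for the class: suprema over the class of absolute values of finite
signed sums of threshold classifiers are measurable (up to null sets) functions of the points.
It holds for instance for every countable class. -/
def SupMeasurable : Prop :=
  ∀ (m : ℕ) (c : Fin m → ℝ) (z : unitInterval),
    AEMeasurable (fun x : Fin m → 𝒳 => ⨆ f : S.predictors, |∑ i, c i * S.thr f (x i) z|)
      (Measure.pi fun _ => S.law.map Prod.fst)

/-! ### Discretization, with grid `{1/N, 2/N, …, 1}` and `α = 1/N` -/

/-- `cover` is a finite `α/2`-cover of the outcome set. -/
def IsCover (N : ℕ) (cover : Finset S.outcomes) : Prop :=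
  ∀ y : S.outcomes, ∃ y' : S.outcomes, y' ∈ cover ∧ |(y : ℝ) - (y' : ℝ)| ≤ 1 / (2 * (N : ℝ))

open Classical in
/-- The smallest element of the cover within `α/2` of `y`. -/
noncomputable def roundOutcome (N : ℕ) (cover : Finset S.outcomes) (y : S.outcomes) :
    S.outcomes :=
  if h : (cover.filter fun y' : S.outcomes => |(y : ℝ) - (y' : ℝ)| ≤ 1 / (2 * (N : ℝ))).Nonempty then
    (cover.filter fun y' : S.outcomes => |(y : ℝ) - (y' : ℝ)| ≤ 1 / (2 * (N : ℝ))).min' h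
  else y

/-- The loss with its second argument truncated to `[0, 1]`; the truncation only matters at the
last grid point, where the shifted argument is `1 + α/2`. -/
noncomputable def lossExt (y : S.outcomes) (v : ℝ) : ℝ :=
  S.lossFn y (projIcc (0 : ℝ) 1 zero_le_one v)

/-- `c(y, z) = N (l(y, z + α/2) - l(y, z - α/2))`. -/
noncomputable def costWeight (N : ℕ) (y : S.outcomes) (z : ℝ) : ℝ :=
  N * (S.lossExt y (z + 1 / (2 * (N : ℝ))) - S.lossExt y (z - 1 / (2 * (N : ℝ))))

/-- Mean over the uniform distribution on the grid `{1/N, …, N/N}`. -/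
noncomputable def gridMean (N : ℕ) (g : ℝ → ℝ) : ℝ :=
  (1 / (N : ℝ)) * ∑ j ∈ Finset.Icc 1 N, g ((j : ℝ) / N)

/-! ### Sample quantities -/

variable {n : ℕ} (s : Fin n → S.Obs)

open Classical in
/-- Number of sample points in the event `𝓔ₐ`. -/
noncomputable def eventCount (a : Fin 2) : ℕ :=
  (Finset.univ.filter fun i => (s i).2 ∈ S.event a).card

open Classical in
/-- Sample version of `disparity(h_f) = ∑ₐ βₐ E[h_f(X, Z) | 𝓔ₐ]`, `Z` uniform on the grid. -/
noncomputable def empDisp (β : Fin 2 → ℝ) (N : ℕ) (f : S.predictors) : ℝ :=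
  ∑ a, β a * ((1 / (S.eventCount s a : ℝ)) *
    ∑ i, if (s i).2 ∈ S.event a then gridMean N (fun z => S.thr f (s i).1 z) else 0)

/-- Sample version of `cost(h_f) = E[c(y̲, Z) h_f(X, Z)]`, with `y̲` the rounded outcome. -/
noncomputable def empCost (N : ℕ) (cover : Finset S.outcomes) (f : S.predictors) : ℝ :=
  (1 / (n : ℝ)) * ∑ i, gridMean N (fun z =>
    S.costWeight N (S.roundOutcome N cover (s i).2.2) z * S.thr f (s i).1 z)

/-- `ĉ₀`, the sample mean of `l(y̲, α/2)`. -/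
noncomputable def empConst (N : ℕ) (cover : Finset S.outcomes) : ℝ :=
  (1 / (n : ℝ)) * ∑ i, S.lossExt (S.roundOutcome N cover (s i).2.2) (1 / (2 * (N : ℝ)))

/-- `ε̂ = ε - ĉ₀ + C' n^{-φ} - C'' n^{-1/2}`. -/
noncomputable def epsHat (N : ℕ) (cover : Finset S.outcomes) (φ ε C' C'' : ℝ) : ℝ :=
  ε - S.empConst s N cover + C' * (n : ℝ) ^ (-φ) - C'' * (n : ℝ) ^ (-(1 / 2) : ℝ)

end Setting

/-! ### The exponentiated gradient algorithm with a slack variable -/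

/-- The three constraint values at `(ξ, Q)`: index `0` is `disp(Q) - ξ`, index `1` is
`-disp(Q) - ξ`, index `2` is `cost(Q) - ε̂`. -/
noncomputable def constraintVec {ι : Type*} (disp cost : ι → ℝ) (epsHat ξ : ℝ) (Q : PMF ι) :
    Fin 3 → ℝ :=
  ![mean Q disp - ξ, -mean Q disp - ξ, mean Q cost - epsHat]

/-- `ρ`: the supremum of the absolute constraint values over all `h` and all `ξ ∈ [0, B_ξ]`
(the norm on `Fin 3 → ℝ` is the sup norm). -/
noncomputable def rho {ι : Type*} (disp cost : ι → ℝ) (epsHat Bξ : ℝ) : ℝ :=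
  ⨆ p : ι × Icc (0 : ℝ) Bξ, ‖constraintVec disp cost epsHat p.2 (PMF.pure p.1)‖

/-- Input of the algorithm: sample disparity and cost of each classifier, empirical loss tolerance,
bounds, accuracy, learning rate, and the procedure for the best response in `h`. -/
structure AlgInput (ι : Type*) where
  disp : ι → ℝ
  cost : ι → ℝ
  epsHat : ℝ
  Bξ : ℝ
  Bl : ℝ
  ν : ℝ
  η : ℝ
  bestH : (Fin 3 → ℝ) → ι

namespace AlgInput

variable {ι : Type*} (g : AlgInput ι)

/-- `bestH` returns a minimizer of the `h`-part of the Lagrangian for all multipliers `λ ≥ 0`. -/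
def IsBestResponse : Prop :=
  ∀ lam : Fin 3 → ℝ, (∀ k, 0 ≤ lam k) → ∀ h : ι,
    (lam 0 - lam 1) * g.disp (g.bestH lam) + lam 2 * (g.cost (g.bestH lam) - g.epsHat) ≤
      (lam 0 - lam 1) * g.disp h + lam 2 * (g.cost h - g.epsHat)

/-- Constraint values. -/
noncomputable def con (ξ : ℝ) (Q : PMF ι) : Fin 3 → ℝ :=
  constraintVec g.disp g.cost g.epsHat ξ Q

/-- The Lagrangian `L(ξ, Q, λ) = ξ + λ₊(disp Q - ξ) + λ₋(-disp Q - ξ) + λ_cost(cost Q - ε̂)`. -/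
noncomputable def lagr (ξ : ℝ) (Q : PMF ι) (lam : Fin 3 → ℝ) : ℝ :=
  ξ + ∑ k, lam k * g.con ξ Q k

/-- Best response in `ξ`. -/
noncomputable def bestXi (lam : Fin 3 → ℝ) : ℝ :=
  if 1 - lam 0 - lam 1 < 0 then g.Bξ else 0

/-- Index of a largest coordinate. -/
noncomputable def maxIndex (v : Fin 3 → ℝ) : Fin 3 :=
  if v 1 ≤ v 0 ∧ v 2 ≤ v 0 then 0 else if v 2 ≤ v 1 then 1 else 2

open Classical in
/-- Best response of the multiplier player: zero if all constraints hold, otherwise all the mass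
`B_λ` on a maximally violated constraint. -/
noncomputable def bestLam (ξ : ℝ) (Q : PMF ι) : Fin 3 → ℝ :=
  if ∀ k, g.con ξ Q k ≤ 0 then 0 else Pi.single (maxIndex (g.con ξ Q)) g.Bl

/-- `λ_k = B_λ exp(θ_k) / (1 + ∑ exp(θ_k'))`. -/
noncomputable def lamOf (θ : Fin 3 → ℝ) : Fin 3 → ℝ :=
  fun k => g.Bl * (Real.exp (θ k) / (1 + ∑ k', Real.exp (θ k')))

/-- The parameter `θ` at round `t + 1` (rounds are counted from `t = 0` here). -/
noncomputable def theta : ℕ → Fin 3 → ℝ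
  | 0 => 0
  | t + 1 => theta t +
      g.η • g.con (g.bestXi (g.lamOf (theta t))) (PMF.pure (g.bestH (g.lamOf (theta t))))

/-- Multipliers played in round `t + 1`. -/
noncomputable def lam (t : ℕ) : Fin 3 → ℝ := g.lamOf (g.theta t)

/-- `Q̂` after round `t + 1`: the uniform mixture of the classifiers of rounds `1, …, t + 1`. -/
noncomputable def Qhat (t : ℕ) : PMF ι :=
  (PMF.uniformOfFintype (Fin (t + 1))).map fun r => g.bestH (g.lam r)

/-- `ξ̂` after round `t + 1`. -/
noncomputable def xiHat (t : ℕ) : ℝ :=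
  (1 / ((t : ℝ) + 1)) * ∑ r ∈ Finset.range (t + 1), g.bestXi (g.lam r)

/-- `λ̂` after round `t + 1`. -/
noncomputable def lamHat (t : ℕ) : Fin 3 → ℝ :=
  (1 / ((t : ℝ) + 1)) • ∑ r ∈ Finset.range (t + 1), g.lam r

/-- The saddle point gap `ν_t` after round `t + 1`. -/
noncomputable def gap (t : ℕ) : ℝ :=
  max
    (g.lagr (g.xiHat t) (g.Qhat t) (g.lamHat t) -
      g.lagr (g.bestXi (g.lamHat t)) (PMF.pure (g.bestH (g.lamHat t))) (g.lamHat t))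
    (g.lagr (g.xiHat t) (g.Qhat t) (g.bestLam (g.xiHat t) (g.Qhat t)) -
      g.lagr (g.xiHat t) (g.Qhat t) (g.lamHat t))

/-- The algorithm stops in round `t + 1`, that is, after exactly `t + 1` iterations. -/
def StopsAt (t : ℕ) : Prop :=
  g.gap t ≤ g.ν ∧ ∀ r < t, g.ν < g.gap r

open Classical in
/-- What is returned if the algorithm stops in round `t + 1`; `none` stands for `null`. -/
noncomputable def output (t : ℕ) : Option (ℝ × PMF ι × (Fin 3 → ℝ)) :=
  if mean (g.Qhat t) g.cost ≤ g.epsHat + (g.Bξ + 2 * g.ν) / g.Bl then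
    some (g.xiHat t, g.Qhat t, g.lamHat t)
  else none

end AlgInput

/-- The polylogarithmic factor `K (1 + ln n + ln(1/δ))^m`. -/
noncomputable def polylog (K : ℝ) (m n : ℕ) (δ : ℝ) : ℝ :=
  K * (1 + Real.log n + Real.log (1 / δ)) ^ m

/-- The algorithm's input for the sample `s`, with learning rate `η = ν / (2 ρ² B_λ)`. -/
noncomputable def Setting.algInput {𝒳 : Type u} [MeasurableSpace 𝒳] (S : Setting 𝒳) {n : ℕ}
    (s : Fin n → S.Obs) (β : Fin 2 → ℝ) (N : ℕ) (cover : Finset S.outcomes)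
    (epsHat Bξ Bl ν : ℝ) (bestH : (Fin 3 → ℝ) → S.predictors) : AlgInput S.predictors where
  disp := S.empDisp s β N
  cost := S.empCost s N cover
  epsHat := epsHat
  Bξ := Bξ
  Bl := Bl
  ν := ν
  η := ν / (2 * rho (S.empDisp s β N) (S.empCost s N cover) epsHat Bξ ^ 2 * Bl)
  bestH := bestH

end FairRashomon

open FairRashomon

/-!
Exponentiated gradient ascent in the multipliers has regret `O(√t)` against every fixed `λ`, so the
averaged play is an approximate saddle point of the Lagrangian within `O(n ^ (4 * φ))` rounds; at
such a point `Q̂` has almost the least absolute disparity among the distributions that satisfy the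
empirical cost constraint, and it violates the constraint only slightly if one exists.

The empirical problem is close to the true one. For a fixed outcome the cost weights telescope along
the grid, so `cost(h_f) + c₀` is the loss of `f` up to `1 / N`. Symmetrization and the bounded
differences inequality give uniform convergence of the weighted threshold averages, at each grid
point through the Rademacher complexity of the thresholds. For the conditional means, fix the set of
observations that lie in the event: these are then a sample from the conditional law, and the bound
does not depend on the set.

For large `n`, `√(log N)` exceeds all the constants in the deviation, so the slack in `ε̂` exceeds
the deviation of the loss: every feasible distribution satisfies the empirical constraint, and a
null output shows that none exists.
-/

namespace FairRashomon

section Mean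

variable {ι : Type*} (Q : PMF ι) {g g' : ι → ℝ} {B B' d : ℝ}

theorem summable_mean (hg : ∀ f, |g f| ≤ B) : Summable fun f => (Q f).toReal * g f := by
  have hQ : Summable fun f => (Q f).toReal :=
    ENNReal.summable_toReal (Q.tsum_coe.trans_ne ENNReal.one_ne_top)
  refine Summable.of_norm_bounded (hQ.mul_right B) fun f => ?_
  rw [Real.norm_eq_abs, abs_mul, abs_of_nonneg ENNReal.toReal_nonneg]
  exact mul_le_mul_of_nonneg_left (hg f) ENNReal.toReal_nonneg

theorem mean_const (c : ℝ) : mean Q (fun _ => c) = c := by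
  rw [mean, tsum_mul_right, ← ENNReal.tsum_toReal_eq Q.apply_ne_top, Q.tsum_coe,
    ENNReal.toReal_one, one_mul]

theorem mean_add (hg : ∀ f, |g f| ≤ B) (hg' : ∀ f, |g' f| ≤ B') :
    mean Q (fun f => g f + g' f) = mean Q g + mean Q g' := by
  simp only [mean, mul_add]
  exact (summable_mean Q hg).tsum_add (summable_mean Q hg')

theorem mean_const_mul (c : ℝ) (g : ι → ℝ) : mean Q (fun f => c * g f) = c * mean Q g := by
  simp only [mean, mul_left_comm _ c, tsum_mul_left]

theorem mean_le_mean_add (hg : ∀ f, |g f| ≤ B) (hg' : ∀ f, |g' f| ≤ B')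
    (h : ∀ f, g f ≤ g' f + d) : mean Q g ≤ mean Q g' + d := by
  have hadd := mean_add Q hg' fun _ => le_refl |d|
  rw [mean_const] at hadd
  rw [← hadd]
  exact (summable_mean Q hg).tsum_le_tsum
    (fun f => mul_le_mul_of_nonneg_left (h f) ENNReal.toReal_nonneg)
    (summable_mean Q fun f => (abs_add_le _ _).trans (add_le_add_left (hg' f) _))

theorem le_mean (hg : ∀ f, |g f| ≤ B) {c : ℝ} (h : ∀ f, c ≤ g f) : c ≤ mean Q g := by
  simpa only [mean_const, add_zero] using mean_le_mean_add Q (g := fun _ => c)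
    (fun _ => le_refl |c|) hg (d := 0) (by simpa only [add_zero] using h)

theorem abs_mean_sub_le (hg : ∀ f, |g f| ≤ B) (hg' : ∀ f, |g' f| ≤ B')
    (h : ∀ f, |g f - g' f| ≤ d) : |mean Q g - mean Q g'| ≤ d := by
  rw [abs_sub_le_iff]
  constructor <;> rw [sub_le_iff_le_add']
  · exact mean_le_mean_add Q hg hg' fun f => sub_le_iff_le_add'.1 (abs_sub_le_iff.1 (h f)).1
  · exact mean_le_mean_add Q hg' hg fun f => sub_le_iff_le_add'.1 (abs_sub_le_iff.1 (h f)).2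

theorem abs_mean_le (hg : ∀ f, |g f| ≤ B) : |mean Q g| ≤ B := by
  simpa only [mean_const, sub_zero] using
    abs_mean_sub_le Q hg (g' := fun _ => 0) (fun _ => abs_zero.le) (by simpa only [sub_zero])

theorem le_affine_mean {c a a' v : ℝ} (hg : ∀ f, |g f| ≤ B) (hg' : ∀ f, |g' f| ≤ B')
    (h : ∀ f, v ≤ c + (a * g f + a' * g' f)) : v ≤ c + (a * mean Q g + a' * mean Q g') := by
  have habs {b x D : ℝ} (hx : |x| ≤ D) : |b * x| ≤ |b| * D := by
    rw [abs_mul]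
    exact mul_le_mul_of_nonneg_left hx (abs_nonneg b)
  have hsum (f : ι) : |a * g f + a' * g' f| ≤ |a| * B + |a'| * B' :=
    (abs_add_le _ _).trans (add_le_add (habs (hg f)) (habs (hg' f)))
  rw [← mean_const_mul, ← mean_const_mul, ← mean_add Q (fun f => habs (hg f)) fun f => habs (hg' f),
    ← sub_le_iff_le_add']
  exact le_mean Q hsum fun f => sub_le_iff_le_add'.2 (h f)

theorem mean_pure (a : ι) (g : ι → ℝ) : mean (PMF.pure a) g = g a := by
  rw [mean, tsum_eq_single a fun b hb => by simp [PMF.pure_apply, hb]]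
  simp

theorem mean_map_of_fintype {α : Type*} [Fintype α] (P : PMF α) (h : α → ι) (g : ι → ℝ) :
    mean (P.map h) g = ∑ a, (P a).toReal * g (h a) := by
  classical
  have hterm (f : ι) : ((P.map h) f).toReal * g f =
      ∑ a, if f = h a then (P a).toReal * g (h a) else 0 := by
    rw [PMF.map_apply, tsum_fintype, ENNReal.toReal_sum, Finset.sum_mul]
    · refine Finset.sum_congr rfl fun a _ => ?_
      split_ifs with hf
      · rw [hf]
      · simp
    · intro a _
      split_ifs
      exacts [P.apply_ne_top a, ENNReal.zero_ne_top]
  rw [mean, tsum_congr hterm,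
    Summable.tsum_finsetSum fun a _ => (hasSum_ite_eq (h a) _).summable]
  exact Finset.sum_congr rfl fun a _ => tsum_ite_eq (h a) _

end Mean

theorem eq_smul_sum_of_succ_eq_add_smul {E : Type*} [AddCommGroup E] [Module ℝ E] {η : ℝ}
    {v θ : ℕ → E} (hθ₀ : θ 0 = 0) (hθ : ∀ t, θ (t + 1) = θ t + η • v t) (T : ℕ) :
    θ T = η • ∑ t ∈ Finset.range T, v t := by
  induction T with
  | zero => simp [hθ₀]
  | succ T ih => rw [hθ, ih, Finset.sum_range_succ, smul_add]

section ExponentiatedGradient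

variable {κ : Type*} [Fintype κ]

/-- Softmax weights of the scores `θ` together with one extra option of score `0`, the weight of
which is left out, so that the weights have sum less than `1`. -/
noncomputable def expWeights (θ : κ → ℝ) (k : κ) : ℝ :=
  Real.exp (θ k) / (1 + ∑ k', Real.exp (θ k'))

theorem one_add_sum_exp_pos (θ : κ → ℝ) : 0 < 1 + ∑ k, Real.exp (θ k) := by positivity

theorem expWeights_nonneg (θ : κ → ℝ) (k : κ) : 0 ≤ expWeights θ k :=
  div_nonneg (Real.exp_pos _).le (one_add_sum_exp_pos θ).le

theorem sum_expWeights (θ : κ → ℝ) :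
    ∑ k, expWeights θ k = 1 - 1 / (1 + ∑ k, Real.exp (θ k)) := by
  simp only [expWeights, ← Finset.sum_div]
  field_simp
  ring

theorem sum_expWeights_le_one (θ : κ → ℝ) : ∑ k, expWeights θ k ≤ 1 := by
  rw [sum_expWeights, sub_le_self_iff]
  exact div_nonneg zero_le_one (one_add_sum_exp_pos θ).le

theorem exp_mul_le_of_abs_le {η ρ x : ℝ} (hη : 0 ≤ η) (hx : |x| ≤ ρ) (hηρ : η * ρ ≤ 1) :
    Real.exp (η * x) ≤ 1 + η * x + (η * ρ) ^ 2 := by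
  have hηx : |η * x| ≤ η * ρ := by
    rw [abs_mul, abs_of_nonneg hη]
    exact mul_le_mul_of_nonneg_left hx hη
  have hexp := (abs_le.1 (Real.abs_exp_sub_one_sub_id_le (hηx.trans hηρ))).2
  have hsq : (η * x) ^ 2 ≤ (η * ρ) ^ 2 := sq_le_sq' (abs_le.1 hηx).1 (abs_le.1 hηx).2
  linarith

theorem log_one_add_sum_exp_add_smul_le {η ρ : ℝ} (θ : κ → ℝ) {v : κ → ℝ} (hη : 0 ≤ η)
    (hv : ∀ k, |v k| ≤ ρ) (hηρ : η * ρ ≤ 1) :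
    Real.log (1 + ∑ k, Real.exp ((θ + η • v) k)) ≤
      Real.log (1 + ∑ k, Real.exp (θ k)) + (η * ∑ k, expWeights θ k * v k + (η * ρ) ^ 2) := by
  have hpos := one_add_sum_exp_pos θ
  rw [← sub_le_iff_le_add', ← Real.log_div (one_add_sum_exp_pos _).ne' hpos.ne',
    Real.log_le_iff_le_exp (div_pos (one_add_sum_exp_pos _) hpos)]
  calc (1 + ∑ k, Real.exp ((θ + η • v) k)) / (1 + ∑ k, Real.exp (θ k))
      = 1 / (1 + ∑ k, Real.exp (θ k)) + ∑ k, expWeights θ k * Real.exp (η * v k) := by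
        rw [add_div, Finset.sum_div]
        simp only [expWeights, Pi.add_apply, Pi.smul_apply, smul_eq_mul, Real.exp_add,
          mul_div_right_comm]
    _ ≤ 1 / (1 + ∑ k, Real.exp (θ k)) +
          ∑ k, expWeights θ k * (1 + η * v k + (η * ρ) ^ 2) := by
        gcongr with k
        · exact expWeights_nonneg θ k
        · exact exp_mul_le_of_abs_le hη (hv k) hηρ
    _ = 1 + η * ∑ k, expWeights θ k * v k + (∑ k, expWeights θ k) * (η * ρ) ^ 2 := by
        simp only [mul_add, mul_one, Finset.sum_add_distrib, mul_left_comm _ η, ← Finset.mul_sum,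
          ← Finset.sum_mul, sum_expWeights]
        ring
    _ ≤ 1 + η * ∑ k, expWeights θ k * v k + (η * ρ) ^ 2 :=
        add_le_add_right (mul_le_of_le_one_left (sq_nonneg _) (sum_expWeights_le_one θ)) _
    _ ≤ Real.exp (η * ∑ k, expWeights θ k * v k + (η * ρ) ^ 2) := by
        linarith [Real.add_one_le_exp (η * ∑ k, expWeights θ k * v k + (η * ρ) ^ 2)]

theorem sum_mul_le_log_one_add_sum_exp (θ : κ → ℝ) {q : κ → ℝ} (hq : ∀ k, 0 ≤ q k)
    (hq1 : ∑ k, q k ≤ 1) : ∑ k, q k * θ k ≤ Real.log (1 + ∑ k, Real.exp (θ k)) := by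
  have hle (k : κ) : θ k ≤ Real.log (1 + ∑ k, Real.exp (θ k)) := by
    rw [Real.le_log_iff_exp_le (one_add_sum_exp_pos θ)]
    linarith [Finset.single_le_sum (f := fun k => Real.exp (θ k))
      (fun k _ => (Real.exp_pos _).le) (Finset.mem_univ k)]
  have hlog : 0 ≤ Real.log (1 + ∑ k, Real.exp (θ k)) :=
    Real.log_nonneg (le_add_of_nonneg_right (Finset.sum_nonneg fun _ _ => (Real.exp_pos _).le))
  calc ∑ k, q k * θ k ≤ ∑ k, q k * Real.log (1 + ∑ k, Real.exp (θ k)) :=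
        Finset.sum_le_sum fun k _ => mul_le_mul_of_nonneg_left (hle k) (hq k)
    _ ≤ Real.log (1 + ∑ k, Real.exp (θ k)) := by
        rw [← Finset.sum_mul]
        exact mul_le_of_le_one_left hlog hq1

variable {η ρ : ℝ} {v θ : ℕ → κ → ℝ}

theorem log_one_add_sum_exp_iterate_le (hθ₀ : θ 0 = 0)
    (hθ : ∀ t, θ (t + 1) = θ t + η • v t) (hη : 0 ≤ η) (hv : ∀ t k, |v t k| ≤ ρ)
    (hηρ : η * ρ ≤ 1) (T : ℕ) :
    Real.log (1 + ∑ k, Real.exp (θ T k)) ≤ Real.log (1 + Fintype.card κ) +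
      ∑ t ∈ Finset.range T, (η * ∑ k, expWeights (θ t) k * v t k + (η * ρ) ^ 2) := by
  induction T with
  | zero => simp [hθ₀]
  | succ T ih =>
    rw [Finset.sum_range_succ, ← add_assoc, hθ]
    exact (log_one_add_sum_exp_add_smul_le (θ T) hη (hv T) hηρ).trans (add_le_add_left ih _)

theorem regret_expWeights_le (hθ₀ : θ 0 = 0) (hθ : ∀ t, θ (t + 1) = θ t + η • v t) (hη : 0 < η)
    (hv : ∀ t k, |v t k| ≤ ρ) (hηρ : η * ρ ≤ 1) (T : ℕ) {q : κ → ℝ} (hq : ∀ k, 0 ≤ q k)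
    (hq1 : ∑ k, q k ≤ 1) :
    ∑ t ∈ Finset.range T, ∑ k, (q k - expWeights (θ t) k) * v t k ≤
      Real.log (1 + Fintype.card κ) / η + T * (η * ρ ^ 2) := by
  have hpotential := (sum_mul_le_log_one_add_sum_exp (θ T) hq hq1).trans
    (log_one_add_sum_exp_iterate_le hθ₀ hθ hη.le hv hηρ T)
  have hcomparator :
      ∑ k, q k * θ T k = η * ∑ t ∈ Finset.range T, ∑ k, q k * v t k := by
    simp only [eq_smul_sum_of_succ_eq_add_smul hθ₀ hθ T, Pi.smul_apply, Finset.sum_apply,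
      smul_eq_mul, mul_left_comm _ η, Finset.mul_sum]
    exact Finset.sum_comm
  rw [hcomparator, Finset.sum_add_distrib, ← Finset.mul_sum, Finset.sum_const, Finset.card_range,
    nsmul_eq_mul] at hpotential
  simp only [sub_mul, Finset.sum_sub_distrib]
  rw [← mul_le_mul_iff_right₀ hη, mul_add, mul_div_cancel₀ _ hη.ne']
  linarith

end ExponentiatedGradient

theorem average_const (t : ℕ) (c : ℝ) :
    (1 / ((t : ℝ) + 1)) * ∑ _r ∈ Finset.range (t + 1), c = c := by
  rw [Finset.sum_const, Finset.card_range, nsmul_eq_mul]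
  push_cast
  field_simp

theorem average_mono {f f' : ℕ → ℝ} (h : ∀ r, f r ≤ f' r) (t : ℕ) :
    (1 / ((t : ℝ) + 1)) * ∑ r ∈ Finset.range (t + 1), f r ≤
      (1 / ((t : ℝ) + 1)) * ∑ r ∈ Finset.range (t + 1), f' r :=
  mul_le_mul_of_nonneg_left (Finset.sum_le_sum fun r _ => h r) (by positivity)

theorem abs_constraintVec_pure_le {ι : Type*} {disp cost : ι → ℝ} {ε Bd Bc Bξ ξ : ℝ}
    (hd : ∀ i, |disp i| ≤ Bd) (hc : ∀ i, |cost i - ε| ≤ Bc) (hξ : ξ ∈ Icc 0 Bξ) (i : ι)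
    (k : Fin 3) :
    |constraintVec disp cost ε ξ (PMF.pure i) k| ≤ Bd + Bξ + Bc := by
  have hdi := abs_le.1 (hd i)
  have hci := abs_le.1 (hc i)
  have hξ₀ := hξ.1
  have hξ₁ := hξ.2
  simp only [constraintVec, mean_pure]
  rw [abs_le]
  fin_cases k <;> simp <;> constructor <;> linarith

section Rho

variable {ι : Type*} {disp cost : ι → ℝ} {ε Bd Bc Bξ : ℝ}

theorem norm_constraintVec_pure_le (hd : ∀ i, |disp i| ≤ Bd) (hc : ∀ i, |cost i - ε| ≤ Bc)
    (p : ι × Icc (0 : ℝ) Bξ) :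
    ‖constraintVec disp cost ε p.2 (PMF.pure p.1)‖ ≤ Bd + Bξ + Bc := by
  have hle := abs_constraintVec_pure_le hd hc p.2.2 p.1
  exact (pi_norm_le_iff_of_nonneg ((abs_nonneg _).trans (hle 0))).2 hle

theorem rho_le [Nonempty ι] (hd : ∀ i, |disp i| ≤ Bd) (hc : ∀ i, |cost i - ε| ≤ Bc)
    (hBξ : 0 ≤ Bξ) : rho disp cost ε Bξ ≤ Bd + Bξ + Bc :=
  have : Nonempty (Icc (0 : ℝ) Bξ) := ⟨⟨0, le_rfl, hBξ⟩⟩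
  ciSup_le (norm_constraintVec_pure_le hd hc)

theorem abs_constraintVec_pure_le_rho (hd : ∀ i, |disp i| ≤ Bd) (hc : ∀ i, |cost i - ε| ≤ Bc)
    {ξ : ℝ} (hξ : ξ ∈ Icc 0 Bξ) (i : ι) (k : Fin 3) :
    |constraintVec disp cost ε ξ (PMF.pure i) k| ≤ rho disp cost ε Bξ :=
  (norm_le_pi_norm (constraintVec disp cost ε ξ (PMF.pure i)) k).trans
    (le_ciSup (f := fun p : ι × Icc (0 : ℝ) Bξ => ‖constraintVec disp cost ε p.2 (PMF.pure p.1)‖)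
      ⟨_, forall_mem_range.2 (norm_constraintVec_pure_le hd hc)⟩ (i, ⟨ξ, hξ⟩))

-- The first constraint takes the values `disp i` and `disp i - Bξ` at the two ends of `[0, Bξ]`.
theorem half_le_rho [Nonempty ι] (hd : ∀ i, |disp i| ≤ Bd) (hc : ∀ i, |cost i - ε| ≤ Bc)
    (hBξ : 0 ≤ Bξ) : Bξ / 2 ≤ rho disp cost ε Bξ := by
  obtain ⟨i⟩ := ‹Nonempty ι›
  have hleft := abs_constraintVec_pure_le_rho hd hc (left_mem_Icc.2 hBξ) i 0
  have hright := abs_constraintVec_pure_le_rho hd hc (right_mem_Icc.2 hBξ) i 0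
  simp only [constraintVec, mean_pure, Matrix.cons_val_zero, sub_zero] at hleft hright
  linarith [(abs_le.1 hleft).2, (abs_le.1 hright).1]

end Rho

namespace AlgInput

variable {ι : Type*} (g : AlgInput ι)

theorem lagr_eq (ξ : ℝ) (Q : PMF ι) (lam : Fin 3 → ℝ) :
    g.lagr ξ Q lam = ξ * (1 - lam 0 - lam 1) +
      ((lam 0 - lam 1) * mean Q g.disp + lam 2 * (mean Q g.cost - g.epsHat)) := by
  simp only [lagr, con, constraintVec, Fin.sum_univ_three, Matrix.cons_val_zero,
    Matrix.cons_val_one, Matrix.cons_val]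
  ring

theorem bestXi_mem (hBξ : 0 ≤ g.Bξ) (lam : Fin 3 → ℝ) : g.bestXi lam ∈ Icc 0 g.Bξ := by
  unfold bestXi
  split_ifs
  exacts [right_mem_Icc.2 hBξ, left_mem_Icc.2 hBξ]

theorem lamOf_eq_smul_expWeights (θ : Fin 3 → ℝ) : g.lamOf θ = g.Bl • expWeights θ := rfl

theorem lam_nonneg (hB : 0 ≤ g.Bl) (t : ℕ) (k : Fin 3) : 0 ≤ g.lam t k :=
  mul_nonneg hB (expWeights_nonneg _ k)

theorem sum_lam_le (hB : 0 ≤ g.Bl) (t : ℕ) : ∑ k, g.lam t k ≤ g.Bl := by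
  simp only [lam, lamOf_eq_smul_expWeights, Pi.smul_apply, smul_eq_mul, ← Finset.mul_sum]
  exact mul_le_of_le_one_right hB (sum_expWeights_le_one _)

theorem xiHat_mem (hBξ : 0 ≤ g.Bξ) (t : ℕ) : g.xiHat t ∈ Icc 0 g.Bξ := by
  rw [← average_const t 0, ← average_const t g.Bξ]
  exact ⟨average_mono (fun _ => (g.bestXi_mem hBξ _).1) t,
    average_mono (fun _ => (g.bestXi_mem hBξ _).2) t⟩

theorem lamHat_apply (t : ℕ) (k : Fin 3) :
    g.lamHat t k = (1 / ((t : ℝ) + 1)) * ∑ r ∈ Finset.range (t + 1), g.lam r k := by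
  simp only [lamHat, Pi.smul_apply, Finset.sum_apply, smul_eq_mul]

theorem lamHat_nonneg (hB : 0 ≤ g.Bl) (t : ℕ) (k : Fin 3) : 0 ≤ g.lamHat t k := by
  rw [lamHat_apply, ← average_const t 0]
  exact average_mono (fun r => g.lam_nonneg hB r k) t

theorem sum_lamHat_le (hB : 0 ≤ g.Bl) (t : ℕ) : ∑ k, g.lamHat t k ≤ g.Bl := by
  simp only [lamHat_apply]
  rw [← Finset.mul_sum, Finset.sum_comm, ← average_const t g.Bl]
  exact average_mono (g.sum_lam_le hB) t

theorem mean_Qhat (t : ℕ) (f : ι → ℝ) :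
    mean (g.Qhat t) f =
      (1 / ((t : ℝ) + 1)) * ∑ r ∈ Finset.range (t + 1), f (g.bestH (g.lam r)) := by
  have hQ : g.Qhat t =
      (PMF.uniformOfFintype (Fin (t + 1))).map fun r : Fin (t + 1) => g.bestH (g.lam r) :=
    PMF.map_comp (fun r : Fin (t + 1) => (r : ℕ)) (PMF.uniformOfFintype (Fin (t + 1)))
      fun r => g.bestH (g.lam r)
  have hcard : (((t + 1 : ℕ) : ENNReal)⁻¹).toReal = 1 / ((t : ℝ) + 1) := by
    rw [ENNReal.toReal_inv, ENNReal.toReal_natCast, one_div]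
    push_cast
    rfl
  simp only [hQ, mean_map_of_fintype, PMF.uniformOfFintype_apply, Fintype.card_fin, hcard,
    ← Finset.mul_sum]
  rw [Fin.sum_univ_eq_sum_range fun r => f (g.bestH (g.lam r))]

section BestResponse

/-- Value of the Lagrangian when `ξ` and `h` are best responses to the multipliers `lam`. -/
noncomputable def dualValue (lam : Fin 3 → ℝ) : ℝ :=
  g.lagr (g.bestXi lam) (PMF.pure (g.bestH lam)) lam

variable {g} {Bd Bc : ℝ}

theorem dualValue_le_lagr_pure (hbest : g.IsBestResponse) {lam : Fin 3 → ℝ}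
    (hlam : ∀ k, 0 ≤ lam k) {ξ : ℝ} (hξ : ξ ∈ Icc 0 g.Bξ) (i : ι) :
    g.dualValue lam ≤ g.lagr ξ (PMF.pure i) lam := by
  have hbestXi : g.bestXi lam * (1 - lam 0 - lam 1) ≤ ξ * (1 - lam 0 - lam 1) := by
    unfold bestXi
    split_ifs with hneg
    · exact mul_le_mul_of_nonpos_right hξ.2 hneg.le
    · rw [zero_mul]
      exact mul_nonneg hξ.1 (not_lt.1 hneg)
  rw [dualValue, lagr_eq, lagr_eq]
  simp only [mean_pure]
  exact add_le_add hbestXi (hbest lam hlam i)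

theorem dualValue_le_lagr (hbest : g.IsBestResponse) (hd : ∀ i, |g.disp i| ≤ Bd)
    (hc : ∀ i, |g.cost i| ≤ Bc) {lam : Fin 3 → ℝ} (hlam : ∀ k, 0 ≤ lam k) {ξ : ℝ}
    (hξ : ξ ∈ Icc 0 g.Bξ) (Q : PMF ι) : g.dualValue lam ≤ g.lagr ξ Q lam := by
  have haffine (P : PMF ι) : g.lagr ξ P lam = ξ * (1 - lam 0 - lam 1) - lam 2 * g.epsHat +
      ((lam 0 - lam 1) * mean P g.disp + lam 2 * mean P g.cost) := by
    rw [lagr_eq]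
    ring
  rw [haffine]
  refine le_affine_mean Q hd hc fun i => ?_
  simpa only [haffine, mean_pure] using dualValue_le_lagr_pure hbest hlam hξ i

end BestResponse

section Violation

/-- Largest violation of the three constraints at `(ξ, Q)`; zero if all of them hold. -/
noncomputable def violation (ξ : ℝ) (Q : PMF ι) : ℝ :=
  max 0 (g.con ξ Q (maxIndex (g.con ξ Q)))

theorem le_apply_maxIndex (v : Fin 3 → ℝ) (k : Fin 3) : v k ≤ v (maxIndex v) := by
  unfold maxIndex
  split_ifs <;> fin_cases k <;> simp only [Fin.zero_eta, Fin.mk_one, Fin.reduceFinMk] <;> grind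

theorem violation_nonneg (ξ : ℝ) (Q : PMF ι) : 0 ≤ g.violation ξ Q := le_max_left _ _

theorem con_le_violation (ξ : ℝ) (Q : PMF ι) (k : Fin 3) : g.con ξ Q k ≤ g.violation ξ Q :=
  (le_apply_maxIndex _ k).trans (le_max_right _ _)

theorem exists_bestLam_eq_smul (ξ : ℝ) (Q : PMF ι) :
    ∃ q : Fin 3 → ℝ, (∀ k, 0 ≤ q k) ∧ ∑ k, q k ≤ 1 ∧ g.bestLam ξ Q = g.Bl • q := by
  unfold bestLam
  split_ifs
  · exact ⟨0, fun _ => le_rfl, by simp, (smul_zero _).symm⟩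
  · refine ⟨Pi.single (maxIndex (g.con ξ Q)) 1, fun k => ?_, ?_, ?_⟩
    · exact (Pi.single_nonneg.2 zero_le_one : (0 : Fin 3 → ℝ) ≤ _) k
    · exact (Finset.sum_pi_single' _ _ _).trans_le (by simp)
    · rw [← Pi.single_smul, smul_eq_mul, mul_one]

theorem lagr_bestLam (ξ : ℝ) (Q : PMF ι) :
    g.lagr ξ Q (g.bestLam ξ Q) = ξ + g.Bl * g.violation ξ Q := by
  unfold lagr bestLam violation
  split_ifs with hcon
  · rw [max_eq_left (hcon _)]
    simp
  · obtain ⟨k, hk⟩ := not_forall.1 hcon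
    rw [max_eq_right ((not_le.1 hk).le.trans (le_apply_maxIndex _ k))]
    simp [Pi.single_apply]

theorem lagr_le_add_violation {lam : Fin 3 → ℝ} (hlam : ∀ k, 0 ≤ lam k) (hsum : ∑ k, lam k ≤ g.Bl)
    (ξ : ℝ) (Q : PMF ι) : g.lagr ξ Q lam ≤ ξ + g.Bl * g.violation ξ Q := by
  refine add_le_add_right ?_ ξ
  calc ∑ k, lam k * g.con ξ Q k ≤ ∑ k, lam k * g.violation ξ Q :=
        Finset.sum_le_sum fun k _ => mul_le_mul_of_nonneg_left (g.con_le_violation ξ Q k) (hlam k)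
    _ = (∑ k, lam k) * g.violation ξ Q := (Finset.sum_mul _ _ _).symm
    _ ≤ g.Bl * g.violation ξ Q := mul_le_mul_of_nonneg_right hsum (g.violation_nonneg ξ Q)

end Violation

section Rounds

/-- Constraint values at the pair `(ξ, h)` played in round `r + 1`: the gradients that the
exponentiated gradient player accumulates. -/
noncomputable def roundCon (r : ℕ) : Fin 3 → ℝ :=
  g.con (g.bestXi (g.lam r)) (PMF.pure (g.bestH (g.lam r)))

theorem dualValue_lam (r : ℕ) :
    g.dualValue (g.lam r) = g.bestXi (g.lam r) + ∑ k, g.lam r k * g.roundCon r k := rfl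

theorem con_hat (t : ℕ) (k : Fin 3) :
    g.con (g.xiHat t) (g.Qhat t) k =
      (1 / ((t : ℝ) + 1)) * ∑ r ∈ Finset.range (t + 1), g.roundCon r k := by
  have hneg (f : ℕ → ℝ) : -((1 / ((t : ℝ) + 1)) * ∑ r ∈ Finset.range (t + 1), f r) =
      (1 / ((t : ℝ) + 1)) * ∑ r ∈ Finset.range (t + 1), -f r := by
    rw [Finset.sum_neg_distrib, mul_neg]
  fin_cases k <;>
    simp only [con, roundCon, constraintVec, mean_pure, mean_Qhat, Fin.zero_eta, Fin.mk_one,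
      Fin.reduceFinMk, Matrix.cons_val]
  · rw [xiHat, ← mul_sub, ← Finset.sum_sub_distrib]
  · rw [hneg, xiHat, ← mul_sub, ← Finset.sum_sub_distrib]
  · rw [Finset.sum_sub_distrib, mul_sub, average_const]

theorem lagr_hat (t : ℕ) (lam : Fin 3 → ℝ) :
    g.lagr (g.xiHat t) (g.Qhat t) lam = (1 / ((t : ℝ) + 1)) *
      ∑ r ∈ Finset.range (t + 1), (g.bestXi (g.lam r) + ∑ k, lam k * g.roundCon r k) := by
  have hcon (k : Fin 3) : lam k * g.con (g.xiHat t) (g.Qhat t) k =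
      (1 / ((t : ℝ) + 1)) * ∑ r ∈ Finset.range (t + 1), lam k * g.roundCon r k := by
    rw [con_hat, ← Finset.mul_sum, mul_left_comm]
  rw [lagr, Finset.sum_congr rfl fun k _ => hcon k, ← Finset.mul_sum, Finset.sum_comm, xiHat,
    ← mul_add, ← Finset.sum_add_distrib]

theorem lagr_lamHat (ξ : ℝ) (Q : PMF ι) (t : ℕ) :
    g.lagr ξ Q (g.lamHat t) =
      (1 / ((t : ℝ) + 1)) * ∑ r ∈ Finset.range (t + 1), g.lagr ξ Q (g.lam r) := by
  have hlam (k : Fin 3) : g.lamHat t k * g.con ξ Q k =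
      (1 / ((t : ℝ) + 1)) * ∑ r ∈ Finset.range (t + 1), g.lam r k * g.con ξ Q k := by
    rw [lamHat_apply, ← Finset.sum_mul, mul_assoc]
  simp only [lagr, Finset.sum_congr rfl fun k _ => hlam k, Finset.sum_add_distrib, mul_add,
    average_const]
  rw [← Finset.mul_sum, Finset.sum_comm]

variable {g} {Bd Bc : ℝ}

theorem average_dualValue_le (hbest : g.IsBestResponse) (hBξ : 0 ≤ g.Bξ) (hB : 0 ≤ g.Bl) (t : ℕ) :
    (1 / ((t : ℝ) + 1)) * ∑ r ∈ Finset.range (t + 1), g.dualValue (g.lam r) ≤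
      g.dualValue (g.lamHat t) := by
  rw [dualValue, lagr_lamHat]
  exact average_mono (fun r =>
    dualValue_le_lagr_pure hbest (g.lam_nonneg hB r) (g.bestXi_mem hBξ _) _) t

theorem lagr_hat_sub_average_dualValue (q : Fin 3 → ℝ) (t : ℕ) :
    g.lagr (g.xiHat t) (g.Qhat t) (g.Bl • q) -
        (1 / ((t : ℝ) + 1)) * ∑ r ∈ Finset.range (t + 1), g.dualValue (g.lam r) =
      g.Bl * ((1 / ((t : ℝ) + 1)) *
        ∑ r ∈ Finset.range (t + 1), ∑ k, (q k - expWeights (g.theta r) k) * g.roundCon r k) := by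
  rw [lagr_hat, ← mul_sub, ← Finset.sum_sub_distrib, mul_left_comm]
  congr 1
  rw [Finset.mul_sum]
  refine Finset.sum_congr rfl fun r _ => ?_
  rw [dualValue_lam, add_sub_add_left_eq_sub, ← Finset.sum_sub_distrib, Finset.mul_sum]
  refine Finset.sum_congr rfl fun k _ => ?_
  rw [lam, lamOf_eq_smul_expWeights, Pi.smul_apply, Pi.smul_apply, smul_eq_mul, smul_eq_mul]
  ring

theorem gap_le (hbest : g.IsBestResponse) (hd : ∀ i, |g.disp i| ≤ Bd) (hc : ∀ i, |g.cost i| ≤ Bc)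
    (hBξ : 0 ≤ g.Bξ) (hB : 0 ≤ g.Bl) (hη : 0 < g.η)
    (hηρ : g.η * rho g.disp g.cost g.epsHat g.Bξ ≤ 1) (t : ℕ) :
    g.gap t ≤ g.Bl * (Real.log 4 / (g.η * (t + 1)) +
      g.η * rho g.disp g.cost g.epsHat g.Bξ ^ 2) := by
  set ρ := rho g.disp g.cost g.epsHat g.Bξ
  set A := (1 / ((t : ℝ) + 1)) * ∑ r ∈ Finset.range (t + 1), g.dualValue (g.lam r)
  have hceps (i : ι) : |g.cost i - g.epsHat| ≤ Bc + |g.epsHat| :=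
    (abs_sub _ _).trans (add_le_add_left (hc i) _)
  obtain ⟨q, hq, hq1, hbestLam⟩ := g.exists_bestLam_eq_smul (g.xiHat t) (g.Qhat t)
  have hdual : A ≤ g.dualValue (g.lamHat t) := average_dualValue_le hbest hBξ hB t
  have hlow : g.dualValue (g.lamHat t) ≤ g.lagr (g.xiHat t) (g.Qhat t) (g.lamHat t) :=
    dualValue_le_lagr hbest hd hc (g.lamHat_nonneg hB t) (g.xiHat_mem hBξ t) _
  have hup : g.lagr (g.xiHat t) (g.Qhat t) (g.lamHat t) ≤
      g.lagr (g.xiHat t) (g.Qhat t) (g.bestLam (g.xiHat t) (g.Qhat t)) := by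
    rw [lagr_bestLam]
    exact g.lagr_le_add_violation (g.lamHat_nonneg hB t) (g.sum_lamHat_le hB t) _ _
  have hregret : g.lagr (g.xiHat t) (g.Qhat t) (g.bestLam (g.xiHat t) (g.Qhat t)) - A ≤
      g.Bl * (Real.log 4 / (g.η * (t + 1)) + g.η * ρ ^ 2) := by
    rw [hbestLam, lagr_hat_sub_average_dualValue]
    refine mul_le_mul_of_nonneg_left ?_ hB
    have hexp := regret_expWeights_le (θ := g.theta) (v := g.roundCon) rfl (fun _ => rfl) hη
      (ρ := ρ) (fun r => abs_constraintVec_pure_le_rho hd hceps (g.bestXi_mem hBξ _) _) hηρ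
      (t + 1) hq hq1
    refine (mul_le_mul_of_nonneg_left hexp (by positivity)).trans_eq ?_
    rw [Fintype.card_fin]
    push_cast
    norm_num only
    field_simp
  refine max_le ?_ ?_
  · change _ - g.dualValue _ ≤ _
    linarith
  · linarith

theorem exists_stopsAt (hbest : g.IsBestResponse) (hd : ∀ i, |g.disp i| ≤ Bd)
    (hc : ∀ i, |g.cost i| ≤ Bc) (hBξ : 0 < g.Bξ) (hB : 0 < g.Bl) (hν : 0 < g.ν)
    (hνB : g.ν ≤ g.Bξ * g.Bl)
    (hη : g.η = g.ν / (2 * rho g.disp g.cost g.epsHat g.Bξ ^ 2 * g.Bl)) :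
    ∃ t, g.StopsAt t ∧ ((t + 1 : ℕ) : ℝ) ≤
      4 * Real.log 4 * rho g.disp g.cost g.epsHat g.Bξ ^ 2 * g.Bl ^ 2 / g.ν ^ 2 + 1 := by
  classical
  have : Nonempty ι := ⟨g.bestH 0⟩
  have hρ_ge : g.Bξ / 2 ≤ rho g.disp g.cost g.epsHat g.Bξ := half_le_rho hd
    (fun i => (abs_sub _ _).trans (add_le_add_left (hc i) _)) hBξ.le
  set ρ := rho g.disp g.cost g.epsHat g.Bξ
  have hρ : 0 < ρ := (half_pos hBξ).trans_le hρ_ge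
  have hηρ : g.η * ρ ≤ 1 := by
    have hνρ : g.ν ≤ 2 * ρ * g.Bl :=
      hνB.trans (mul_le_mul_of_nonneg_right (by linarith) hB.le)
    calc g.η * ρ = g.ν / (2 * ρ * g.Bl) := by rw [hη]; field_simp
      _ ≤ 1 := div_le_one_of_le₀ hνρ (by positivity)
  set x := 4 * Real.log 4 * ρ ^ 2 * g.Bl ^ 2 / g.ν ^ 2 with hx
  have hx₀ : 0 ≤ x := by positivity
  have hgap : g.gap ⌊x⌋₊ ≤ g.ν :=
    calc g.gap ⌊x⌋₊ ≤ g.Bl * (Real.log 4 / (g.η * (⌊x⌋₊ + 1)) + g.η * ρ ^ 2) :=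
          gap_le hbest hd hc hBξ.le hB.le (by rw [hη]; positivity) hηρ _
      _ = x / (⌊x⌋₊ + 1) * (g.ν / 2) + g.ν / 2 := by rw [hη, hx]; field_simp; ring
      _ ≤ 1 * (g.ν / 2) + g.ν / 2 := by
          gcongr
          exact div_le_one_of_le₀ (Nat.lt_floor_add_one x).le (by positivity)
      _ = g.ν := by ring
  have hex : ∃ t, g.gap t ≤ g.ν := ⟨_, hgap⟩
  refine ⟨Nat.find hex, ⟨Nat.find_spec hex, fun r hr => not_le.1 (Nat.find_min hex hr)⟩, ?_⟩
  rw [Nat.cast_succ]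
  exact add_le_add_left ((Nat.cast_le.2 (Nat.find_min' hex hgap)).trans (Nat.floor_le hx₀)) 1

theorem xiHat_add_violation_le (hbest : g.IsBestResponse) (hd : ∀ i, |g.disp i| ≤ g.Bξ)
    (hc : ∀ i, |g.cost i| ≤ Bc) (hB : 0 ≤ g.Bl) {t : ℕ} (ht : g.gap t ≤ g.ν) {Q : PMF ι}
    (hQ : mean Q g.cost ≤ g.epsHat) :
    g.xiHat t + g.Bl * g.violation (g.xiHat t) (g.Qhat t) ≤ |mean Q g.disp| + 2 * g.ν := by
  obtain ⟨hprimal, hdual⟩ := max_le_iff.1 (show max _ _ ≤ _ from ht)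
  have hlam := g.lamHat_nonneg hB t
  have hle : g.dualValue (g.lamHat t) ≤ g.lagr |mean Q g.disp| Q (g.lamHat t) :=
    dualValue_le_lagr hbest hd hc hlam ⟨abs_nonneg _, abs_mean_le Q hd⟩ Q
  have hfeasible (k : Fin 3) : g.con |mean Q g.disp| Q k ≤ 0 := by
    fin_cases k
    exacts [sub_nonpos.2 (le_abs_self _), sub_nonpos.2 (neg_le_abs _), sub_nonpos.2 hQ]
  have hlagr : g.lagr |mean Q g.disp| Q (g.lamHat t) ≤ |mean Q g.disp| :=
    add_le_of_nonpos_right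
      (Finset.sum_nonpos fun k _ => mul_nonpos_of_nonneg_of_nonpos (hlam k) (hfeasible k))
  rw [lagr_bestLam] at hdual
  unfold dualValue at hle
  linarith

theorem mean_cost_Qhat_le (hbest : g.IsBestResponse) (hd : ∀ i, |g.disp i| ≤ g.Bξ)
    (hc : ∀ i, |g.cost i| ≤ Bc) (hBξ : 0 ≤ g.Bξ) (hB : 0 < g.Bl) {t : ℕ} (ht : g.gap t ≤ g.ν)
    {Q : PMF ι} (hQ : mean Q g.cost ≤ g.epsHat) :
    mean (g.Qhat t) g.cost ≤ g.epsHat + (g.Bξ + 2 * g.ν) / g.Bl := by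
  have hviolation := xiHat_add_violation_le hbest hd hc hB.le ht hQ
  have hdisp := abs_mean_le Q hd
  have hcost := g.con_le_violation (g.xiHat t) (g.Qhat t) 2
  rw [← sub_le_iff_le_add']
  refine hcost.trans ((le_div_iff₀' hB).2 ?_)
  linarith [(g.xiHat_mem hBξ t).1]

theorem abs_mean_disp_Qhat_le (hbest : g.IsBestResponse) (hd : ∀ i, |g.disp i| ≤ g.Bξ)
    (hc : ∀ i, |g.cost i| ≤ Bc) (hB : 1 ≤ g.Bl) {t : ℕ} (ht : g.gap t ≤ g.ν) {Q : PMF ι}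
    (hQ : mean Q g.cost ≤ g.epsHat) :
    |mean (g.Qhat t) g.disp| ≤ |mean Q g.disp| + 2 * g.ν := by
  refine le_trans ?_ (xiHat_add_violation_le hbest hd hc (zero_le_one.trans hB) ht hQ)
  have hviolation := le_mul_of_one_le_left (g.violation_nonneg (g.xiHat t) (g.Qhat t)) hB
  exact abs_le'.2
    ⟨sub_le_iff_le_add'.1 ((g.con_le_violation (g.xiHat t) (g.Qhat t) 0).trans hviolation),
      sub_le_iff_le_add'.1 ((g.con_le_violation (g.xiHat t) (g.Qhat t) 1).trans hviolation)⟩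

end Rounds

end AlgInput

section SupSum

variable {ι T : Type*} [Fintype ι] {a b : T → ι → ℝ} {c c' : ℝ}

/-- Supremum over a class of vectors of the absolute values of their coordinate sums: the quantity
that uniform deviations and Rademacher averages are made of. -/
noncomputable def supSum (a : T → ι → ℝ) : ℝ := ⨆ f, |∑ i, a f i|

theorem abs_sum_le_card_mul {x : ι → ℝ} (h : ∀ i, |x i| ≤ c) : |∑ i, x i| ≤ Fintype.card ι * c :=
  calc |∑ i, x i| ≤ ∑ i, |x i| := Finset.abs_sum_le_sum_abs _ _
    _ ≤ ∑ _i : ι, c := Finset.sum_le_sum fun i _ => h i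
    _ = Fintype.card ι * c := by rw [Finset.sum_const, Finset.card_univ, nsmul_eq_mul]

theorem le_supSum (h : ∀ f i, |a f i| ≤ c) (f : T) : |∑ i, a f i| ≤ supSum a :=
  le_ciSup (f := fun f => |∑ i, a f i|)
    ⟨_, forall_mem_range.2 fun f => abs_sum_le_card_mul (h f)⟩ f

theorem supSum_nonneg (a : T → ι → ℝ) : 0 ≤ supSum a := Real.iSup_nonneg fun _ => abs_nonneg _

theorem supSum_le_card_mul [Nonempty T] (h : ∀ f i, |a f i| ≤ c) :
    supSum a ≤ Fintype.card ι * c := ciSup_le fun f => abs_sum_le_card_mul (h f)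

theorem supSum_add_le [Nonempty T] (ha : ∀ f i, |a f i| ≤ c) (hb : ∀ f i, |b f i| ≤ c') :
    supSum (fun f i => a f i + b f i) ≤ supSum a + supSum b := by
  refine ciSup_le fun f => ?_
  rw [Finset.sum_add_distrib]
  exact (abs_add_le _ _).trans (add_le_add (le_supSum ha f) (le_supSum hb f))

theorem supSum_const_mul (hc : 0 ≤ c) (a : T → ι → ℝ) :
    supSum (fun f i => c * a f i) = c * supSum a := by
  simp only [supSum, ← Finset.mul_sum, abs_mul, abs_of_nonneg hc]
  rw [Real.mul_iSup_of_nonneg hc]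

theorem supSum_le_add_of_forall_ne [Nonempty T] (hb : ∀ f i, |b f i| ≤ c') {j : ι}
    (hne : ∀ f, ∀ i ≠ j, a f i = b f i) (hj : ∀ f, |a f j - b f j| ≤ c) :
    supSum a ≤ supSum b + c := by
  refine ciSup_le fun f => ?_
  have hsum : ∑ i, a f i = ∑ i, b f i + (a f j - b f j) := by
    rw [← sub_eq_iff_eq_add', ← Finset.sum_sub_distrib]
    exact Finset.sum_eq_single j (fun i _ hi => sub_eq_zero.2 (hne f i hi)) (by simp)
  rw [hsum]
  exact (abs_add_le _ _).trans (add_le_add (le_supSum hb f) (hj f))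

end SupSum

section Signs

open scoped BigOperators

theorem expect_bool_exp_le {x : Bool → ℝ} {c : ℝ} (h : |x true - x false| ≤ 2 * c) :
    𝔼 b, Real.exp (x b) ≤ Real.exp (𝔼 b, x b + c ^ 2 / 2) := by
  set m := 𝔼 b, x b with hm
  set d := (x true - x false) / 2 with hd
  rw [Fintype.expect_eq_sum_div_card, Fintype.sum_bool, Fintype.card_bool, Nat.cast_ofNat] at hm
  have hd_sq : d ^ 2 ≤ c ^ 2 :=
    sq_le_sq' (by linarith [(abs_le.1 h).1]) (by linarith [(abs_le.1 h).2])
  calc 𝔼 b, Real.exp (x b) = Real.exp m * Real.cosh d := by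
        rw [Fintype.expect_eq_sum_div_card, Fintype.sum_bool, Fintype.card_bool, Nat.cast_ofNat,
          Real.cosh_eq, mul_div_assoc', mul_add, ← Real.exp_add, ← Real.exp_add]
        congr 4 <;> linarith
    _ ≤ Real.exp m * Real.exp (c ^ 2 / 2) :=
        mul_le_mul_of_nonneg_left ((Real.cosh_le_exp_half_sq d).trans
          (Real.exp_le_exp.2 (div_le_div_of_nonneg_right hd_sq two_pos.le))) (Real.exp_pos m).le
    _ = Real.exp (m + c ^ 2 / 2) := (Real.exp_add _ _).symm

theorem expect_fin_succ_bool {n : ℕ} (G : (Fin (n + 1) → Bool) → ℝ) :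
    𝔼 σ, G σ = 𝔼 b, 𝔼 σ : Fin n → Bool, G (Fin.cons b σ) := by
  rw [← Finset.expect_product', Finset.univ_product_univ]
  exact (Fintype.expect_equiv (Fin.consEquiv fun _ => Bool) _ _ fun _ => rfl).symm

theorem expect_exp_le_of_bounded_differences_fin {n : ℕ} (G : (Fin n → Bool) → ℝ) (c : Fin n → ℝ)
    (hG : ∀ σ i b, |G (Function.update σ i b) - G σ| ≤ 2 * c i) :
    𝔼 σ, Real.exp (G σ) ≤ Real.exp (𝔼 σ, G σ + ∑ i, c i ^ 2 / 2) := by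
  induction n with
  | zero => simp
  | succ n ih =>
    have htail (b : Bool) := ih (fun σ => G (Fin.cons b σ)) (fun i => c i.succ) fun σ i b' => by
      rw [Fin.cons_update]
      exact hG _ _ _
    have hhead : |𝔼 σ : Fin n → Bool, G (Fin.cons true σ) -
        𝔼 σ : Fin n → Bool, G (Fin.cons false σ)| ≤ 2 * c 0 := by
      rw [← Finset.expect_sub_distrib]
      refine (Finset.abs_expect_le _ _).trans (Finset.expect_le Finset.univ_nonempty fun σ _ => ?_)
      simpa only [Fin.update_cons_zero] using hG (Fin.cons false σ) 0 true
    rw [expect_fin_succ_bool, expect_fin_succ_bool G, Fin.sum_univ_succ]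
    calc 𝔼 b, 𝔼 σ : Fin n → Bool, Real.exp (G (Fin.cons b σ))
        ≤ 𝔼 b, Real.exp (𝔼 σ : Fin n → Bool, G (Fin.cons b σ)) *
            Real.exp (∑ i : Fin n, c i.succ ^ 2 / 2) :=
          Finset.expect_le_expect fun b _ => by rw [← Real.exp_add]; exact htail b
      _ = (𝔼 b, Real.exp (𝔼 σ : Fin n → Bool, G (Fin.cons b σ))) *
            Real.exp (∑ i : Fin n, c i.succ ^ 2 / 2) := (Finset.expect_mul _ _ _).symm
      _ ≤ Real.exp (𝔼 b, 𝔼 σ : Fin n → Bool, G (Fin.cons b σ) + c 0 ^ 2 / 2) *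
            Real.exp (∑ i : Fin n, c i.succ ^ 2 / 2) :=
          mul_le_mul_of_nonneg_right (expect_bool_exp_le hhead) (Real.exp_pos _).le
      _ = _ := by rw [← Real.exp_add, add_assoc]

variable {ι T : Type*} [Fintype ι] [DecidableEq ι]

theorem expect_exp_le_of_bounded_differences (G : (ι → Bool) → ℝ) (c : ι → ℝ)
    (hG : ∀ σ i b, |G (Function.update σ i b) - G σ| ≤ 2 * c i) :
    𝔼 σ, Real.exp (G σ) ≤ Real.exp (𝔼 σ, G σ + ∑ i, c i ^ 2 / 2) := by
  let e := Fintype.equivFin ι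
  have hreindex (F : (ι → Bool) → ℝ) : 𝔼 σ, F σ = 𝔼 σ : Fin (Fintype.card ι) → Bool, F (σ ∘ e) :=
    (Fintype.expect_equiv (e.symm.arrowCongr (Equiv.refl Bool)) _ _ fun _ => rfl).symm
  rw [hreindex, hreindex G, ← e.symm.sum_comp]
  refine expect_exp_le_of_bounded_differences_fin (fun σ => G (σ ∘ e)) _ fun σ i b => ?_
  rw [Function.update_comp_equiv]
  exact hG _ _ _

/-- The sign `±1` encoded by a Boolean, as in the definition of the Rademacher complexity. -/
noncomputable def sgn (b : Bool) : ℝ := if b then 1 else -1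

theorem abs_sgn_mul (b : Bool) (x : ℝ) : |sgn b * x| = |x| := by cases b <;> simp [sgn]

/-- Rademacher average of a class of vectors, without the normalization by their length. -/
noncomputable def rademacherSum (a : T → ι → ℝ) : ℝ :=
  𝔼 σ : ι → Bool, supSum fun f i => sgn (σ i) * a f i

theorem rademacherSum_add_le [Nonempty T] {a b : T → ι → ℝ} {c c' : ℝ} (ha : ∀ f i, |a f i| ≤ c)
    (hb : ∀ f i, |b f i| ≤ c') :
    rademacherSum (fun f i => a f i + b f i) ≤ rademacherSum a + rademacherSum b := by
  rw [rademacherSum, rademacherSum, rademacherSum, ← Finset.expect_add_distrib]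
  refine Finset.expect_le_expect fun σ _ => ?_
  simp only [mul_add]
  exact supSum_add_le (fun f i => (abs_sgn_mul _ _).trans_le (ha f i))
    fun f i => (abs_sgn_mul _ _).trans_le (hb f i)

theorem rademacherSum_const_mul {c : ℝ} (hc : 0 ≤ c) (a : T → ι → ℝ) :
    rademacherSum (fun f i => c * a f i) = c * rademacherSum a := by
  simp only [rademacherSum, Finset.mul_expect, ← supSum_const_mul hc, mul_left_comm]

theorem rademacherSum_sgn_mul (τ : ι → Bool) (a : T → ι → ℝ) :
    rademacherSum (fun f i => sgn (τ i) * a f i) = rademacherSum a := by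
  have hinv : Function.Involutive fun (σ : ι → Bool) i => σ i == τ i := fun σ => by
    ext i
    change ((σ i == τ i) == τ i) = σ i
    cases σ i <;> cases τ i <;> rfl
  refine Fintype.expect_equiv hinv.toPerm _ _ fun σ => ?_
  have hsgn (b b' : Bool) : sgn b * sgn b' = sgn (b == b') := by
    cases b <;> cases b' <;> simp [sgn]
  simp only [← mul_assoc, hsgn, Function.Involutive.coe_toPerm]

theorem rademacherSum_sub_le [Nonempty T] {a b : T → ι → ℝ} {c c' : ℝ} (ha : ∀ f i, |a f i| ≤ c)
    (hb : ∀ f i, |b f i| ≤ c') :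
    rademacherSum (fun f i => a f i - b f i) ≤ rademacherSum a + rademacherSum b := by
  rw [← rademacherSum_sgn_mul (fun _ => false) b]
  simpa [sgn, sub_eq_add_neg] using
    rademacherSum_add_le (b := fun f i => -b f i) ha fun f i => (abs_neg _).trans_le (hb f i)

theorem convexOn_rademacherSum_mul [Nonempty T] {a : T → ι → ℝ} {B : ℝ} (ha : ∀ f i, |a f i| ≤ B) :
    ConvexOn ℝ univ fun c : ι → ℝ => rademacherSum fun f i => c i * a f i := by
  have hbound (r : ℝ) (z : ι → ℝ) (f : T) (i : ι) : |r * (z i * a f i)| ≤ |r| * (‖z‖ * B) := by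
    rw [abs_mul, abs_mul]
    gcongr
    exacts [norm_le_pi_norm z i, ha f i]
  refine ⟨convex_univ, fun x _ y _ p q hp hq _ => ?_⟩
  simp only [smul_eq_mul, Pi.add_apply, Pi.smul_apply, ← rademacherSum_const_mul hp,
    ← rademacherSum_const_mul hq, add_mul, mul_assoc]
  exact rademacherSum_add_le (hbound p x) (hbound q y)

-- By convexity in `c`, it is enough to consider the vertices of the cube `[-1, 1]^ι`.
theorem rademacherSum_mul_le [Nonempty T] {a : T → ι → ℝ} {B : ℝ} (ha : ∀ f i, |a f i| ≤ B)
    {c : ι → ℝ} (hc : ∀ i, |c i| ≤ 1) :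
    rademacherSum (fun f i => c i * a f i) ≤ rademacherSum a := by
  have hmem : c ∈ convexHull ℝ (univ.pi fun _ : ι => ({-1, 1} : Set ℝ)) := by
    refine mem_convexHull_pi fun i _ => ?_
    rw [convexHull_pair, segment_eq_Icc (by norm_num)]
    exact abs_le.1 (hc i)
  obtain ⟨y, hy, hle⟩ :=
    (convexOn_rademacherSum_mul ha).exists_ge_of_mem_convexHull (subset_univ _) hmem
  have hsgn (i : ι) : ∃ b, sgn b = y i := by
    rcases hy i (mem_univ i) with h | h
    · exact ⟨false, by simp [sgn, h]⟩
    · exact ⟨true, by simp [sgn, mem_singleton_iff.1 h]⟩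
  choose τ hτ using hsgn
  refine hle.trans_eq ?_
  simp only [← hτ, rademacherSum_sgn_mul]

theorem expect_exp_supSum_le [Nonempty T] {a : T → ι → ℝ} {c : ℝ} (ha : ∀ f i, |a f i| ≤ c)
    {lam : ℝ} (hlam : 0 ≤ lam) :
    𝔼 σ : ι → Bool, Real.exp (lam * supSum fun f i => sgn (σ i) * a f i) ≤
      Real.exp (lam * rademacherSum a + Fintype.card ι * ((lam * c) ^ 2 / 2)) := by
  have hle (σ τ : ι → Bool) (j : ι) (hne : ∀ i ≠ j, σ i = τ i) :
      (supSum fun f i => sgn (σ i) * a f i) ≤ (supSum fun f i => sgn (τ i) * a f i) + 2 * c := by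
    refine supSum_le_add_of_forall_ne (j := j) (fun f i => (abs_sgn_mul _ _).trans_le (ha f i))
      (fun f i hi => by rw [hne i hi]) fun f => (abs_sub _ _).trans ?_
    rw [abs_sgn_mul, abs_sgn_mul, ← two_mul]
    exact mul_le_mul_of_nonneg_left (ha f j) two_pos.le
  have hdiff := expect_exp_le_of_bounded_differences
    (fun σ : ι → Bool => lam * supSum fun f i => sgn (σ i) * a f i) (fun _ => lam * c)
    fun σ j b => by
      rw [← mul_sub, abs_mul, abs_of_nonneg hlam, mul_left_comm]
      refine mul_le_mul_of_nonneg_left (abs_sub_le_iff.2 ⟨?_, ?_⟩) hlam <;>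
        rw [sub_le_iff_le_add']
      · exact hle _ _ j fun i hi => Function.update_of_ne hi _ _
      · exact hle _ _ j fun i hi => (Function.update_of_ne hi _ _).symm
  rwa [← Finset.mul_expect, Finset.sum_const, Finset.card_univ, nsmul_eq_mul] at hdiff

end Signs

section Expect

open scoped BigOperators

variable {α κ : Type*} [MeasurableSpace α] {μ : Measure α} {J : Finset κ}

theorem abs_expect_le_of_forall_le (hJ : J.Nonempty) {x : κ → ℝ} {c : ℝ} (h : ∀ j ∈ J, |x j| ≤ c) :
    |𝔼 j ∈ J, x j| ≤ c :=
  (Finset.abs_expect_le _ _).trans (Finset.expect_le hJ h)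

theorem exp_expect_le (hJ : J.Nonempty) (x : κ → ℝ) :
    Real.exp (𝔼 j ∈ J, x j) ≤ 𝔼 j ∈ J, Real.exp (x j) := by
  have hcard : (J.card : ℝ) ≠ 0 := by exact_mod_cast hJ.card_pos.ne'
  simpa [Finset.expect_eq_sum_div_card, ← Finset.mul_sum, div_eq_inv_mul] using
    convexOn_exp.map_sum_le (t := J) (w := fun _ => (J.card : ℝ)⁻¹) (p := x)
      (fun _ _ => by positivity) (by simp [hcard]) fun _ _ => mem_univ _

theorem integrable_expect {f : κ → α → ℝ} (hf : ∀ j ∈ J, Integrable (f j) μ) :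
    Integrable (fun x => 𝔼 j ∈ J, f j x) μ := by
  simp only [Finset.expect_eq_sum_div_card]
  exact (integrable_finsetSum J hf).div_const _

theorem integral_expect {f : κ → α → ℝ} (hf : ∀ j ∈ J, Integrable (f j) μ) :
    ∫ x, 𝔼 j ∈ J, f j x ∂μ = 𝔼 j ∈ J, ∫ x, f j x ∂μ := by
  simp only [Finset.expect_eq_sum_div_card, integral_div, integral_finsetSum J hf]

theorem integral_exp_mul_expect_le (hJ : J.Nonempty) {H : κ → α → ℝ} {lam M : ℝ}
    (hintegrable : ∀ j ∈ J, Integrable (fun x => Real.exp (lam * H j x)) μ)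
    (hM : ∀ j ∈ J, ∫ x, Real.exp (lam * H j x) ∂μ ≤ M) :
    ∫ x, Real.exp (lam * 𝔼 j ∈ J, H j x) ∂μ ≤ M :=
  calc ∫ x, Real.exp (lam * 𝔼 j ∈ J, H j x) ∂μ
      ≤ ∫ x, 𝔼 j ∈ J, Real.exp (lam * H j x) ∂μ :=
        integral_mono_of_nonneg (ae_of_all _ fun _ => (Real.exp_pos _).le)
          (integrable_expect hintegrable) (ae_of_all _ fun x => by
            simpa only [Finset.mul_expect] using exp_expect_le hJ fun j => lam * H j x)
    _ = 𝔼 j ∈ J, ∫ x, Real.exp (lam * H j x) ∂μ := integral_expect hintegrable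
    _ ≤ M := Finset.expect_le hJ hM

theorem integrable_exp_mul_of_bounded [IsFiniteMeasure μ] {F : α → ℝ} (hF : AEMeasurable F μ)
    {B : ℝ} (hFB : ∀ x, |F x| ≤ B) (lam : ℝ) : Integrable (fun x => Real.exp (lam * F x)) μ := by
  refine Integrable.of_bound (C := Real.exp (|lam| * B))
    (Real.measurable_exp.comp_aemeasurable (hF.const_mul lam)).aestronglyMeasurable
    (ae_of_all _ fun x => ?_)
  rw [Real.norm_eq_abs, Real.abs_exp, Real.exp_le_exp]
  exact (le_abs_self _).trans
    ((abs_mul _ _).trans_le (mul_le_mul_of_nonneg_left (hFB x) (abs_nonneg _)))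

theorem measureReal_ge_le_of_mgf_le [IsFiniteMeasure μ] {H : α → ℝ} {m v τ : ℝ} (hv : 0 < v)
    (hτ : 0 ≤ τ) (hintegrable : ∀ lam : ℝ, Integrable (fun x => Real.exp (lam * H x)) μ)
    (hmgf : ∀ lam : ℝ, 0 ≤ lam → ∫ x, Real.exp (lam * H x) ∂μ ≤
      Real.exp (lam * m + v * lam ^ 2 / 2)) :
    μ.real {x | m + τ ≤ H x} ≤ Real.exp (-τ ^ 2 / (2 * v)) := by
  have hlam : 0 ≤ τ / v := by positivity
  refine (ProbabilityTheory.measure_ge_le_exp_mul_mgf (m + τ) hlam (hintegrable _)).trans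
    ((mul_le_mul_of_nonneg_left (hmgf _ hlam) (Real.exp_pos _).le).trans_eq ?_)
  rw [← Real.exp_add]
  congr 1
  field_simp
  ring

end Expect

section Symmetrization

open scoped BigOperators

variable {Ω ι T : Type*} {g : T → Ω → ℝ} {B : ℝ}

/-- Exchange of sample and ghost sample at the coordinates where `σ` is `false`. -/
def swapBy (σ : ι → Bool) (u : ι → Ω × Ω) : ι → Ω × Ω :=
  fun i => if σ i then u i else (u i).swap

theorem abs_ghost_le (hb : ∀ f ω, |g f ω| ≤ B) (u : ι → Ω × Ω) (f : T) (i : ι) :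
    |g f (u i).1 - g f (u i).2| ≤ 2 * B := by
  rw [two_mul]
  exact (abs_sub _ _).trans (add_le_add (hb _ _) (hb _ _))

variable [Fintype ι]

/-- Supremum over the class of the differences of the sums over a sample and a ghost sample. -/
noncomputable def ghostSup (g : T → Ω → ℝ) (u : ι → Ω × Ω) : ℝ :=
  supSum fun f i => g f (u i).1 - g f (u i).2

theorem abs_ghostSup_le [Nonempty T] (hb : ∀ f ω, |g f ω| ≤ B) (u : ι → Ω × Ω) :
    |ghostSup g u| ≤ Fintype.card ι * (2 * B) := by
  rw [ghostSup, abs_of_nonneg (supSum_nonneg _)]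
  exact supSum_le_card_mul (abs_ghost_le hb u)

theorem ghostSup_swapBy (σ : ι → Bool) (u : ι → Ω × Ω) :
    ghostSup g (swapBy σ u) = supSum fun f i => sgn (σ i) * (g f (u i).1 - g f (u i).2) := by
  unfold ghostSup swapBy
  congr! 3 with f i
  cases σ i <;> simp [sgn]

variable [MeasurableSpace Ω] {P : Measure Ω} [IsProbabilityMeasure P]

theorem measurePreserving_swapBy (σ : ι → Bool) :
    MeasurePreserving (swapBy (Ω := Ω) σ) (Measure.pi fun _ => P.prod P)
      (Measure.pi fun _ => P.prod P) :=
  measurePreserving_pi (fun _ => P.prod P) (fun _ => P.prod P)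
    (f := fun i (p : Ω × Ω) => if σ i then p else p.swap) fun i => by
      cases σ i
      · simpa using Measure.measurePreserving_swap
      · simpa using! MeasurePreserving.id (P.prod P)

theorem integral_comp_ghostSup [DecidableEq ι] {F : ℝ → ℝ}
    (hF : Integrable (fun u : ι → Ω × Ω => F (ghostSup g u)) (Measure.pi fun _ => P.prod P)) :
    ∫ u : ι → Ω × Ω, F (ghostSup g u) ∂(Measure.pi fun _ => P.prod P) =
      ∫ u : ι → Ω × Ω, 𝔼 σ : ι → Bool,
        F (supSum fun f i => sgn (σ i) * (g f (u i).1 - g f (u i).2))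
          ∂(Measure.pi fun _ => P.prod P) := by
  have hswap (σ : ι → Bool) := measurePreserving_swapBy (P := P) σ
  have hintegrable (σ : ι → Bool) : Integrable (fun u : ι → Ω × Ω => F (ghostSup g (swapBy σ u)))
      (Measure.pi fun _ => P.prod P) := (hswap σ).integrable_comp_of_integrable hF
  have hinv (σ : ι → Bool) :
      ∫ u : ι → Ω × Ω, F (ghostSup g (swapBy σ u)) ∂(Measure.pi fun _ => P.prod P) =
        ∫ u : ι → Ω × Ω, F (ghostSup g u) ∂(Measure.pi fun _ => P.prod P) := by
    have hF_map := hF.aestronglyMeasurable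
    rw [← (hswap σ).map_eq] at hF_map
    rw [← integral_map (hswap σ).aemeasurable hF_map, (hswap σ).map_eq]
  simp only [← ghostSup_swapBy, integral_expect fun σ _ => hintegrable σ, hinv,
    Fintype.expect_const]

/-- The expected deviation from an independent ghost sample. -/
noncomputable def ghostMean (P : Measure Ω) (g : T → Ω → ℝ) (s : ι → Ω) : ℝ :=
  ∫ s' : ι → Ω, ghostSup g (fun i => (s i, s' i)) ∂(Measure.pi fun _ => P)

theorem aemeasurable_ghostSup_prod
    (hmeas : AEMeasurable (ghostSup (ι := ι) g) (Measure.pi fun _ => P.prod P)) :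
    AEMeasurable (fun p : (ι → Ω) × (ι → Ω) => ghostSup g fun i => (p.1 i, p.2 i))
      ((Measure.pi fun _ => P).prod (Measure.pi fun _ => P)) :=
  hmeas.comp_quasiMeasurePreserving
    ((measurePreserving_arrowProdEquivProdArrow Ω Ω ι (fun _ => P) fun _ => P).symm
      _).quasiMeasurePreserving

variable [Nonempty T]

theorem integral_exp_ghostSup_le [DecidableEq ι] (hb : ∀ f ω, |g f ω| ≤ B)
    (hmeas : AEMeasurable (ghostSup (ι := ι) g) (Measure.pi fun _ => P.prod P)) {A : ℝ}
    (hrad : ∀ s : ι → Ω, rademacherSum (fun f i => g f (s i)) ≤ A) {lam : ℝ} (hlam : 0 ≤ lam) :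
    ∫ u, Real.exp (lam * ghostSup g u) ∂(Measure.pi fun _ : ι => P.prod P) ≤
      Real.exp (lam * (2 * A) + 4 * Fintype.card ι * B ^ 2 * lam ^ 2 / 2) := by
  rw [integral_comp_ghostSup (F := fun x => Real.exp (lam * x))
    (integrable_exp_mul_of_bounded hmeas (abs_ghostSup_le hb) lam)]
  have hbound (u : ι → Ω × Ω) :
      𝔼 σ : ι → Bool, Real.exp (lam * supSum fun f i => sgn (σ i) * (g f (u i).1 - g f (u i).2)) ≤
        Real.exp (lam * (2 * A) + 4 * Fintype.card ι * B ^ 2 * lam ^ 2 / 2) := by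
    have hdiff : rademacherSum (fun f i => g f (u i).1 - g f (u i).2) ≤ 2 * A :=
      calc _ ≤ rademacherSum (fun f i => g f (u i).1) + rademacherSum (fun f i => g f (u i).2) :=
            rademacherSum_sub_le (fun _ _ => hb _ _) fun _ _ => hb _ _
        _ ≤ 2 * A := by rw [two_mul]; exact add_le_add (hrad _) (hrad _)
    refine (expect_exp_supSum_le (abs_ghost_le hb u) hlam).trans (Real.exp_le_exp.2 ?_)
    exact add_le_add (mul_le_mul_of_nonneg_left hdiff hlam) (by ring_nf; rfl)
  simpa using integral_mono_of_nonneg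
    (ae_of_all _ fun u => Finset.expect_nonneg fun _ _ => (Real.exp_pos _).le)
    (integrable_const _) (ae_of_all (Measure.pi fun _ : ι => P.prod P) hbound)

theorem integrable_ghostSup_prod (hb : ∀ f ω, |g f ω| ≤ B)
    (hmeas : AEMeasurable (ghostSup (ι := ι) g) (Measure.pi fun _ => P.prod P)) :
    Integrable (fun p : (ι → Ω) × (ι → Ω) => ghostSup g fun i => (p.1 i, p.2 i))
      ((Measure.pi fun _ => P).prod (Measure.pi fun _ => P)) :=
  Integrable.of_bound (aemeasurable_ghostSup_prod hmeas).aestronglyMeasurable _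
    (ae_of_all _ fun _ => abs_ghostSup_le hb _)

theorem aemeasurable_ghostMean (hb : ∀ f ω, |g f ω| ≤ B)
    (hmeas : AEMeasurable (ghostSup (ι := ι) g) (Measure.pi fun _ => P.prod P)) :
    AEMeasurable (ghostMean P g) (Measure.pi fun _ : ι => P) :=
  (integrable_ghostSup_prod hb hmeas).aestronglyMeasurable.integral_prod_right'.aemeasurable

theorem abs_ghostMean_le (hb : ∀ f ω, |g f ω| ≤ B) (s : ι → Ω) :
    |ghostMean P g s| ≤ Fintype.card ι * (2 * B) := by
  simpa [ghostMean] using norm_integral_le_of_norm_le_const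
    (μ := Measure.pi fun _ : ι => P) (f := fun s' => ghostSup g fun i => (s i, s' i))
    (ae_of_all _ fun _ => abs_ghostSup_le hb _)

theorem integral_sum_sub_ghost {h : Ω → ℝ} (hh : Integrable h P) (s : ι → Ω) :
    ∫ s' : ι → Ω, ∑ i, (h (s i) - h (s' i)) ∂(Measure.pi fun _ => P) =
      ∑ i, h (s i) - Fintype.card ι * ∫ ω, h ω ∂P := by
  have hintegrable (i : ι) := integrable_comp_eval (μ := fun _ : ι => P) (i := i) hh
  have heval (i : ι) := integral_comp_eval (μ := fun _ : ι => P) (i := i) hh.aestronglyMeasurable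
  rw [integral_finsetSum (f := fun i (s' : ι → Ω) => h (s i) - h (s' i)) _
    fun i _ => (integrable_const _).sub (hintegrable i)]
  simp [integral_sub (integrable_const _) (hintegrable _), heval]

theorem abs_sum_sub_integral_le_ghostMean (hg : ∀ f, Measurable (g f)) (hb : ∀ f ω, |g f ω| ≤ B)
    (hmeas : AEMeasurable (ghostSup (ι := ι) g) (Measure.pi fun _ => P.prod P)) :
    ∀ᵐ s ∂(Measure.pi fun _ : ι => P), ∀ f,
      |∑ i, g f (s i) - Fintype.card ι * ∫ ω, g f ω ∂P| ≤ ghostMean P g s := by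
  filter_upwards [(integrable_ghostSup_prod hb hmeas).prod_right_ae] with s hs f
  rw [← integral_sum_sub_ghost
    (Integrable.of_bound (hg f).aestronglyMeasurable _ (ae_of_all _ (hb f))) s]
  exact abs_integral_le_integral_abs.trans (integral_mono_of_nonneg
    (ae_of_all _ fun _ => abs_nonneg _) hs
    (ae_of_all _ fun s' => le_supSum (abs_ghost_le hb fun i => (s i, s' i)) f))

theorem integral_exp_ghostMean_le [DecidableEq ι] (hb : ∀ f ω, |g f ω| ≤ B)
    (hmeas : AEMeasurable (ghostSup (ι := ι) g) (Measure.pi fun _ => P.prod P)) {A : ℝ}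
    (hrad : ∀ s : ι → Ω, rademacherSum (fun f i => g f (s i)) ≤ A) {lam : ℝ} (hlam : 0 ≤ lam) :
    ∫ s, Real.exp (lam * ghostMean P g s) ∂(Measure.pi fun _ : ι => P) ≤
      Real.exp (lam * (2 * A) + 4 * Fintype.card ι * B ^ 2 * lam ^ 2 / 2) := by
  have hexp := integrable_exp_mul_of_bounded (aemeasurable_ghostSup_prod hmeas)
    (fun p => abs_ghostSup_le hb fun i => (p.1 i, p.2 i)) lam
  have hjensen : ∀ᵐ s ∂(Measure.pi fun _ : ι => P), Real.exp (lam * ghostMean P g s) ≤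
      ∫ s' : ι → Ω, Real.exp (lam * ghostSup g fun i => (s i, s' i)) ∂(Measure.pi fun _ => P) := by
    filter_upwards [(integrable_ghostSup_prod hb hmeas).prod_right_ae, hexp.prod_right_ae]
      with s hs hs_exp
    rw [ghostMean, ← integral_const_mul]
    exact convexOn_exp.map_integral_le Real.continuous_exp.continuousOn isClosed_univ
      (ae_of_all _ fun _ => mem_univ _) (hs.const_mul lam) hs_exp
  calc ∫ s, Real.exp (lam * ghostMean P g s) ∂(Measure.pi fun _ : ι => P)
      ≤ ∫ s : ι → Ω, ∫ s' : ι → Ω, Real.exp (lam * ghostSup g fun i => (s i, s' i))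
          ∂(Measure.pi fun _ => P) ∂(Measure.pi fun _ => P) :=
        integral_mono_of_nonneg (ae_of_all _ fun _ => (Real.exp_pos _).le)
          hexp.integral_prod_left hjensen
    _ = ∫ u, Real.exp (lam * ghostSup g u) ∂(Measure.pi fun _ : ι => P.prod P) := by
        rw [← integral_prod _ hexp]
        exact ((measurePreserving_arrowProdEquivProdArrow Ω Ω ι
          (fun _ => P) fun _ => P).integral_comp' fun p =>
            Real.exp (lam * ghostSup g fun i => (p.1 i, p.2 i))).symm
    _ ≤ _ := integral_exp_ghostSup_le hb hmeas hrad hlam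

theorem abs_sum_expect_sub_le {κ : Type*} {J : Finset κ} {x : κ → ι → ℝ} {m H : κ → ℝ}
    (h : ∀ j ∈ J, |∑ i, x j i - Fintype.card ι * m j| ≤ H j) :
    |∑ i, 𝔼 j ∈ J, x j i - Fintype.card ι * 𝔼 j ∈ J, m j| ≤ 𝔼 j ∈ J, H j := by
  rw [← Finset.expect_sum_comm, Finset.mul_expect, ← Finset.expect_sub_distrib]
  exact (Finset.abs_expect_le _ _).trans (Finset.expect_le_expect h)

theorem uniform_deviation [Nonempty ι] [DecidableEq ι] (hB : 0 < B) {κ : Type*}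
    {J : Finset κ} (hJ : J.Nonempty) {g : κ → T → Ω → ℝ} (hg : ∀ j f, Measurable (g j f))
    (hb : ∀ j f ω, |g j f ω| ≤ B)
    (hmeas : ∀ j ∈ J, AEMeasurable (ghostSup (ι := ι) (g j)) (Measure.pi fun _ => P.prod P)) {A : ℝ}
    (hrad : ∀ j ∈ J, ∀ s : ι → Ω, rademacherSum (fun f i => g j f (s i)) ≤ A) {τ : ℝ} (hτ : 0 ≤ τ) :
    (Measure.pi fun _ : ι => P) {s | ¬ ∀ f,
      |∑ i, 𝔼 j ∈ J, g j f (s i) - Fintype.card ι * 𝔼 j ∈ J, ∫ ω, g j f ω ∂P| ≤ 2 * A + τ} ≤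
      ENNReal.ofReal (Real.exp (-τ ^ 2 / (8 * Fintype.card ι * B ^ 2))) := by
  let H (s : ι → Ω) : ℝ := 𝔼 j ∈ J, ghostMean P (g j) s
  have hH_meas : AEMeasurable H (Measure.pi fun _ => P) := by
    simp only [H, Finset.expect_eq_sum_div_card]
    exact (Finset.aemeasurable_fun_sum _ fun j hj =>
      aemeasurable_ghostMean (hb j) (hmeas j hj)).div_const _
  have hH_le (s : ι → Ω) : |H s| ≤ Fintype.card ι * (2 * B) :=
    abs_expect_le_of_forall_le hJ fun j _ => abs_ghostMean_le (hb j) s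
  have hcard : (0 : ℝ) < Fintype.card ι := by exact_mod_cast Fintype.card_pos
  have htail := measureReal_ge_le_of_mgf_le (v := 4 * Fintype.card ι * B ^ 2)
    (mul_pos (mul_pos four_pos hcard) (pow_pos hB 2)) hτ
    (integrable_exp_mul_of_bounded hH_meas hH_le) fun lam hlam =>
      integral_exp_mul_expect_le hJ
        (fun j hj => integrable_exp_mul_of_bounded (aemeasurable_ghostMean (hb j) (hmeas j hj))
          (abs_ghostMean_le (hb j)) lam)
        fun j hj => integral_exp_ghostMean_le (hb j) (hmeas j hj) (hrad j hj) hlam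
  refine (measure_mono_ae (t := {s | 2 * A + τ ≤ H s}) ?_).trans ?_
  · filter_upwards [(Filter.eventually_all_finset J).2 fun j hj =>
      abs_sum_sub_integral_le_ghostMean (hg j) (hb j) (hmeas j hj)] with s hs hdev
    obtain ⟨f, hf⟩ := not_forall.1 hdev
    exact (not_le.1 hf).le.trans (abs_sum_expect_sub_le fun j hj => hs j hj f)
  · rw [← ofReal_measureReal]
    exact ENNReal.ofReal_le_ofReal (htail.trans_eq (by ring_nf))

end Symmetrization

section Conditioning

variable {Ω ι : Type*} [MeasurableSpace Ω] [Fintype ι] {P : Measure Ω} [IsProbabilityMeasure P]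
  {E : Set Ω}

theorem pi_cond (hE : MeasurableSet E) (hP : P E ≠ 0) :
    (Measure.pi fun _ : ι => ProbabilityTheory.cond P E) =
      ProbabilityTheory.cond (Measure.pi fun _ : ι => P) (univ.pi fun _ => E) := by
  have := ProbabilityTheory.cond_isProbabilityMeasure hP
  refine Measure.pi_eq fun s _ => ?_
  rw [ProbabilityTheory.cond_apply (MeasurableSet.univ_pi fun _ => hE), ← pi_inter_distrib,
    Measure.pi_pi, Measure.pi_pi]
  simp only [ProbabilityTheory.cond_apply hE]
  rw [Finset.prod_mul_distrib, ENNReal.prod_inv_distrib]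
  exact fun _ _ _ _ _ => Or.inl hP

theorem pi_inter_box_eq (hE : MeasurableSet E) (hP : P E ≠ 0) (B : Set (ι → Ω)) :
    (Measure.pi fun _ : ι => P) ((univ.pi fun _ => E) ∩ B) =
      (Measure.pi fun _ : ι => P) (univ.pi fun _ => E) *
        (Measure.pi fun _ : ι => ProbabilityTheory.cond P E) B := by
  rw [pi_cond hE hP, mul_comm,
    ProbabilityTheory.cond_mul_eq_inter (MeasurableSet.univ_pi fun _ => hE)]

open Classical in
/-- Coordinates of a sample that lie in `E`. -/
noncomputable def hits (E : Set Ω) (s : ι → Ω) : Finset ι := Finset.univ.filter fun i => s i ∈ E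

open Classical in
theorem setOf_hits_eq (E : Set Ω) (I : Finset ι) :
    {s : ι → Ω | hits E s = I} =
      MeasurableEquiv.piEquivPiSubtypeProd (fun _ => Ω) (· ∈ I) ⁻¹'
        ((univ.pi fun _ => E) ×ˢ univ.pi fun _ => Eᶜ) := by
  ext s
  simp only [hits, Finset.ext_iff, Finset.mem_filter, Finset.mem_univ, true_and, mem_ofPred_eq,
    mem_preimage, mem_prod, mem_univ_pi, mem_compl_iff, Subtype.forall]
  exact ⟨fun h => ⟨fun i => (h i).2, fun i hi hs => hi ((h i).1 hs)⟩,
    fun h i => ⟨fun hs => by_contra fun hi => h.2 i hi hs, h.1 i⟩⟩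

theorem measurableSet_hits_eq (hE : MeasurableSet E) (I : Finset ι) :
    MeasurableSet {s : ι → Ω | hits E s = I} := by
  classical
  rw [setOf_hits_eq]
  exact (MeasurableEquiv.measurable _)
    ((MeasurableSet.univ_pi fun _ => hE).prod (MeasurableSet.univ_pi fun _ => hE.compl))

theorem measure_hits_eq_inter_le (hE : MeasurableSet E) (hP : P E ≠ 0) (I : Finset ι)
    (B : Set (I → Ω)) :
    (Measure.pi fun _ : ι => P) ({s | hits E s = I} ∩ {s | (fun i : I => s i) ∈ B}) ≤
      (Measure.pi fun _ : ι => P) {s | hits E s = I} *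
        (Measure.pi fun _ : I => ProbabilityTheory.cond P E) B := by
  classical
  have hsplit : MeasurePreserving (MeasurableEquiv.piEquivPiSubtypeProd (fun _ => Ω) (· ∈ I))
      (Measure.pi fun _ : ι => P)
      ((Measure.pi fun _ : I => P).prod (Measure.pi fun _ : {i // i ∉ I} => P)) := by
    convert measurePreserving_piEquivPiSubtypeProd (fun _ : ι => P) (· ∈ I)
  set B' := toMeasurable (Measure.pi fun _ : I => ProbabilityTheory.cond P E) B
  calc (Measure.pi fun _ : ι => P) ({s | hits E s = I} ∩ {s | (fun i : I => s i) ∈ B})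
      ≤ (Measure.pi fun _ : ι => P) (MeasurableEquiv.piEquivPiSubtypeProd (fun _ => Ω) (· ∈ I) ⁻¹'
          (((univ.pi fun _ => E) ∩ B') ×ˢ univ.pi fun _ => Eᶜ)) := by
        refine measure_mono fun s hs => ?_
        rw [setOf_hits_eq] at hs
        exact ⟨⟨hs.1.1, subset_toMeasurable _ _ hs.2⟩, hs.1.2⟩
    _ = (Measure.pi fun _ : I => P) (univ.pi fun _ => E) *
          (Measure.pi fun _ : I => ProbabilityTheory.cond P E) B' *
          (Measure.pi fun _ : {i // i ∉ I} => P) (univ.pi fun _ => Eᶜ) := by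
        rw [hsplit.measure_preimage_equiv, Measure.prod_prod, ← pi_inter_box_eq hE hP]
    _ = (Measure.pi fun _ : ι => P) {s | hits E s = I} *
          (Measure.pi fun _ : I => ProbabilityTheory.cond P E) B := by
        rw [setOf_hits_eq, hsplit.measure_preimage_equiv, Measure.prod_prod, measure_toMeasurable,
          mul_right_comm]

theorem measure_subsample_le (hE : MeasurableSet E) (hP : P E ≠ 0)
    (B : ∀ I : Finset ι, Set (I → Ω)) {q : ENNReal}
    (hq : ∀ I : Finset ι, (Measure.pi fun _ : I => ProbabilityTheory.cond P E) (B I) ≤ q) :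
    (Measure.pi fun _ : ι => P) {s | (fun i : hits E s => s i) ∈ B (hits E s)} ≤ q := by
  have htotal : ∑ I : Finset ι, (Measure.pi fun _ : ι => P) {s | hits E s = I} = 1 := by
    simpa [preimage] using! sum_measure_preimage_singleton (μ := Measure.pi fun _ : ι => P)
      (Finset.univ : Finset (Finset ι)) (f := hits E) fun I _ => measurableSet_hits_eq hE I
  calc (Measure.pi fun _ : ι => P) {s | (fun i : hits E s => s i) ∈ B (hits E s)}
      ≤ (Measure.pi fun _ : ι => P) (⋃ I ∈ (Finset.univ : Finset (Finset ι)),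
          {s | hits E s = I} ∩ {s | (fun i : I => s i) ∈ B I}) :=
        measure_mono fun s hs => mem_biUnion (Finset.mem_univ (hits E s)) ⟨rfl, hs⟩
    _ ≤ ∑ I : Finset ι, (Measure.pi fun _ : ι => P)
          ({s | hits E s = I} ∩ {s | (fun i : I => s i) ∈ B I}) := measure_biUnion_finset_le _ _
    _ ≤ ∑ I : Finset ι, (Measure.pi fun _ : ι => P) {s | hits E s = I} * q :=
        Finset.sum_le_sum fun I _ =>
          (measure_hits_eq_inter_le hE hP I (B I)).trans (mul_le_mul_right (hq I) _)
    _ = q := by rw [← Finset.sum_mul, htotal, one_mul]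

end Conditioning

section Hoeffding

variable {Ω ι : Type*} [MeasurableSpace Ω] [Fintype ι] {P : Measure Ω} [IsProbabilityMeasure P]
  {h : Ω → ℝ} {a b τ : ℝ}

theorem measureReal_sum_sub_integral_ge_le (hm : Measurable h) (hab : ∀ ω, h ω ∈ Icc a b)
    (hτ : 0 ≤ τ) :
    (Measure.pi fun _ : ι => P).real {s | τ ≤ ∑ i, (h (s i) - ∫ ω, h ω ∂P)} ≤
      Real.exp (-2 * τ ^ 2 / (Fintype.card ι * (b - a) ^ 2)) := by
  have hind := ProbabilityTheory.iIndepFun_pi (μ := fun _ : ι => P)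
    (X := fun _ ω => h ω - ∫ ω, h ω ∂P) fun _ => (hm.sub_const _).aemeasurable
  have hsub (i : ι) : ProbabilityTheory.HasSubgaussianMGF (fun s : ι → Ω => h (s i) - ∫ ω, h ω ∂P)
      ((‖b - a‖₊ / 2) ^ 2) (Measure.pi fun _ => P) := by
    rw [← integral_comp_eval (μ := fun _ : ι => P) (i := i) hm.aestronglyMeasurable]
    exact ProbabilityTheory.hasSubgaussianMGF_of_mem_Icc
      (hm.comp (measurable_pi_apply i)).aemeasurable (ae_of_all _ fun s => hab (s i))
  refine (ProbabilityTheory.HasSubgaussianMGF.measure_sum_ge_le_of_iIndepFun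
    hind (s := Finset.univ) (fun i _ => hsub i) hτ).trans_eq ?_
  congr 1
  simp only [Finset.sum_const, Finset.card_univ, nsmul_eq_mul, NNReal.coe_mul, NNReal.coe_natCast,
    NNReal.coe_pow, NNReal.coe_div, coe_nnnorm, NNReal.coe_ofNat, div_pow, Real.norm_eq_abs, sq_abs]
  generalize (b - a) ^ 2 = w
  ring

theorem measure_abs_sum_sub_gt_le (hm : Measurable h) (hab : ∀ ω, h ω ∈ Icc a b) (hτ : 0 ≤ τ) :
    (Measure.pi fun _ : ι => P) {s | ¬ |∑ i, h (s i) - Fintype.card ι * ∫ ω, h ω ∂P| ≤ τ} ≤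
      ENNReal.ofReal (2 * Real.exp (-2 * τ ^ 2 / (Fintype.card ι * (b - a) ^ 2))) := by
  have hupper := measureReal_sum_sub_integral_ge_le (ι := ι) (P := P) hm hab hτ
  have hlower := measureReal_sum_sub_integral_ge_le (ι := ι) (P := P) (a := -b) (b := -a) hm.neg
    (fun ω => ⟨neg_le_neg (hab ω).2, neg_le_neg (hab ω).1⟩) hτ
  rw [neg_sub_neg] at hlower
  have hcover : {s : ι → Ω | ¬ |∑ i, h (s i) - Fintype.card ι * ∫ ω, h ω ∂P| ≤ τ} ⊆
      {s | τ ≤ ∑ i, (h (s i) - ∫ ω, h ω ∂P)} ∪ {s | τ ≤ ∑ i, (-h (s i) - ∫ ω, -h ω ∂P)} := by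
    intro s hs
    simp only [mem_ofPred_eq, not_le, lt_abs] at hs
    simp only [mem_union, mem_ofPred_eq, Finset.sum_sub_distrib, Finset.sum_neg_distrib,
      Finset.sum_const, Finset.card_univ, nsmul_eq_mul, integral_neg]
    exact hs.imp le_of_lt fun hs => by linarith
  rw [← ofReal_measureReal, two_mul]
  exact ENNReal.ofReal_le_ofReal ((measureReal_mono hcover).trans
    ((measureReal_union_le _ _).trans (add_le_add hupper hlower)))

end Hoeffding

section Reindexing

variable {Ω ι κ T : Type*} [Fintype ι] [Fintype κ]

theorem rademacherSum_comp_equiv [DecidableEq ι] [DecidableEq κ] (e : κ ≃ ι) (a : T → ι → ℝ) :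
    rademacherSum (fun f k => a f (e k)) = rademacherSum a := by
  refine Fintype.expect_equiv (e.arrowCongr (Equiv.refl Bool)) _ _ fun σ => ?_
  simp only [supSum]
  refine iSup_congr fun f => ?_
  rw [← e.sum_comp]
  simp

variable [MeasurableSpace Ω] {P : Measure Ω} [IsProbabilityMeasure P]

theorem aemeasurable_ghostSup {g : T → Ω → ℝ}
    (h : AEMeasurable (fun v : ι ⊕ ι → Ω => supSum fun f j =>
      (Sum.elim (fun _ => 1) (fun _ => -1) j : ℝ) * g f (v j)) (Measure.pi fun _ => P)) :
    AEMeasurable (ghostSup (ι := ι) g) (Measure.pi fun _ => P.prod P) := by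
  have hjoin := (measurePreserving_sumPiEquivProdPi_symm (X := fun _ : ι ⊕ ι => Ω)
    fun _ => P).comp (measurePreserving_arrowProdEquivProdArrow Ω Ω ι (fun _ => P) fun _ => P)
  refine (h.comp_quasiMeasurePreserving hjoin.quasiMeasurePreserving).congr
    (ae_of_all _ fun u => ?_)
  simp only [Function.comp_apply, ghostSup, supSum, Fintype.sum_sum_type, Sum.elim_inl,
    Sum.elim_inr, one_mul, neg_one_mul, sub_eq_add_neg, Finset.sum_add_distrib]
  rfl

theorem measurePreserving_pi_map_comp_equiv {Ω' : Type*} [MeasurableSpace Ω'] {p : Ω → Ω'}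
    (hp : Measurable p) (e : κ ≃ ι) :
    MeasurePreserving (fun (v : κ → Ω) i => p (v (e.symm i))) (Measure.pi fun _ => P)
      (Measure.pi fun _ => P.map p) := by
  have := Measure.isProbabilityMeasure_map (μ := P) hp.aemeasurable
  have hreindex := measurePreserving_arrowCongr' (fun _ : κ => P) (fun _ : ι => P) e
    (MeasurableEquiv.refl _) fun _ => MeasurePreserving.id _
  exact (measurePreserving_pi (fun _ : ι => P) (fun _ => P.map p) (f := fun _ => p)
    fun _ => ⟨hp, rfl⟩).comp hreindex

end Reindexing

namespace Setting

variable {𝒳 : Type u} [MeasurableSpace 𝒳] (S : Setting 𝒳)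

section Thresholds

theorem abs_thr_le_one (f : S.predictors) (x : 𝒳) (z : ℝ) : |S.thr f x z| ≤ 1 := by
  unfold thr
  split_ifs <;> simp

theorem measurable_predictor (f : S.predictors) : Measurable fun o : S.Obs => (f.1 o.1 : ℝ) :=
  measurable_subtype_coe.comp ((S.predictors_measurable f.1 f.2).comp measurable_fst)

theorem measurable_thr (f : S.predictors) (z : ℝ) : Measurable fun o : S.Obs => S.thr f o.1 z :=
  Measurable.ite (measurableSet_le measurable_const (S.measurable_predictor f)) measurable_const
    measurable_const

variable {S}

theorem aemeasurable_supSum (hS : S.SupMeasurable) {κ : Type*} [Fintype κ] (z : unitInterval)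
    (c : κ → ℝ) {w : S.Obs → ℝ} (hw : Measurable w) (hfin : (range w).Finite) :
    AEMeasurable (fun v : κ → S.Obs => supSum fun (f : S.predictors) j =>
      c j * (w (v j) * S.thr f (v j).1 z)) (Measure.pi fun _ => S.law) := by
  have := S.law_prob
  have : Finite (range w) := hfin
  set e := Fintype.equivFin κ
  -- On each piece of this finite partition the weights are constant, so that `hS` applies.
  have hcover : (⋃ p : κ → range w, {v : κ → S.Obs | ∀ j, w (v j) = p j}) = univ :=
    eq_univ_of_forall fun v => mem_iUnion.2 ⟨fun j => ⟨w (v j), mem_range_self _⟩, fun _ => rfl⟩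
  rw [← Measure.restrict_univ (μ := Measure.pi fun _ : κ => S.law), ← hcover]
  refine aemeasurable_iUnion_iff.2 fun p => ?_
  have hpiece : MeasurableSet {v : κ → S.Obs | ∀ j, w (v j) = p j} := by
    rw [ofPred_forall]
    exact MeasurableSet.iInter fun j =>
      (hw.comp (measurable_pi_apply j)) (measurableSet_singleton (p j : ℝ))
  have hsup := (hS (Fintype.card κ) (fun i => c (e.symm i) * p (e.symm i))
    z).comp_quasiMeasurePreserving
      (measurePreserving_pi_map_comp_equiv measurable_fst e).quasiMeasurePreserving
  refine (hsup.mono_measure Measure.restrict_le_self).congr ?_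
  filter_upwards [ae_restrict_mem hpiece] with v (hv : ∀ j, w (v j) = p j)
  simp only [Function.comp_apply, supSum]
  refine iSup_congr fun f => ?_
  rw [← Equiv.sum_comp e.symm fun j => c j * (w (v j) * S.thr f (v j).1 z)]
  simp only [hv, mul_assoc]

theorem rademacher_nonneg (S : Setting 𝒳) (m : ℕ) : 0 ≤ S.rademacher m :=
  Real.iSup_nonneg fun _ => mul_nonneg (by positivity)
    (Finset.sum_nonneg fun _ _ => Real.iSup_nonneg fun _ => abs_nonneg _)

theorem nonneg_of_rademacher_le {C φ : ℝ}
    (hR : ∀ k : ℕ, 1 ≤ k → S.rademacher k ≤ C * (k : ℝ) ^ (-φ)) : 0 ≤ C := by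
  simpa using (S.rademacher_nonneg 1).trans (hR 1 le_rfl)

theorem rademacher_eq_iSup_rademacherSum (m : ℕ) :
    S.rademacher m = ⨆ v : Fin m → 𝒳 × unitInterval,
      (1 / (m : ℝ)) * rademacherSum fun (f : S.predictors) i => S.thr f (v i).1 (v i).2 := by
  refine iSup_congr fun v => ?_
  rw [← rademacherSum_const_mul (by positivity), rademacherSum, Fintype.expect_eq_sum_div_card,
    one_div_mul_eq_div]
  congr 1
  · refine Finset.sum_congr rfl fun σ _ => iSup_congr fun f => ?_
    simp only [sgn, Finset.mul_sum, mul_left_comm]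
  · simp

theorem rademacherSum_thr_le_card_mul_rademacher [Nonempty S.predictors] {ι : Type*} [Fintype ι]
    [DecidableEq ι] [Nonempty ι] (v : ι → 𝒳 × unitInterval) :
    rademacherSum (fun (f : S.predictors) i => S.thr f (v i).1 (v i).2) ≤
      Fintype.card ι * S.rademacher (Fintype.card ι) := by
  set e := (Fintype.equivFin ι).symm
  have hcard : (0 : ℝ) < Fintype.card ι := by exact_mod_cast Fintype.card_pos
  have hbdd : BddAbove (range fun v : Fin (Fintype.card ι) → 𝒳 × unitInterval =>
      (1 / (Fintype.card ι : ℝ)) *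
        rademacherSum fun (f : S.predictors) i => S.thr f (v i).1 (v i).2) := by
    refine ⟨1, forall_mem_range.2 fun v => ?_⟩
    rw [one_div, inv_mul_le_iff₀ hcard, mul_one]
    refine Finset.expect_le Finset.univ_nonempty fun σ _ =>
      (supSum_le_card_mul (c := 1) fun f i => ?_).trans (by simp)
    rw [abs_sgn_mul]
    exact S.abs_thr_le_one _ _ _
  have hle := le_ciSup hbdd fun i => v (e i)
  rw [← rademacher_eq_iSup_rademacherSum, one_div, inv_mul_le_iff₀ hcard] at hle
  rwa [rademacherSum_comp_equiv e fun (f : S.predictors) i => S.thr f (v i).1 (v i).2] at hle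

end Thresholds

section Discretization

theorem gridMean_eq_expect (N : ℕ) (h : ℝ → ℝ) :
    gridMean N h = Finset.expect (Finset.Icc 1 N) fun j => h ((j : ℝ) / N) := by
  rw [gridMean, Finset.expect_eq_sum_div_card, Nat.card_Icc, Nat.add_sub_cancel,
    one_div_mul_eq_div]

theorem sum_grid_mul_ite (N : ℕ) (a : ℕ → ℝ) {v : ℝ} (hv : v ∈ Icc (0 : ℝ) 1) :
    ∑ j ∈ Finset.Icc 1 N, a j * (if (j : ℝ) / N ≤ v then 1 else 0) =
      ∑ j ∈ Finset.Icc 1 ⌊(N : ℝ) * v⌋₊, a j := by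
  simp only [mul_ite, mul_one, mul_zero]
  rw [← Finset.sum_filter]
  congr 1
  ext j
  simp only [Finset.mem_filter, Finset.mem_Icc]
  rcases N.eq_zero_or_pos with rfl | hN
  · simp +contextual [hv.1]
  have hN' : (0 : ℝ) < N := by exact_mod_cast hN
  have hfloor : ⌊(N : ℝ) * v⌋₊ ≤ N :=
    Nat.floor_le_of_le (mul_le_of_le_one_right hN'.le hv.2)
  rw [div_le_iff₀' hN', ← Nat.le_floor_iff (mul_nonneg hN'.le hv.1)]
  omega

theorem gridMean_thr (N : ℕ) (f : S.predictors) (x : 𝒳) :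
    gridMean N (fun z => S.thr f x z) = ⌊(N : ℝ) * (f.1 x : ℝ)⌋₊ / (N : ℝ) := by
  have hcount := sum_grid_mul_ite N (fun _ => 1) (f.1 x).2
  simp only [one_mul] at hcount
  simp only [gridMean, thr, hcount, Finset.sum_const, Nat.card_Icc, Nat.add_sub_cancel,
    nsmul_eq_mul, mul_one, one_div_mul_eq_div]

theorem floor_mul_div_mem_Icc {N : ℕ} (hN : 0 < N) {v : ℝ} (hv : 0 ≤ v) :
    (⌊(N : ℝ) * v⌋₊ : ℝ) / N ∈ Icc (v - 1 / N) v := by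
  have hN' : (0 : ℝ) < N := by exact_mod_cast hN
  have hle := Nat.floor_le (mul_nonneg hN'.le hv)
  have hlt := (Nat.lt_floor_add_one ((N : ℝ) * v)).le
  constructor
  · rw [sub_le_iff_le_add, ← add_div, le_div_iff₀' hN']
    exact hlt
  · rwa [div_le_iff₀' hN']

theorem abs_gridMean_thr_sub_le {N : ℕ} (hN : 0 < N) (f : S.predictors) (x : 𝒳) :
    |gridMean N (fun z => S.thr f x z) - (f.1 x : ℝ)| ≤ 1 / N := by
  obtain ⟨hlo, hhi⟩ := floor_mul_div_mem_Icc hN (f.1 x).2.1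
  have : (0 : ℝ) ≤ 1 / N := by positivity
  rw [gridMean_thr, abs_le]
  constructor <;> linarith

theorem gridMean_thr_mem_Icc (N : ℕ) (f : S.predictors) (x : 𝒳) :
    gridMean N (fun z => S.thr f x z) ∈ Icc (0 : ℝ) 1 := by
  rcases N.eq_zero_or_pos with rfl | hN
  · simp [gridMean]
  · rw [gridMean_thr]
    exact ⟨by positivity, (floor_mul_div_mem_Icc hN (f.1 x).2.1).2.trans (f.1 x).2.2⟩

theorem abs_lossExt_sub_le (y y' : S.outcomes) (v v' : ℝ) :
    |S.lossExt y v - S.lossExt y' v'| ≤ |(y : ℝ) - y'| + |v - v'| :=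
  (S.lossFn_lipschitz _ _ _ _).trans
    (add_le_add_right (abs_projIcc_sub_projIcc (zero_le_one' ℝ)) _)

theorem lossExt_coe (y : S.outcomes) (v : unitInterval) : S.lossExt y v = S.lossFn y v := by
  rw [lossExt, projIcc_val]

theorem lossExt_mem_Icc (y : S.outcomes) (v : ℝ) : S.lossExt y v ∈ Icc (0 : ℝ) 1 :=
  (S.lossFn y _).2

theorem abs_costWeight_le_one (N : ℕ) (y : S.outcomes) (z : ℝ) : |S.costWeight N y z| ≤ 1 := by
  rcases N.eq_zero_or_pos with rfl | hN
  · simp [costWeight]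
  have hN' : (0 : ℝ) < N := by exact_mod_cast hN
  have hlip := S.abs_lossExt_sub_le y y (z + 1 / (2 * (N : ℝ))) (z - 1 / (2 * (N : ℝ)))
  have hstep : z + 1 / (2 * (N : ℝ)) - (z - 1 / (2 * (N : ℝ))) = 1 / N := by field_simp; ring
  rw [sub_self, abs_zero, zero_add, hstep, abs_of_pos (one_div_pos.2 hN'), le_div_iff₀' hN'] at hlip
  rwa [costWeight, abs_mul, abs_of_pos hN']

theorem gridMean_costWeight_mul_thr {N : ℕ} (hN : 0 < N) (y : S.outcomes) (f : S.predictors)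
    (x : 𝒳) :
    gridMean N (fun z => S.costWeight N y z * S.thr f x z) =
      S.lossExt y (⌊(N : ℝ) * (f.1 x : ℝ)⌋₊ / (N : ℝ) + 1 / (2 * (N : ℝ))) -
        S.lossExt y (1 / (2 * (N : ℝ))) := by
  have hN' : (0 : ℝ) < N := by exact_mod_cast hN
  simp only [gridMean, thr, sum_grid_mul_ite N (fun j => S.costWeight N y ((j : ℝ) / N)) (f.1 x).2]
  generalize ⌊(N : ℝ) * (f.1 x : ℝ)⌋₊ = J
  rw [one_div, inv_mul_eq_iff_eq_mul₀ hN'.ne']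
  induction J with
  | zero => simp
  | succ J ih =>
    have hshift : ((J + 1 : ℕ) : ℝ) / N - 1 / (2 * (N : ℝ)) = (J : ℝ) / N + 1 / (2 * (N : ℝ)) := by
      push_cast; field_simp; ring
    rw [Finset.sum_Icc_succ_top (by omega), ih, costWeight, ← mul_add, hshift]
    ring

end Discretization

section Rounding

variable {S} {N : ℕ} {cover : Finset S.outcomes}

theorem roundOutcome_spec (hc : S.IsCover N cover) (y : S.outcomes) :
    S.roundOutcome N cover y ∈ cover ∧
      |(y : ℝ) - S.roundOutcome N cover y| ≤ 1 / (2 * (N : ℝ)) ∧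
      ∀ c ∈ cover, |(y : ℝ) - (c : ℝ)| ≤ 1 / (2 * (N : ℝ)) → S.roundOutcome N cover y ≤ c := by
  classical
  obtain ⟨y', hy', hyy'⟩ := hc y
  have hne : (cover.filter fun y' : S.outcomes =>
      |(y : ℝ) - (y' : ℝ)| ≤ 1 / (2 * (N : ℝ))).Nonempty :=
    ⟨y', Finset.mem_filter.2 ⟨hy', hyy'⟩⟩
  have hround : S.roundOutcome N cover y = (cover.filter fun y' : S.outcomes =>
      |(y : ℝ) - (y' : ℝ)| ≤ 1 / (2 * (N : ℝ))).min' hne := by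
    rw [roundOutcome]
    convert dif_pos hne
  have hmem := Finset.mem_filter.1 (Finset.min'_mem _ hne)
  rw [hround]
  exact ⟨hmem.1, hmem.2, fun c hc hc' => Finset.min'_le _ _ (Finset.mem_filter.2 ⟨hc, hc'⟩)⟩

theorem roundOutcome_eq_iff (hc : S.IsCover N cover) {y c : S.outcomes} (hcc : c ∈ cover) :
    S.roundOutcome N cover y = c ↔ |(y : ℝ) - (c : ℝ)| ≤ 1 / (2 * (N : ℝ)) ∧
      ∀ c' ∈ cover, c' < c → ¬ |(y : ℝ) - (c' : ℝ)| ≤ 1 / (2 * (N : ℝ)) := by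
  obtain ⟨hmem, hnear, hmin⟩ := roundOutcome_spec hc y
  constructor
  · rintro rfl
    exact ⟨hnear, fun c' hc' hlt hle => not_lt.2 (hmin c' hc' hle) hlt⟩
  · rintro ⟨hcnear, hcmin⟩
    exact le_antisymm (hmin c hcc hcnear) (not_lt.1 fun hlt => hcmin _ hmem hlt hnear)

theorem measurableSet_roundOutcome_eq (hc : S.IsCover N cover) {c : S.outcomes}
    (hcc : c ∈ cover) : MeasurableSet {y : S.outcomes | S.roundOutcome N cover y = c} := by
  have hnear (c : S.outcomes) :
      MeasurableSet {y : S.outcomes | |(y : ℝ) - (c : ℝ)| ≤ 1 / (2 * (N : ℝ))} :=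
    measurableSet_le (measurable_subtype_coe.sub_const _).abs measurable_const
  simp only [roundOutcome_eq_iff hc hcc, ofPred_and, ofPred_forall]
  exact (hnear c).inter (Finset.measurableSet_biInter _ fun c' _ =>
    MeasurableSet.iInter fun _ => (hnear c').compl)

theorem measurableSet_preimage_roundOutcome (hc : S.IsCover N cover) (t : Set S.outcomes) :
    MeasurableSet (S.roundOutcome N cover ⁻¹' t) := by
  have hpreimage : S.roundOutcome N cover ⁻¹' t =
      ⋃ c ∈ (cover : Set S.outcomes) ∩ t, {y | S.roundOutcome N cover y = c} := by
    ext y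
    simp only [mem_preimage, mem_iUnion, mem_inter_iff, Finset.mem_coe, mem_ofPred_eq,
      exists_prop, exists_eq_right']
    exact (and_iff_right (roundOutcome_spec hc y).1).symm
  rw [hpreimage]
  exact MeasurableSet.biUnion ((cover.finite_toSet.inter_of_left _).countable)
    fun c hct => measurableSet_roundOutcome_eq hc hct.1

theorem measurable_comp_roundOutcome (hc : S.IsCover N cover) (h : S.outcomes → ℝ) :
    Measurable fun o : S.Obs => h (S.roundOutcome N cover o.2.2) :=
  fun t _ => (measurable_snd.comp measurable_snd)
    (measurableSet_preimage_roundOutcome hc (h ⁻¹' t))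

theorem finite_range_comp_roundOutcome (hc : S.IsCover N cover) (h : S.outcomes → ℝ) :
    (range fun o : S.Obs => h (S.roundOutcome N cover o.2.2)).Finite :=
  (cover.finite_toSet.image h).subset
    (range_subset_iff.2 fun o => ⟨_, (roundOutcome_spec hc o.2.2).1, rfl⟩)

end Rounding

theorem measurable_loss (f : S.predictors) :
    Measurable fun o : S.Obs => (S.lossFn o.2.2 (f.1 o.1) : ℝ) := by
  have hcont : Continuous fun p : S.outcomes × unitInterval => (S.lossFn p.1 p.2 : ℝ) := by
    refine (LipschitzWith.of_dist_le_mul (K := 2) fun p q => ?_).continuous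
    rw [Real.dist_eq]
    refine (S.lossFn_lipschitz _ _ _ _).trans ?_
    have hfst : |(p.1 : ℝ) - q.1| ≤ dist p q := le_max_left (dist p.1 q.1) (dist p.2 q.2)
    have hsnd : |(p.2 : ℝ) - q.2| ≤ dist p q := le_max_right (dist p.1 q.1) (dist p.2 q.2)
    push_cast
    linarith
  exact hcont.measurable.comp ((measurable_snd.comp measurable_snd).prodMk
    ((S.predictors_measurable f.1 f.2).comp measurable_fst))

end Setting

section Rates

theorem sqrt_le_mul_rpow {k : ℕ} (hk : 0 < k) {φ : ℝ} (hφ : φ ≤ 1 / 2) :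
    √(k : ℝ) ≤ k * (k : ℝ) ^ (-φ) := by
  have hk' : (0 : ℝ) < k := by exact_mod_cast hk
  calc √(k : ℝ) = (k : ℝ) ^ ((1 : ℝ) / 2) := Real.sqrt_eq_rpow _
    _ ≤ (k : ℝ) ^ (1 + -φ) :=
        Real.rpow_le_rpow_of_exponent_le (by exact_mod_cast hk) (by linarith)
    _ = k * (k : ℝ) ^ (-φ) := by rw [Real.rpow_add hk', Real.rpow_one]

theorem abs_one_div_mul_sub_le_mul_rpow {k : ℕ} (hk : 0 < k) {φ x m b τ : ℝ} (hφ : φ ≤ 1 / 2)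
    (hτ : 0 ≤ τ) (h : |x - k * m| ≤ k * (b * (k : ℝ) ^ (-φ)) + τ * √k) :
    |(1 / (k : ℝ)) * x - m| ≤ (b + τ) * (k : ℝ) ^ (-φ) := by
  have hk' : (0 : ℝ) < k := by exact_mod_cast hk
  have hscale : (1 / (k : ℝ)) * x - m = (x - k * m) / k := by field_simp
  rw [hscale, abs_div, abs_of_pos hk', div_le_iff₀ hk']
  linarith [mul_le_mul_of_nonneg_left (sqrt_le_mul_rpow hk hφ) hτ]

end Rates

section Integrals

variable {Ω : Type*} [MeasurableSpace Ω] {P : Measure Ω} [IsProbabilityMeasure P]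

theorem abs_integral_sub_integral_le {f g : Ω → ℝ} (hf : Integrable f P) (hg : Integrable g P)
    {c : ℝ} (h : ∀ ω, |f ω - g ω| ≤ c) : |∫ ω, f ω ∂P - ∫ ω, g ω ∂P| ≤ c := by
  rw [← integral_sub hf hg]
  simpa using norm_integral_le_of_norm_le_const (μ := P) (f := fun ω => f ω - g ω) (ae_of_all _ h)

theorem pi_cond_absolutelyContinuous {ι : Type*} [Fintype ι] {E : Set Ω} (hE : MeasurableSet E)
    (hP : P E ≠ 0) :
    (Measure.pi fun _ : ι => ProbabilityTheory.cond P E) ≪ Measure.pi fun _ => P := by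
  rw [pi_cond hE hP]
  exact ProbabilityTheory.cond_absolutelyContinuous

end Integrals

namespace Setting

variable {𝒳 : Type u} [MeasurableSpace 𝒳] {S : Setting 𝒳} {φ C τ : ℝ} {N : ℕ}

section WeightedThresholds

open scoped BigOperators

/-- Average over the grid of the threshold classifiers of `f` with weights `w`. It is the cost of
`f` if the weights are those of the rounded outcome, and the discretization of `f` if `w = 1`. -/
noncomputable def weightedThr (S : Setting 𝒳) (N : ℕ) (w : ℝ → S.Obs → ℝ) (f : S.predictors)
    (o : S.Obs) : ℝ :=
  gridMean N fun z => w z o * S.thr f o.1 z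

variable {P : Measure S.Obs} [IsProbabilityMeasure P] {w : ℝ → S.Obs → ℝ}

theorem abs_mul_thr_le_one (hw : ∀ z o, |w z o| ≤ 1) (f : S.predictors) (z : ℝ) (o : S.Obs) :
    |w z o * S.thr f o.1 z| ≤ 1 := by
  rw [abs_mul]
  exact mul_le_one₀ (hw z o) (abs_nonneg _) (S.abs_thr_le_one f o.1 z)

theorem integrable_mul_thr (hwm : ∀ z, Measurable (w z)) (hw : ∀ z o, |w z o| ≤ 1)
    (f : S.predictors) (z : ℝ) : Integrable (fun o => w z o * S.thr f o.1 z) P :=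
  Integrable.of_bound ((hwm z).mul (S.measurable_thr f z)).aestronglyMeasurable 1
    (ae_of_all _ (abs_mul_thr_le_one hw f z))

theorem integrable_weightedThr (hwm : ∀ z, Measurable (w z)) (hw : ∀ z o, |w z o| ≤ 1)
    (f : S.predictors) : Integrable (S.weightedThr N w f) P := by
  unfold weightedThr
  simp only [gridMean_eq_expect]
  exact integrable_expect fun j _ => integrable_mul_thr hwm hw f _

theorem rademacherSum_mul_thr_le [Nonempty S.predictors]
    (hR : ∀ k : ℕ, 1 ≤ k → S.rademacher k ≤ C * (k : ℝ) ^ (-φ)) {ι : Type*} [Fintype ι]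
    [DecidableEq ι] [Nonempty ι] (hw : ∀ z o, |w z o| ≤ 1) (z : unitInterval) (s : ι → S.Obs) :
    rademacherSum (fun (f : S.predictors) i => w z (s i) * S.thr f (s i).1 z) ≤
      Fintype.card ι * (C * (Fintype.card ι : ℝ) ^ (-φ)) :=
  calc rademacherSum (fun (f : S.predictors) i => w z (s i) * S.thr f (s i).1 z)
      ≤ rademacherSum fun (f : S.predictors) i => S.thr f (s i).1 z :=
        rademacherSum_mul_le (fun f i => S.abs_thr_le_one f (s i).1 z) fun i => hw z (s i)
    _ ≤ Fintype.card ι * S.rademacher (Fintype.card ι) :=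
        rademacherSum_thr_le_card_mul_rademacher fun i => ((s i).1, z)
    _ ≤ _ := mul_le_mul_of_nonneg_left (hR _ Fintype.card_pos) (Nat.cast_nonneg _)

theorem measure_weightedThr_deviation_le [Nonempty S.predictors] (hS : S.SupMeasurable)
    (hR : ∀ k : ℕ, 1 ≤ k → S.rademacher k ≤ C * (k : ℝ) ^ (-φ)) (hφ : φ ≤ 1 / 2)
    {ι : Type*} [Fintype ι] [Nonempty ι]
    (hP : (Measure.pi fun _ : ι ⊕ ι => P) ≪ Measure.pi fun _ => S.law) (hN : 0 < N)
    (hwm : ∀ z, Measurable (w z)) (hfin : ∀ z, (range (w z)).Finite) (hw : ∀ z o, |w z o| ≤ 1)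
    (hτ : 0 ≤ τ) :
    (Measure.pi fun _ : ι => P) {s | ¬ ∀ f,
      |(1 / (Fintype.card ι : ℝ)) * ∑ i, S.weightedThr N w f (s i) -
        ∫ o, S.weightedThr N w f o ∂P| ≤ (2 * C + τ) * (Fintype.card ι : ℝ) ^ (-φ)} ≤
      ENNReal.ofReal (Real.exp (-τ ^ 2 / 8)) := by
  classical
  have hgrid (j : ℕ) (hj : j ∈ Finset.Icc 1 N) : (j : ℝ) / N ∈ unitInterval :=
    ⟨by positivity, div_le_one_of_le₀ (by exact_mod_cast (Finset.mem_Icc.1 hj).2) (by positivity)⟩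
  have hdev := uniform_deviation (P := P) (ι := ι) one_pos
    (J := Finset.Icc 1 N) (Finset.nonempty_Icc.2 hN)
    (g := fun (j : ℕ) (f : S.predictors) o => w ((j : ℝ) / N) o * S.thr f o.1 ((j : ℝ) / N))
    (fun j f => (hwm _).mul (S.measurable_thr f _)) (fun j f => abs_mul_thr_le_one hw f _)
    (fun j hj => aemeasurable_ghostSup
      ((aemeasurable_supSum hS ⟨_, hgrid j hj⟩ _ (hwm _) (hfin _)).mono_ac hP))
    (fun j hj => rademacherSum_mul_thr_le hR hw ⟨_, hgrid j hj⟩)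
    (τ := τ * √(Fintype.card ι)) (by positivity)
  have hcard : (0 : ℝ) < Fintype.card ι := by exact_mod_cast Fintype.card_pos
  have hexponent : -(τ * √(Fintype.card ι)) ^ 2 / (8 * (Fintype.card ι : ℝ) * 1 ^ 2) =
      -τ ^ 2 / 8 := by
    rw [mul_pow, Real.sq_sqrt hcard.le]
    field_simp
  rw [hexponent] at hdev
  refine le_trans (measure_mono ?_) hdev
  refine fun s (hs : ¬ _) hall => hs fun f => ?_
  have hintegrable : ∫ o, S.weightedThr N w f o ∂P = 𝔼 j ∈ Finset.Icc 1 N,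
      ∫ o, w ((j : ℝ) / N) o * S.thr f o.1 ((j : ℝ) / N) ∂P := by
    simp only [weightedThr, gridMean_eq_expect]
    exact integral_expect fun j _ => integrable_mul_thr hwm hw f _
  rw [hintegrable]
  simp only [weightedThr, gridMean_eq_expect]
  exact abs_one_div_mul_sub_le_mul_rpow Fintype.card_pos hφ hτ (b := 2 * C)
    ((hall f).trans_eq (by ring))

end WeightedThresholds

section Loss

variable {cover : Finset S.outcomes}

/-- The cost weights of the rounded outcome. -/
noncomputable def roundedWeight (S : Setting 𝒳) (N : ℕ) (cover : Finset S.outcomes) (z : ℝ)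
    (o : S.Obs) : ℝ :=
  S.costWeight N (S.roundOutcome N cover o.2.2) z

/-- The part of the rounded loss that does not depend on the predictor; `empConst` is its sample
mean. -/
noncomputable def baseLoss (S : Setting 𝒳) (N : ℕ) (cover : Finset S.outcomes) (o : S.Obs) : ℝ :=
  S.lossExt (S.roundOutcome N cover o.2.2) (1 / (2 * (N : ℝ)))

theorem abs_roundedWeight_le_one (z : ℝ) (o : S.Obs) : |S.roundedWeight N cover z o| ≤ 1 :=
  S.abs_costWeight_le_one _ _ _

theorem measurable_roundedWeight (hc : S.IsCover N cover) (z : ℝ) :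
    Measurable (S.roundedWeight N cover z) :=
  measurable_comp_roundOutcome hc fun y => S.costWeight N y z

theorem measurable_baseLoss (hc : S.IsCover N cover) : Measurable (S.baseLoss N cover) :=
  measurable_comp_roundOutcome hc fun y => S.lossExt y (1 / (2 * (N : ℝ)))

theorem baseLoss_mem_Icc (o : S.Obs) : S.baseLoss N cover o ∈ Icc (0 : ℝ) 1 :=
  S.lossExt_mem_Icc _ _

theorem abs_weightedThr_add_baseLoss_sub_le (hN : 0 < N) (hc : S.IsCover N cover)
    (f : S.predictors) (o : S.Obs) :
    |S.weightedThr N (S.roundedWeight N cover) f o + S.baseLoss N cover o -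
      S.lossFn o.2.2 (f.1 o.1)| ≤ 1 / N := by
  obtain ⟨hlo, hhi⟩ := floor_mul_div_mem_Icc hN (f.1 o.1).2.1
  have hround := (roundOutcome_spec hc o.2.2).2.1
  have hhalves : (1 : ℝ) / N = 1 / (2 * (N : ℝ)) + 1 / (2 * (N : ℝ)) := by
    rw [← two_mul]; field_simp
  rw [weightedThr, baseLoss]
  simp only [roundedWeight]
  rw [S.gridMean_costWeight_mul_thr hN, sub_add_cancel, ← lossExt_coe]
  refine (S.abs_lossExt_sub_le _ _ _ _).trans ?_
  rw [abs_sub_comm] at hround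
  rw [hhalves] at hlo ⊢
  exact add_le_add hround (abs_le.2 ⟨by linarith, by linarith⟩)

theorem abs_integral_weightedThr_add_baseLoss_sub_le (hN : 0 < N) (hc : S.IsCover N cover)
    (f : S.predictors) :
    |∫ o, S.weightedThr N (S.roundedWeight N cover) f o ∂S.law +
      ∫ o, S.baseLoss N cover o ∂S.law - S.loss f| ≤ 1 / N := by
  have := S.law_prob
  have hcost := integrable_weightedThr (P := S.law) (N := N) (measurable_roundedWeight hc)
    abs_roundedWeight_le_one f
  have hbase : Integrable (S.baseLoss N cover) S.law := Integrable.of_mem_Icc 0 1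
    (measurable_baseLoss hc).aemeasurable (ae_of_all _ baseLoss_mem_Icc)
  have hloss : Integrable (fun o : S.Obs => (S.lossFn o.2.2 (f.1 o.1) : ℝ)) S.law :=
    Integrable.of_mem_Icc 0 1 (S.measurable_loss f).aemeasurable
      (ae_of_all _ fun o => (S.lossFn o.2.2 (f.1 o.1)).2)
  rw [← integral_add hcost hbase]
  exact abs_integral_sub_integral_le (hcost.add hbase) hloss
    (abs_weightedThr_add_baseLoss_sub_le hN hc f)

theorem measure_baseLoss_deviation_le {n : ℕ} (hn : 0 < n) (hφ : φ ≤ 1 / 2)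
    (hc : S.IsCover N cover) (hτ : 0 ≤ τ) :
    (Measure.pi fun _ : Fin n => S.law) {s | ¬ |S.empConst s N cover -
      ∫ o, S.baseLoss N cover o ∂S.law| ≤ τ * (n : ℝ) ^ (-φ)} ≤
      ENNReal.ofReal (2 * Real.exp (-2 * τ ^ 2)) := by
  have := S.law_prob
  have hn' : (0 : ℝ) < n := by exact_mod_cast hn
  have hdev := measure_abs_sum_sub_gt_le (ι := Fin n) (P := S.law) (measurable_baseLoss hc)
    baseLoss_mem_Icc (τ := τ * √n) (by positivity)
  have hexponent : -2 * (τ * √(n : ℝ)) ^ 2 / (n * (1 - 0) ^ 2) = -2 * τ ^ 2 := by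
    rw [mul_pow, Real.sq_sqrt hn'.le]
    field_simp
    ring
  rw [Fintype.card_fin, hexponent] at hdev
  refine le_trans (measure_mono ?_) hdev
  refine fun s (hs : ¬ _) hsum => hs ?_
  have hmean := abs_one_div_mul_sub_le_mul_rpow hn (b := 0) hφ hτ (hsum.trans_eq (by ring))
  rwa [zero_add] at hmean

theorem measure_loss_deviation_le [Nonempty S.predictors] (hS : S.SupMeasurable)
    (hR : ∀ k : ℕ, 1 ≤ k → S.rademacher k ≤ C * (k : ℝ) ^ (-φ)) (hφ : φ ≤ 1 / 2)
    {n : ℕ} (hn : 0 < n) (hN : 0 < N) (hc : S.IsCover N cover) (hτ : 0 ≤ τ) :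
    (Measure.pi fun _ : Fin n => S.law) {s | ¬ ∀ f,
      |S.empCost s N cover f + S.empConst s N cover - S.loss f| ≤
        (2 * C + 2 * τ) * (n : ℝ) ^ (-φ) + 1 / N} ≤
      ENNReal.ofReal (Real.exp (-τ ^ 2 / 8)) + ENNReal.ofReal (2 * Real.exp (-2 * τ ^ 2)) := by
  have := S.law_prob
  have : Nonempty (Fin n) := ⟨⟨0, hn⟩⟩
  have hcost := measure_weightedThr_deviation_le (ι := Fin n) hS hR hφ
    Measure.AbsolutelyContinuous.rfl hN (measurable_roundedWeight hc)
    (fun z => finite_range_comp_roundOutcome hc fun y => S.costWeight N y z)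
    abs_roundedWeight_le_one hτ
  rw [Fintype.card_fin] at hcost
  refine (measure_mono fun s hs => ?_).trans ((measure_union_le _ _).trans
    (add_le_add hcost (measure_baseLoss_deviation_le hn hφ hc hτ)))
  by_contra hnot
  simp only [mem_union, mem_ofPred_eq, not_or, not_not] at hnot
  obtain ⟨hcost_dev, hbase_dev⟩ := hnot
  refine hs fun f => ?_
  have hcost_f : |S.empCost s N cover f - ∫ o, S.weightedThr N (S.roundedWeight N cover) f o ∂S.law|
      ≤ (2 * C + τ) * (n : ℝ) ^ (-φ) := hcost_dev f
  have hpop := abs_integral_weightedThr_add_baseLoss_sub_le hN hc f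
  rw [abs_le] at hcost_f hbase_dev hpop ⊢
  constructor <;> linarith [hcost_f.1, hcost_f.2, hbase_dev.1, hbase_dev.2, hpop.1, hpop.2]

end Loss

section ConditionalMeans

/-- The observations that lie in the `a`-th conditioning event. -/
def eventObs (S : Setting 𝒳) (a : Fin 2) : Set S.Obs := {o | o.2 ∈ S.event a}

open Classical in
/-- Sample version of `E[h_f(X, Z) | 𝓔ₐ]`; it is zero if no observation lies in `𝓔ₐ`. -/
noncomputable def empCondMean (S : Setting 𝒳) {n : ℕ} (s : Fin n → S.Obs) (N : ℕ)
    (f : S.predictors) (a : Fin 2) : ℝ :=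
  (1 / (S.eventCount s a : ℝ)) *
    ∑ i, if (s i).2 ∈ S.event a then gridMean N (fun z => S.thr f (s i).1 z) else 0

/-- `E[f(X) | 𝓔ₐ]`. -/
noncomputable def condMean (S : Setting 𝒳) (f : S.predictors) (a : Fin 2) : ℝ :=
  ∫ o, (f.1 o.1 : ℝ) ∂(ProbabilityTheory.cond S.law (S.eventObs a))

theorem measurableSet_eventObs (S : Setting 𝒳) (a : Fin 2) : MeasurableSet (S.eventObs a) :=
  measurable_snd (S.event_measurable a)

theorem isProbabilityMeasure_cond_eventObs (S : Setting 𝒳) (a : Fin 2) :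
    IsProbabilityMeasure (ProbabilityTheory.cond S.law (S.eventObs a)) :=
  have := S.law_prob
  ProbabilityTheory.cond_isProbabilityMeasure (S.event_pos a)

variable {n : ℕ} (s : Fin n → S.Obs) (f : S.predictors) (a : Fin 2)

theorem empDisp_eq_sum_empCondMean (β : Fin 2 → ℝ) :
    S.empDisp s β N f = ∑ a, β a * S.empCondMean s N f a := rfl

theorem disp_eq_sum_condMean (β : Fin 2 → ℝ) : S.disp β f = ∑ a, β a * S.condMean f a := rfl

theorem eventCount_eq_card_hits : S.eventCount s a = (hits (S.eventObs a) s).card := rfl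

theorem empCondMean_eq : S.empCondMean s N f a = (1 / (Fintype.card (hits (S.eventObs a) s) : ℝ)) *
    ∑ i : hits (S.eventObs a) s, S.weightedThr N (fun _ _ => 1) f (s i) := by
  classical
  rw [empCondMean, eventCount_eq_card_hits, Fintype.card_coe,
    Finset.sum_coe_sort (hits (S.eventObs a) s) fun i => S.weightedThr N (fun _ _ => 1) f (s i),
    hits, Finset.sum_filter]
  simp only [weightedThr, one_mul]
  rfl

theorem empCondMean_mem_Icc : S.empCondMean s N f a ∈ Icc (0 : ℝ) 1 := by
  have hmem (i : Fin n) : S.weightedThr N (fun _ _ => 1) f (s i) ∈ Icc (0 : ℝ) 1 := by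
    simpa only [weightedThr, one_mul] using S.gridMean_thr_mem_Icc N f (s i).1
  rw [empCondMean_eq, one_div_mul_eq_div]
  refine ⟨div_nonneg (Finset.sum_nonneg fun i _ => (hmem i).1) (Nat.cast_nonneg _),
    div_le_one_of_le₀ ?_ (Nat.cast_nonneg _)⟩
  simpa using Finset.sum_le_card_nsmul Finset.univ _ 1
    fun (i : hits (S.eventObs a) s) _ => (hmem i).2

theorem condMean_mem_Icc : S.condMean f a ∈ Icc (0 : ℝ) 1 := by
  have := S.isProbabilityMeasure_cond_eventObs a
  refine ⟨integral_nonneg fun o => (f.1 o.1).2.1, ?_⟩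
  have hintegrable : Integrable (fun o : S.Obs => (f.1 o.1 : ℝ))
      (ProbabilityTheory.cond S.law (S.eventObs a)) :=
    Integrable.of_mem_Icc 0 1 (S.measurable_predictor f).aemeasurable
      (ae_of_all _ fun o => (f.1 o.1).2)
  exact (integral_mono hintegrable (integrable_const 1) fun o => (f.1 o.1).2.2).trans (by simp)

theorem abs_integral_weightedThr_one_sub_condMean_le (hN : 0 < N) :
    |∫ o, S.weightedThr N (fun _ _ => 1) f o ∂ProbabilityTheory.cond S.law (S.eventObs a) -
      S.condMean f a| ≤ 1 / N := by
  have := S.isProbabilityMeasure_cond_eventObs a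
  refine abs_integral_sub_integral_le
    (integrable_weightedThr (fun _ => measurable_const) (fun _ _ => by simp) f)
    (Integrable.of_mem_Icc 0 1 (S.measurable_predictor f).aemeasurable
      (ae_of_all _ fun o => (f.1 o.1).2)) fun o => ?_
  simpa only [weightedThr, one_mul] using S.abs_gridMean_thr_sub_le hN f o.1

theorem abs_empCondMean_sub_condMean_le_of_eventCount_eq_zero (hC : 0 ≤ C) (hτ : 1 ≤ τ)
    (h : S.eventCount s a = 0) :
    |S.empCondMean s N f a - S.condMean f a| ≤
      (2 * C + τ) * (max 1 (S.eventCount s a) : ℝ) ^ (-φ) + 1 / N := by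
  have hzero : S.empCondMean s N f a = 0 := by simp [empCondMean, h]
  rw [hzero, h, zero_sub, abs_neg, abs_of_nonneg (condMean_mem_Icc f a).1]
  have hN : (0 : ℝ) ≤ 1 / N := by positivity
  simp only [CharP.cast_eq_zero, zero_le_one, sup_of_le_left, Real.one_rpow, mul_one]
  linarith [(condMean_mem_Icc f a).2]

theorem measure_condMean_deviation_le [Nonempty S.predictors] (hS : S.SupMeasurable)
    (hR : ∀ k : ℕ, 1 ≤ k → S.rademacher k ≤ C * (k : ℝ) ^ (-φ)) (hφ : φ ≤ 1 / 2) (hN : 0 < N)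
    (hτ : 1 ≤ τ) :
    (Measure.pi fun _ : Fin n => S.law) {s | ¬ ∀ f,
      |S.empCondMean s N f a - S.condMean f a| ≤
        (2 * C + τ) * (max 1 (S.eventCount s a) : ℝ) ^ (-φ) + 1 / N} ≤
      ENNReal.ofReal (Real.exp (-τ ^ 2 / 8)) := by
  have := S.law_prob
  have := S.isProbabilityMeasure_cond_eventObs a
  have hC := nonneg_of_rademacher_le hR
  let P := ProbabilityTheory.cond S.law (S.eventObs a)
  let bad (I : Finset (Fin n)) : Set (I → S.Obs) := {u | I.Nonempty ∧ ¬ ∀ f,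
    |(1 / (Fintype.card I : ℝ)) * ∑ i, S.weightedThr N (fun _ _ => 1) f (u i) -
      ∫ o, S.weightedThr N (fun _ _ => 1) f o ∂P| ≤ (2 * C + τ) * (Fintype.card I : ℝ) ^ (-φ)}
  have hbad (I : Finset (Fin n)) : (Measure.pi fun _ : I => P) (bad I) ≤
      ENNReal.ofReal (Real.exp (-τ ^ 2 / 8)) := by
    rcases I.eq_empty_or_nonempty with hI | hI
    · simp [bad, hI]
    · have := hI.to_subtype
      refine (measure_mono fun u hu => hu.2).trans (measure_weightedThr_deviation_le hS hR hφ
        (pi_cond_absolutelyContinuous (S.measurableSet_eventObs a) (S.event_pos a)) hN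
        (fun _ => measurable_const) (fun _ => finite_range_const) (fun _ _ => by simp)
        (zero_le_one.trans hτ))
  refine (measure_mono fun s hs => ?_).trans
    (measure_subsample_le (S.measurableSet_eventObs a) (S.event_pos a) bad hbad)
  obtain ⟨f, hf⟩ := not_forall.1 hs
  have hcount : S.eventCount s a ≠ 0 := fun h =>
    hf (abs_empCondMean_sub_condMean_le_of_eventCount_eq_zero s f a hC hτ h)
  refine ⟨Finset.card_ne_zero.1 hcount, fun hall => hf ?_⟩
  have hsample := hall f
  rw [← empCondMean_eq] at hsample
  have hmax : max 1 (S.eventCount s a : ℝ) = Fintype.card (hits (S.eventObs a) s) := by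
    rw [Fintype.card_coe, ← eventCount_eq_card_hits]
    exact max_eq_right (by exact_mod_cast Nat.one_le_iff_ne_zero.2 hcount)
  rw [hmax]
  exact (abs_sub_le _ _ _).trans
    (add_le_add hsample (abs_integral_weightedThr_one_sub_condMean_le f a hN))

end ConditionalMeans

end Setting

section SampleSize

open Filter

variable {φ κ δ : ℝ}

theorem tendsto_const_mul_natCast_rpow_atTop (hφ : 0 < φ) (hκ : 0 < κ) :
    Tendsto (fun n : ℕ => κ * (n : ℝ) ^ φ) atTop atTop :=
  ((tendsto_rpow_atTop hφ).comp tendsto_natCast_atTop_atTop).const_mul_atTop hκ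

theorem tendsto_sqrt_log_mul_natCast_rpow_atTop (hφ : 0 < φ) (hκ : 0 < κ) (hδ : 0 < δ) :
    Tendsto (fun n : ℕ => √(2 * Real.log (8 * (κ * (n : ℝ) ^ φ) / δ))) atTop atTop := by
  have harg : Tendsto (fun n : ℕ => 8 * (κ * (n : ℝ) ^ φ) / δ) atTop atTop :=
    ((tendsto_const_mul_natCast_rpow_atTop hφ hκ).const_mul_atTop (by norm_num)).atTop_div_const hδ
  exact Real.tendsto_sqrt_atTop.comp
    ((Real.tendsto_log_atTop.comp harg).const_mul_atTop two_pos)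

theorem eventually_polylog_mul_rpow_le_one (hφ : 0 < φ) (K : ℝ) (m : ℕ) (δ : ℝ) :
    ∀ᶠ n : ℕ in atTop, polylog K m n δ * (n : ℝ) ^ (-φ) ≤ 1 := by
  have hlog : (fun x : ℝ => 1 + Real.log x + Real.log (1 / δ)) =O[atTop] Real.log :=
    (Real.isLittleO_const_log_atTop.isBigO.add (Asymptotics.isBigO_refl _ _)).add
      Real.isLittleO_const_log_atTop.isBigO
  have hpow : (fun x : ℝ => Real.log x ^ m) =o[atTop] fun x : ℝ => x ^ φ := by
    simpa only [Real.rpow_natCast] using isLittleO_log_rpow_rpow_atTop (m : ℝ) hφ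
  have hpolylog := ((hlog.pow m).trans_isLittleO hpow).const_mul_left K
  refine tendsto_natCast_atTop_atTop.eventually (p := fun x : ℝ =>
    K * (1 + Real.log x + Real.log (1 / δ)) ^ m * x ^ (-φ) ≤ 1) ?_
  filter_upwards [hpolylog.def one_pos, eventually_gt_atTop 0] with x hx hx0
  have hxφ := Real.rpow_pos_of_pos hx0 φ
  rw [one_mul, Real.norm_eq_abs, Real.norm_eq_abs, abs_of_pos hxφ] at hx
  rw [Real.rpow_neg hx0.le, ← div_eq_mul_inv, div_le_one hxφ]
  exact (le_abs_self _).trans hx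

-- The grid size enters `C'` through `√(log N)`, which eventually exceeds every constant.
theorem exists_sample_size (hφ : 0 < φ) (hκ : 0 < κ) (hδ : 0 < δ) {κB : ℝ} (hκB : 0 < κB)
    (b b' B M : ℝ) (r : ℕ) :
    ∃ n₀ : ℕ, ∀ n : ℕ, n₀ ≤ n → 0 < n ∧ B ≤ κB * (n : ℝ) ^ φ ∧
      ∀ N : ℕ, κ * (n : ℝ) ^ φ ≤ N → ∀ C' : ℝ, b + √(2 * Real.log (8 * N / δ)) ≤ C' →
        C' ≤ polylog M r n δ → b + b' ≤ C' ∧ C' * (n : ℝ) ^ (-φ) ≤ 1 := by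
  obtain ⟨n₀, hn₀⟩ := eventually_atTop.1 <|
    (eventually_gt_atTop 0).and <|
    ((tendsto_const_mul_natCast_rpow_atTop hφ hκB).eventually_ge_atTop B).and <|
    ((tendsto_sqrt_log_mul_natCast_rpow_atTop hφ hκ hδ).eventually_ge_atTop b').and <|
    eventually_polylog_mul_rpow_le_one hφ M r δ
  refine ⟨n₀, fun n hn => ?_⟩
  obtain ⟨hn0, hB, hsqrt, hpolylog⟩ := hn₀ n hn
  refine ⟨hn0, hB, fun N hN C' hC' hC'M => ⟨?_, ?_⟩⟩
  · have : 0 < κ * (n : ℝ) ^ φ :=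
      mul_pos hκ (Real.rpow_pos_of_pos (by exact_mod_cast hn0) φ)
    have hmono : √(2 * Real.log (8 * (κ * (n : ℝ) ^ φ) / δ)) ≤ √(2 * Real.log (8 * N / δ)) := by
      gcongr
    linarith
  · exact (mul_le_mul_of_nonneg_right hC'M (Real.rpow_nonneg n.cast_nonneg _)).trans hpolylog

end SampleSize

section Rates

variable {φ κ κν κB Bξ C' τ δ : ℝ} {n N : ℕ}

theorem one_div_le_div_rpow (hn : 0 < n) (hκ : 0 < κ) (hN : κ * (n : ℝ) ^ φ ≤ N) :
    1 / (N : ℝ) ≤ 1 / κ * (n : ℝ) ^ (-φ) := by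
  have hpow : 0 < (n : ℝ) ^ φ := Real.rpow_pos_of_pos (by exact_mod_cast hn) φ
  rw [Real.rpow_neg n.cast_nonneg, ← one_div, one_div_mul_one_div]
  exact one_div_le_one_div_of_le (mul_pos hκ hpow) hN

theorem deviation_le_slack (hn : 0 < n) (hκ : 0 < κ) (hN : κ * (n : ℝ) ^ φ ≤ N) (hφ : φ ≤ 1 / 2)
    {c C'' : ℝ} (hC'' : 0 ≤ C'') (hC' : c + 1 / κ + C'' ≤ C') :
    c * (n : ℝ) ^ (-φ) + 1 / N ≤ C' * (n : ℝ) ^ (-φ) - C'' * (n : ℝ) ^ (-(1 / 2) : ℝ) := by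
  have hrate : (n : ℝ) ^ (-(1 / 2) : ℝ) ≤ (n : ℝ) ^ (-φ) :=
    Real.rpow_le_rpow_of_exponent_le (by exact_mod_cast hn) (by linarith)
  have hscaled := mul_le_mul_of_nonneg_right hC' (Real.rpow_nonneg n.cast_nonneg (-φ))
  linarith [one_div_le_div_rpow hn hκ hN, mul_le_mul_of_nonneg_left hrate hC'']

theorem pos_of_mul_rpow_le (hn : 0 < n) (hκ : 0 < κ) (hN : κ * (n : ℝ) ^ φ ≤ N) : 0 < N :=
  Nat.cast_pos.1 ((mul_pos hκ (Real.rpow_pos_of_pos (by exact_mod_cast hn) φ)).trans_le hN)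

theorem slack_mem_Icc (hn : 0 < n) (hκ : 0 < κ) (hN : κ * (n : ℝ) ^ φ ≤ N) (hφ : φ ≤ 1 / 2)
    {c C'' : ℝ} (hc : 0 ≤ c) (hC'' : 0 ≤ C'') (hC' : c + 1 / κ + C'' ≤ C')
    (hC'_le : C' * (n : ℝ) ^ (-φ) ≤ 1) :
    C' * (n : ℝ) ^ (-φ) - C'' * (n : ℝ) ^ (-(1 / 2) : ℝ) ∈ Icc (0 : ℝ) 1 :=
  ⟨le_trans (by positivity) (deviation_le_slack hn hκ hN hφ hC'' hC'),
    (sub_le_self _ (by positivity)).trans hC'_le⟩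

theorem rpow_le_rpow_max_one {k : ℕ} (hφ : 0 ≤ φ) (hn : 0 < n) (hk : k ≤ n) :
    (n : ℝ) ^ (-φ) ≤ (max 1 k : ℝ) ^ (-φ) :=
  Real.rpow_le_rpow_of_nonpos (one_pos.trans_le (le_max_left _ _))
    (max_le (by exact_mod_cast hn) (by exact_mod_cast hk)) (neg_nonpos.2 hφ)

theorem deviation_le_mul_rpow_max_one {k : ℕ} (hφ : 0 ≤ φ) (hn : 0 < n) (hk : k ≤ n) (hκ : 0 < κ)
    (hN : κ * (n : ℝ) ^ φ ≤ N) {c : ℝ} (hC' : c + 1 / κ ≤ C') :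
    c * (max 1 k : ℝ) ^ (-φ) + 1 / N ≤ C' * (max 1 k : ℝ) ^ (-φ) := by
  have hgrid : 1 / (N : ℝ) ≤ 1 / κ * (max 1 k : ℝ) ^ (-φ) := (one_div_le_div_rpow hn hκ hN).trans
    (mul_le_mul_of_nonneg_left (rpow_le_rpow_max_one hφ hn hk) (by positivity))
  have hscaled := mul_le_mul_of_nonneg_right hC'
    (show 0 ≤ (max 1 k : ℝ) ^ (-φ) by positivity)
  linarith

theorem iterations_le_mul_rpow (hφ : 0 ≤ φ) (hn : 0 < n) {ρ R : ℝ} (hρ : 0 ≤ ρ) (hρR : ρ ≤ R) :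
    4 * Real.log 4 * ρ ^ 2 * (κB * (n : ℝ) ^ φ) ^ 2 / (κν * (n : ℝ) ^ (-φ)) ^ 2 + 1 ≤
      (4 * Real.log 4 * R ^ 2 * κB ^ 2 / κν ^ 2 + 1) * (n : ℝ) ^ (4 * φ) := by
  have : 0 < (n : ℝ) ^ φ := Real.rpow_pos_of_pos (by exact_mod_cast hn) φ
  have hfourth : (n : ℝ) ^ (4 * φ) = ((n : ℝ) ^ φ) ^ 4 := by
    rw [mul_comm, Real.rpow_mul n.cast_nonneg]
    norm_cast
  have hone : (1 : ℝ) ≤ ((n : ℝ) ^ φ) ^ 4 :=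
    one_le_pow₀ (Real.one_le_rpow (by exact_mod_cast hn) hφ)
  have hcollect : 4 * Real.log 4 * ρ ^ 2 * (κB * (n : ℝ) ^ φ) ^ 2 / (κν * (n : ℝ) ^ (-φ)) ^ 2 =
      4 * Real.log 4 * ρ ^ 2 * κB ^ 2 / κν ^ 2 * ((n : ℝ) ^ φ) ^ 4 := by
    rw [Real.rpow_neg n.cast_nonneg]
    field_simp
  have : 0 ≤ Real.log 4 := Real.log_nonneg (by norm_num)
  rw [hcollect, hfourth, add_mul, one_mul]
  gcongr

theorem polylog_mono {K K' : ℝ} {m : ℕ} (hδ : 0 < δ) (hδ_le : δ ≤ 1) (h : K ≤ K') :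
    polylog K m n δ ≤ polylog K' m n δ :=
  mul_le_mul_of_nonneg_right h <| pow_nonneg (add_nonneg
    (add_nonneg zero_le_one (Real.log_natCast_nonneg n))
    (Real.log_nonneg ((one_le_div hδ).2 hδ_le))) m

theorem le_polylog {K : ℝ} {m : ℕ} (hδ : 0 < δ) (hδ_le : δ ≤ 1) (hK : 0 ≤ K) :
    K ≤ polylog K m n δ := by
  refine le_mul_of_one_le_right hK (one_le_pow₀ ?_)
  linarith [Real.log_natCast_nonneg n, Real.log_nonneg ((one_le_div hδ).2 hδ_le)]

theorem affine_le_polylog {a b M K : ℝ} {m : ℕ} (hδ : 0 < δ) (hδ_le : δ ≤ 1) (ha : 0 ≤ a)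
    (hb : 0 ≤ b) (hC' : C' ≤ polylog M m n δ) (hK : a * |M| + b ≤ K) :
    a * C' + b ≤ polylog K m n δ :=
  calc a * C' + b ≤ a * polylog |M| m n δ + polylog b m n δ :=
        add_le_add
          (mul_le_mul_of_nonneg_left (hC'.trans (polylog_mono hδ hδ_le (le_abs_self M))) ha)
          (le_polylog hδ hδ_le hb)
    _ = polylog (a * |M| + b) m n δ := by simp only [polylog]; ring
    _ ≤ polylog K m n δ := polylog_mono hδ hδ_le hK

/-- The constant in the bound on the number of rounds and in both rates, for `ε ≤ εmax` and `C'` at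
most `polylog M`. The first two terms bound the rounds, the others the slack and the gap. -/
noncomputable def rateConstant (εmax Bξ κν κB M : ℝ) : ℝ :=
  4 * Real.log 4 * (2 * Bξ + 1 + (2 + εmax)) ^ 2 * κB ^ 2 / κν ^ 2 + 1 +
    (2 * (Bξ + 1) * |M| + κν + (Bξ + 2 * κν) / κB)

theorem rateConstant_pos {εmax M : ℝ} (hBξ : 0 ≤ Bξ) (hκν : 0 ≤ κν) (hκB : 0 ≤ κB) :
    0 < rateConstant εmax Bξ κν κB M := by
  have := Real.log_nonneg (x := 4) (by norm_num)
  unfold rateConstant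
  positivity

theorem rounds_le_rateConstant {εmax M : ℝ} (hBξ : 0 ≤ Bξ) (hκν : 0 ≤ κν) (hκB : 0 ≤ κB) :
    4 * Real.log 4 * (2 * Bξ + 1 + (2 + εmax)) ^ 2 * κB ^ 2 / κν ^ 2 + 1 ≤
      rateConstant εmax Bξ κν κB M :=
  le_add_of_nonneg_right (by positivity)

theorem slack_le_rateConstant (εmax Bξ κν κB M : ℝ) :
    2 * (Bξ + 1) * |M| + κν + (Bξ + 2 * κν) / κB ≤ rateConstant εmax Bξ κν κB M := by
  have := Real.log_nonneg (x := 4) (by norm_num)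
  exact le_add_of_nonneg_left (by positivity)

theorem loss_slack_le {εmax M C'' : ℝ} {r : ℕ} (hφ : 0 ≤ φ) (hn : 0 < n) (hδ : 0 < δ)
    (hδ' : δ ≤ 1) (hBξ : 0 ≤ Bξ) (hκν : 0 ≤ κν) (hκB : 0 ≤ κB) (hC'' : 0 ≤ C'')
    (hC' : C' ≤ polylog M r n δ) :
    2 * (C' * (n : ℝ) ^ (-φ) - C'' * (n : ℝ) ^ (-(1 / 2) : ℝ)) +
        (Bξ + 2 * (κν * (n : ℝ) ^ (-φ))) / (κB * (n : ℝ) ^ φ) ≤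
      polylog (rateConstant εmax Bξ κν κB M) r n δ * (n : ℝ) ^ (-φ) := by
  have hrate_le_one : (n : ℝ) ^ (-φ) ≤ 1 :=
    Real.rpow_le_one_of_one_le_of_nonpos (by exact_mod_cast hn) (neg_nonpos.2 hφ)
  have hgap : (Bξ + 2 * (κν * (n : ℝ) ^ (-φ))) / (κB * (n : ℝ) ^ φ) ≤
      (Bξ + 2 * κν) / κB * (n : ℝ) ^ (-φ) := by
    rw [← div_div, div_eq_mul_inv _ ((n : ℝ) ^ φ), ← Real.rpow_neg n.cast_nonneg]
    gcongr
    exact mul_le_of_le_one_right hκν hrate_le_one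
  have hconst : 2 * C' + (Bξ + 2 * κν) / κB ≤ polylog (rateConstant εmax Bξ κν κB M) r n δ :=
    affine_le_polylog hδ hδ' zero_le_two (by positivity) hC' <|
      le_trans (by linarith [mul_nonneg hBξ (abs_nonneg M)])
        (slack_le_rateConstant εmax Bξ κν κB M)
  have hslack : 0 ≤ C'' * (n : ℝ) ^ (-(1 / 2) : ℝ) := by positivity
  linarith [mul_le_mul_of_nonneg_right hconst (Real.rpow_nonneg n.cast_nonneg (-φ))]

theorem disparity_slack_le {εmax M : ℝ} {r : ℕ} {β : Fin 2 → ℝ} {k : Fin 2 → ℕ} (hφ : 0 ≤ φ)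
    (hn : 0 < n) (hk : ∀ a, k a ≤ n) (hδ : 0 < δ) (hδ' : δ ≤ 1) (hβ : ∀ a, |β a| ≤ Bξ)
    (hκν : 0 ≤ κν) (hκB : 0 ≤ κB) (hC' : C' ≤ polylog M r n δ) :
    2 * (κν * (n : ℝ) ^ (-φ)) + 2 * ∑ a, |β a| * (C' * (max 1 (k a) : ℝ) ^ (-φ)) ≤
      polylog (rateConstant εmax Bξ κν κB M) r n δ * (max 1 (k 0) : ℝ) ^ (-φ) +
        polylog (rateConstant εmax Bξ κν κB M) r n δ * (max 1 (k 1) : ℝ) ^ (-φ) := by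
  have hBξ : 0 ≤ Bξ := (abs_nonneg _).trans (hβ 0)
  have hconst (a : Fin 2) :
      2 * |β a| * C' + κν ≤ polylog (rateConstant εmax Bξ κν κB M) r n δ := by
    refine affine_le_polylog hδ hδ' (by positivity) hκν hC' <|
      le_trans ?_ (slack_le_rateConstant εmax Bξ κν κB M)
    have hgap : 0 ≤ (Bξ + 2 * κν) / κB := by positivity
    linarith [mul_le_mul_of_nonneg_right (hβ a) (abs_nonneg M), abs_nonneg M]
  have hterm (a : Fin 2) : κν * (n : ℝ) ^ (-φ) + 2 * (|β a| * (C' * (max 1 (k a) : ℝ) ^ (-φ))) ≤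
      polylog (rateConstant εmax Bξ κν κB M) r n δ * (max 1 (k a) : ℝ) ^ (-φ) := by
    have hrate := mul_le_mul_of_nonneg_left (rpow_le_rpow_max_one hφ hn (hk a)) hκν
    linarith [mul_le_mul_of_nonneg_right (hconst a)
      (show 0 ≤ (max 1 (k a) : ℝ) ^ (-φ) by positivity)]
  rw [Fin.sum_univ_two]
  linarith [hterm 0, hterm 1]

end Rates

theorem abs_one_div_mul_sum_le_one {n : ℕ} {v : Fin n → ℝ} (hv : ∀ i, |v i| ≤ 1) :
    |(1 / (n : ℝ)) * ∑ i, v i| ≤ 1 := by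
  have hsum := abs_sum_le_card_mul hv
  rw [Fintype.card_fin, mul_one] at hsum
  rw [one_div_mul_eq_div, abs_div, Nat.abs_cast]
  exact div_le_one_of_le₀ hsum n.cast_nonneg

theorem abs_sum_mul_le {β : Fin 2 → ℝ} {B : ℝ}
    (hβ : ∀ p ∈ Icc (0 : ℝ) 1, ∀ q ∈ Icc (0 : ℝ) 1, |β 0 * p + β 1 * q| ≤ B) {v : Fin 2 → ℝ}
    (hv : ∀ a, v a ∈ Icc (0 : ℝ) 1) : |∑ a, β a * v a| ≤ B := by
  rw [Fin.sum_univ_two]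
  exact hβ _ (hv 0) _ (hv 1)

theorem abs_apply_le {β : Fin 2 → ℝ} {B : ℝ}
    (hβ : ∀ p ∈ Icc (0 : ℝ) 1, ∀ q ∈ Icc (0 : ℝ) 1, |β 0 * p + β 1 * q| ≤ B) (a : Fin 2) :
    |β a| ≤ B := by
  fin_cases a
  · simpa using hβ 1 (by simp) 0 (by simp)
  · simpa using hβ 0 (by simp) 1 (by simp)

theorem exists_measurableSet_subset_compl {Ω : Type*} [MeasurableSpace Ω] {P : Measure Ω}
    [IsProbabilityMeasure P] {B : Set Ω} {δ : ℝ} (hδ : 0 ≤ δ) (hB : P B ≤ ENNReal.ofReal δ) :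
    ∃ G : Set Ω, MeasurableSet G ∧ ENNReal.ofReal (1 - δ) ≤ P G ∧ G ⊆ Bᶜ := by
  refine ⟨(toMeasurable P B)ᶜ, (measurableSet_toMeasurable _ _).compl, ?_,
    compl_subset_compl.2 (subset_toMeasurable P B)⟩
  rw [prob_compl_eq_one_sub (measurableSet_toMeasurable _ _), measure_toMeasurable,
    ENNReal.ofReal_sub _ hδ, ENNReal.ofReal_one]
  exact tsub_le_tsub_left hB _

/-- The deviation, in units of the standard error, that the bounds `exp (-τ ^ 2 / 8)` allow to be
exceeded with probability `δ / 8`. -/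
noncomputable def confidenceRadius (δ : ℝ) : ℝ := √(8 * Real.log (8 / δ))

theorem one_le_confidenceRadius {δ : ℝ} (hδ : 0 < δ) (hδ' : δ ≤ 1) : 1 ≤ confidenceRadius δ := by
  have hlog := Real.one_sub_inv_le_log_of_pos (x := 8 / δ) (by positivity)
  rw [confidenceRadius, Real.one_le_sqrt]
  rw [inv_div] at hlog
  linarith

theorem exp_neg_confidenceRadius_sq_div {δ : ℝ} (hδ : 0 < δ) (hδ' : δ ≤ 1) :
    Real.exp (-confidenceRadius δ ^ 2 / 8) = δ / 8 := by
  have hlog : 0 ≤ Real.log (8 / δ) := Real.log_nonneg ((one_le_div hδ).2 (by linarith))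
  rw [confidenceRadius, Real.sq_sqrt (by positivity), neg_div, mul_div_cancel_left₀ _ (by norm_num),
    Real.exp_neg, Real.exp_log (by positivity), inv_div]

theorem failure_probability_le {δ : ℝ} (hδ : 0 < δ) (hδ' : δ ≤ 1) :
    ENNReal.ofReal (Real.exp (-confidenceRadius δ ^ 2 / 8)) +
        ENNReal.ofReal (2 * Real.exp (-2 * confidenceRadius δ ^ 2)) +
      (ENNReal.ofReal (Real.exp (-confidenceRadius δ ^ 2 / 8)) +
        ENNReal.ofReal (Real.exp (-confidenceRadius δ ^ 2 / 8))) ≤ ENNReal.ofReal δ := by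
  have hexp : Real.exp (-2 * confidenceRadius δ ^ 2) ≤ δ / 8 := by
    rw [← exp_neg_confidenceRadius_sq_div hδ hδ', Real.exp_le_exp]
    linarith [sq_nonneg (confidenceRadius δ)]
  rw [exp_neg_confidenceRadius_sq_div hδ hδ', ← ENNReal.ofReal_add (by positivity) (by positivity),
    ← ENNReal.ofReal_add (by positivity) (by positivity),
    ← ENNReal.ofReal_add (by positivity) (by positivity)]
  exact ENNReal.ofReal_le_ofReal (by linarith)

namespace Setting

variable {𝒳 : Type u} [MeasurableSpace 𝒳] {S : Setting 𝒳} {n N : ℕ} {s : Fin n → S.Obs}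
  {cover : Finset S.outcomes} {β : Fin 2 → ℝ} {Bξ : ℝ}

theorem abs_empCost_le_one (hN : 0 < N) (s : Fin n → S.Obs) (cover : Finset S.outcomes)
    (f : S.predictors) : |S.empCost s N cover f| ≤ 1 :=
  abs_one_div_mul_sum_le_one fun i => by
    rw [gridMean_eq_expect]
    exact abs_expect_le_of_forall_le (Finset.nonempty_Icc.2 hN) fun j _ =>
      abs_mul_thr_le_one (w := S.roundedWeight N cover) abs_roundedWeight_le_one f _ (s i)

theorem abs_empConst_le_one (N : ℕ) (s : Fin n → S.Obs) (cover : Finset S.outcomes) :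
    |S.empConst s N cover| ≤ 1 :=
  abs_one_div_mul_sum_le_one fun i => by
    have hbase := baseLoss_mem_Icc (N := N) (cover := cover) (s i)
    exact (abs_of_nonneg hbase.1).trans_le hbase.2

theorem abs_loss_le_one (f : S.predictors) : |S.loss f| ≤ 1 := by
  have := S.law_prob
  have hloss := norm_integral_le_of_norm_le_const (μ := S.law) (C := 1)
    (f := fun o : S.Obs => (S.lossFn o.2.2 (f.1 o.1) : ℝ)) <| ae_of_all _ fun o =>
      (abs_of_nonneg (S.lossFn o.2.2 (f.1 o.1)).2.1).trans_le (S.lossFn o.2.2 (f.1 o.1)).2.2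
  rwa [probReal_univ, mul_one] at hloss

theorem abs_empDisp_le (hβ : ∀ p ∈ Icc (0 : ℝ) 1, ∀ q ∈ Icc (0 : ℝ) 1, |β 0 * p + β 1 * q| ≤ Bξ)
    (s : Fin n → S.Obs) (f : S.predictors) : |S.empDisp s β N f| ≤ Bξ :=
  abs_sum_mul_le hβ fun a => empCondMean_mem_Icc s f a

theorem abs_disp_le (hβ : ∀ p ∈ Icc (0 : ℝ) 1, ∀ q ∈ Icc (0 : ℝ) 1, |β 0 * p + β 1 * q| ≤ Bξ)
    (f : S.predictors) : |S.disp β f| ≤ Bξ :=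
  abs_sum_mul_le hβ fun a => condMean_mem_Icc f a

theorem eventCount_le (s : Fin n → S.Obs) (a : Fin 2) : S.eventCount s a ≤ n := by
  unfold eventCount
  exact (Finset.card_le_univ _).trans_eq (Fintype.card_fin n)

theorem epsHat_eq (s : Fin n → S.Obs) (φ ε C' C'' : ℝ) :
    S.epsHat s N cover φ ε C' C'' = ε - S.empConst s N cover +
      (C' * (n : ℝ) ^ (-φ) - C'' * (n : ℝ) ^ (-(1 / 2) : ℝ)) :=
  add_sub_assoc _ _ _

theorem abs_epsHat_le {φ ε εmax C' C'' : ℝ} (s : Fin n → S.Obs) (hε : 0 ≤ ε) (hε' : ε ≤ εmax)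
    (hslack : C' * (n : ℝ) ^ (-φ) - C'' * (n : ℝ) ^ (-(1 / 2) : ℝ) ∈ Icc (0 : ℝ) 1) :
    |S.epsHat s N cover φ ε C' C''| ≤ 2 + εmax := by
  have hconst := abs_le.1 (abs_empConst_le_one N s cover)
  rw [epsHat_eq]
  exact abs_le.2 ⟨by linarith [hconst.2, hslack.1], by linarith [hconst.1, hslack.2]⟩

theorem exists_stopsAt_le (hn : 0 < n) (hN : 0 < N) {κν κB φ εmax M epsHat : ℝ} (hBξ : 0 < Bξ)
    (hφ : 0 ≤ φ)
    (hβ : ∀ p ∈ Icc (0 : ℝ) 1, ∀ q ∈ Icc (0 : ℝ) 1, |β 0 * p + β 1 * q| ≤ Bξ)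
    (hκν : 0 < κν) (hκB : 0 < κB) (hlarge : κν / Bξ ≤ κB * (n : ℝ) ^ φ)
    (hepsHat : |epsHat| ≤ 2 + εmax)
    {bestH : (Fin 3 → ℝ) → S.predictors} {g : AlgInput S.predictors}
    (hg : g = S.algInput s β N cover epsHat Bξ (κB * (n : ℝ) ^ φ) (κν * (n : ℝ) ^ (-φ)) bestH)
    (hbest : g.IsBestResponse) :
    ∃ t : ℕ, g.StopsAt t ∧
      ((t + 1 : ℕ) : ℝ) ≤ rateConstant εmax Bξ κν κB M * (n : ℝ) ^ (4 * φ) := by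
  subst hg
  have : Nonempty S.predictors := ⟨bestH 0⟩
  have hpow : 0 < (n : ℝ) ^ φ := Real.rpow_pos_of_pos (by exact_mod_cast hn) φ
  have hrate : (n : ℝ) ^ (-φ) ≤ 1 :=
    Real.rpow_le_one_of_one_le_of_nonpos (by exact_mod_cast hn) (neg_nonpos.2 hφ)
  have hν : 0 < κν * (n : ℝ) ^ (-φ) :=
    mul_pos hκν (Real.rpow_pos_of_pos (by exact_mod_cast hn) _)
  have hνB : κν * (n : ℝ) ^ (-φ) ≤ Bξ * (κB * (n : ℝ) ^ φ) :=
    (mul_le_of_le_one_right hκν.le hrate).trans ((div_le_iff₀' hBξ).1 hlarge)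
  obtain ⟨t, ht, hle⟩ := AlgInput.exists_stopsAt hbest (abs_empDisp_le hβ s)
    (abs_empCost_le_one hN s cover) hBξ (mul_pos hκB hpow) hν hνB rfl
  have hrho : rho (S.empDisp s β N) (S.empCost s N cover) epsHat Bξ ≤
      2 * Bξ + 1 + (2 + εmax) := by
    refine (rho_le (Bc := 1 + (2 + εmax)) (abs_empDisp_le hβ s) (fun f => ?_)
      hBξ.le).trans_eq (by ring)
    exact (abs_sub _ _).trans (add_le_add (abs_empCost_le_one hN s cover f) hepsHat)
  refine ⟨t, ht, hle.trans <| (iterations_le_mul_rpow hφ hn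
    (Real.iSup_nonneg fun _ => norm_nonneg _) hrho).trans ?_⟩
  exact mul_le_mul_of_nonneg_right (rounds_le_rateConstant hBξ.le hκν.le hκB.le)
    (Real.rpow_nonneg n.cast_nonneg _)

/-- On the sample `s`, the loss of every predictor is estimated up to `γ` and its conditional means
up to `e`. -/
structure IsRepresentative (S : Setting 𝒳) (s : Fin n → S.Obs) (N : ℕ)
    (cover : Finset S.outcomes) (γ : ℝ) (e : Fin 2 → ℝ) : Prop where
  abs_empCost_add_empConst_sub_le :
    ∀ f, |S.empCost s N cover f + S.empConst s N cover - S.loss f| ≤ γ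
  abs_empCondMean_sub_le : ∀ f a, |S.empCondMean s N f a - S.condMean f a| ≤ e a

namespace IsRepresentative

variable {γ ε : ℝ} {e : Fin 2 → ℝ}

theorem abs_empDisp_sub_le (h : S.IsRepresentative s N cover γ e) (f : S.predictors) :
    |S.empDisp s β N f - S.disp β f| ≤ ∑ a, |β a| * e a := by
  rw [empDisp_eq_sum_empCondMean, disp_eq_sum_condMean, ← Finset.sum_sub_distrib]
  refine (Finset.abs_sum_le_sum_abs _ _).trans (Finset.sum_le_sum fun a _ => ?_)
  rw [← mul_sub, abs_mul]
  exact mul_le_mul_of_nonneg_left (h.abs_empCondMean_sub_le f a) (abs_nonneg _)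

theorem abs_mean_empDisp_sub_le (h : S.IsRepresentative s N cover γ e)
    (hβ : ∀ p ∈ Icc (0 : ℝ) 1, ∀ q ∈ Icc (0 : ℝ) 1, |β 0 * p + β 1 * q| ≤ Bξ)
    (Q : PMF S.predictors) :
    |mean Q (S.empDisp s β N) - mean Q (S.disp β)| ≤ ∑ a, |β a| * e a :=
  abs_mean_sub_le Q (abs_empDisp_le hβ s) (abs_disp_le hβ) h.abs_empDisp_sub_le

theorem abs_mean_empCost_add_empConst_sub_le (h : S.IsRepresentative s N cover γ e) (hN : 0 < N)
    (Q : PMF S.predictors) :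
    |mean Q (S.empCost s N cover) + S.empConst s N cover - mean Q S.loss| ≤ γ := by
  have hlower := mean_le_mean_add Q abs_loss_le_one (abs_empCost_le_one hN s cover)
    (d := γ + S.empConst s N cover)
    fun f => by linarith [(abs_le.1 (h.abs_empCost_add_empConst_sub_le f)).1]
  have hupper := mean_le_mean_add Q (abs_empCost_le_one hN s cover) abs_loss_le_one
    (d := γ - S.empConst s N cover)
    fun f => by linarith [(abs_le.1 (h.abs_empCost_add_empConst_sub_le f)).2]
  exact abs_le.2 ⟨by linarith, by linarith⟩

theorem mean_empCost_le_of_feasible (h : S.IsRepresentative s N cover γ e) (hN : 0 < N)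
    {Q : PMF S.predictors} (hQ : S.Feasible ε Q) :
    mean Q (S.empCost s N cover) ≤ ε - S.empConst s N cover + γ := by
  have hloss : mean Q S.loss ≤ ε := hQ
  linarith [(abs_le.1 (h.abs_mean_empCost_add_empConst_sub_le hN Q)).2]

theorem abs_mean_disp_le_of_abs_mean_empDisp_le (h : S.IsRepresentative s N cover γ e)
    (hβ : ∀ p ∈ Icc (0 : ℝ) 1, ∀ q ∈ Icc (0 : ℝ) 1, |β 0 * p + β 1 * q| ≤ Bξ)
    {Q Q' : PMF S.predictors} {d : ℝ}
    (hd : |mean Q (S.empDisp s β N)| ≤ |mean Q' (S.empDisp s β N)| + d) :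
    |mean Q (S.disp β)| ≤ |mean Q' (S.disp β)| + (d + 2 * ∑ a, |β a| * e a) := by
  have hQ := h.abs_mean_empDisp_sub_le hβ Q
  rw [abs_sub_comm] at hQ
  linarith [(abs_sub_abs_le_abs_sub _ _).trans hQ,
    (abs_sub_abs_le_abs_sub _ _).trans (h.abs_mean_empDisp_sub_le hβ Q')]

theorem output_spec (h : S.IsRepresentative s N cover γ e) (hN : 0 < N) {Bl ν : ℝ} (hBξ : 0 ≤ Bξ)
    (hβ : ∀ p ∈ Icc (0 : ℝ) 1, ∀ q ∈ Icc (0 : ℝ) 1, |β 0 * p + β 1 * q| ≤ Bξ) (hBl : 1 ≤ Bl)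
    {bestH : (Fin 3 → ℝ) → S.predictors} {g : AlgInput S.predictors}
    (hg : g = S.algInput s β N cover (ε - S.empConst s N cover + γ) Bξ Bl ν bestH)
    (hbest : g.IsBestResponse) {t : ℕ} (ht : g.StopsAt t) :
    (∃ (ξ : ℝ) (Q : PMF S.predictors) (lam : Fin 3 → ℝ), g.output t = some (ξ, Q, lam) ∧
      mean Q S.loss ≤ ε + (2 * γ + (Bξ + 2 * ν) / Bl) ∧
      ∀ Q' : PMF S.predictors, S.Feasible ε Q' →
        |mean Q (S.disp β)| ≤ |mean Q' (S.disp β)| + (2 * ν + 2 * ∑ a, |β a| * e a)) ∨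
    (g.output t = none ∧ ¬ ∃ Q' : PMF S.predictors, S.Feasible ε Q') := by
  have hdisp := abs_empDisp_le (N := N) hβ s
  have hcost := abs_empCost_le_one hN s cover
  by_cases hout : mean (g.Qhat t) g.cost ≤ g.epsHat + (g.Bξ + 2 * g.ν) / g.Bl
  · refine Or.inl ⟨g.xiHat t, g.Qhat t, g.lamHat t, if_pos hout, ?_, fun Q' hQ' =>
      h.abs_mean_disp_le_of_abs_mean_empDisp_le hβ ?_⟩
    · have hloss := h.abs_mean_empCost_add_empConst_sub_le hN (g.Qhat t)
      subst hg
      simp only [algInput] at hout hloss ⊢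
      linarith [(abs_le.1 hloss).1]
    · subst hg
      exact AlgInput.abs_mean_disp_Qhat_le hbest hdisp hcost hBl ht.1
        (h.mean_empCost_le_of_feasible hN hQ')
  · refine Or.inr ⟨if_neg hout, fun ⟨Q', hQ'⟩ => hout ?_⟩
    subst hg
    exact AlgInput.mean_cost_Qhat_le hbest hdisp hcost hBξ (zero_lt_one.trans_le hBl :) ht.1
      (h.mean_empCost_le_of_feasible hN hQ')

end IsRepresentative

theorem measure_not_isRepresentative_le [Nonempty S.predictors] {φ C κ δ C' C'' : ℝ}
    (hS : S.SupMeasurable) (hR : ∀ k : ℕ, 1 ≤ k → S.rademacher k ≤ C * (k : ℝ) ^ (-φ))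
    (hφ : 0 ≤ φ) (hφ' : φ ≤ 1 / 2) (hn : 0 < n) (hN : 0 < N) (hκ : 0 < κ)
    (hκN : κ * (n : ℝ) ^ φ ≤ N) (hcover : S.IsCover N cover) (hδ : 0 < δ) (hδ' : δ ≤ 1)
    (hC'' : 0 ≤ C'') (hC' : 2 * C + 2 * confidenceRadius δ + 1 / κ + C'' ≤ C') :
    (Measure.pi fun _ : Fin n => S.law) {s | ¬ S.IsRepresentative s N cover
      (C' * (n : ℝ) ^ (-φ) - C'' * (n : ℝ) ^ (-(1 / 2) : ℝ))
      fun a => C' * (max 1 (S.eventCount s a) : ℝ) ^ (-φ)} ≤ ENNReal.ofReal δ := by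
  have hτ := one_le_confidenceRadius hδ hδ'
  have hloss := measure_loss_deviation_le hS hR hφ' hn hN hcover (zero_le_one.trans hτ)
  have hcond (a : Fin 2) := measure_condMean_deviation_le (n := n) a hS hR hφ' hN hτ
  refine (measure_mono fun s hs => ?_).trans <|
    ((measure_union_le _ _).trans <| add_le_add hloss <| (measure_union_le _ _).trans <|
      add_le_add (hcond 0) (hcond 1)).trans (failure_probability_le hδ hδ')
  by_contra hgood
  simp only [mem_union, mem_ofPred_eq, not_or, not_not] at hgood
  have hslack (a : Fin 2) := deviation_le_mul_rpow_max_one hφ hn (eventCount_le s a) hκ hκN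
    (c := 2 * C + confidenceRadius δ) (C' := C') (by linarith)
  refine hs ⟨fun f => (hgood.1 f).trans (deviation_le_slack hn hκ hκN hφ' hC'' hC'),
    fun f => Fin.forall_fin_two.2 ⟨?_, ?_⟩⟩
  · exact (hgood.2.1 f).trans (hslack 0)
  · exact (hgood.2.2 f).trans (hslack 1)

theorem exists_measurableSet_isRepresentative {φ C κ δ C' C'' : ℝ}
    (hS : S.SupMeasurable) (hR : ∀ k : ℕ, 1 ≤ k → S.rademacher k ≤ C * (k : ℝ) ^ (-φ))
    (hφ : 0 ≤ φ) (hφ' : φ ≤ 1 / 2) (hn : 0 < n) (hN : 0 < N) (hκ : 0 < κ)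
    (hκN : κ * (n : ℝ) ^ φ ≤ N) (hcover : S.IsCover N cover) (hδ : 0 < δ) (hδ' : δ ≤ 1)
    (hC'' : 0 ≤ C'') (hC' : 2 * C + 2 * confidenceRadius δ + 1 / κ + C'' ≤ C') :
    ∃ G : Set (Fin n → S.Obs), MeasurableSet G ∧
      ENNReal.ofReal (1 - δ) ≤ Measure.pi (fun _ : Fin n => S.law) G ∧
      ∀ s ∈ G, S.IsRepresentative s N cover
        (C' * (n : ℝ) ^ (-φ) - C'' * (n : ℝ) ^ (-(1 / 2) : ℝ))
        fun a => C' * (max 1 (S.eventCount s a) : ℝ) ^ (-φ) := by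
  have := S.law_prob
  rcases isEmpty_or_nonempty S.predictors with _ | _
  · exact ⟨univ, MeasurableSet.univ,
      (ENNReal.ofReal_le_one.2 (by linarith)).trans_eq measure_univ.symm,
      fun s _ => ⟨isEmptyElim, isEmptyElim⟩⟩
  · obtain ⟨G, hG, hprob, hsub⟩ := exists_measurableSet_subset_compl hδ.le
      (measure_not_isRepresentative_le hS hR hφ hφ' hn hN hκ hκN hcover hδ hδ' hC'' hC')
    exact ⟨G, hG, hprob, fun s hs => not_not.1 (hsub hs)⟩

end Setting

end FairRashomon

theorem theorem3_general
    (φ C εmax Bξ κν κB κ₁ M : ℝ) (r : ℕ) (β : Fin 2 → ℝ)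
    (hφ : 0 < φ) (hφ' : φ ≤ 1 / 2) (hBξ : 0 < Bξ)
    (hβ : ∀ p ∈ Icc (0 : ℝ) 1, ∀ q ∈ Icc (0 : ℝ) 1, |β 0 * p + β 1 * q| ≤ Bξ)
    (hκν : 0 < κν) (hκB : 0 < κB) (hκ₁ : 0 < κ₁) :
    ∃ K : ℝ, 0 < K ∧ ∃ m : ℕ,
      ∀ δ : ℝ, 0 < δ → δ < 1 →
      ∀ C'' : ℝ, 0 ≤ C'' →
      ∃ n₀ : ℕ,
      ∀ (𝒳 : Type u) [MeasurableSpace 𝒳] (S : Setting 𝒳), S.SupMeasurable →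
      (∀ k : ℕ, 1 ≤ k → S.rademacher k ≤ C * (k : ℝ) ^ (-φ)) →
      ∀ ε : ℝ, 0 ≤ ε → ε ≤ εmax →
      ∀ n : ℕ, n₀ ≤ n →
      ∀ N : ℕ, κ₁ * (n : ℝ) ^ φ ≤ N →
      ∀ cover : Finset S.outcomes, S.IsCover N cover →
      ∀ C' : ℝ, 2 * C + 2 + √(2 * Real.log (8 * N / δ)) ≤ C' → C' ≤ polylog M r n δ →
      (∀ (s : Fin n → S.Obs) (bestH : (Fin 3 → ℝ) → S.predictors) (g : AlgInput S.predictors),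
        g = S.algInput s β N cover (S.epsHat s N cover φ ε C' C'') Bξ
          (κB * (n : ℝ) ^ φ) (κν * (n : ℝ) ^ (-φ)) bestH →
        g.IsBestResponse →
        ∃ t : ℕ, g.StopsAt t ∧ ((t + 1 : ℕ) : ℝ) ≤ K * (n : ℝ) ^ (4 * φ)) ∧
      ∃ G : Set (Fin n → S.Obs), MeasurableSet G ∧
        ENNReal.ofReal (1 - δ) ≤ Measure.pi (fun _ : Fin n => S.law) G ∧
        ∀ s ∈ G, ∀ (bestH : (Fin 3 → ℝ) → S.predictors) (g : AlgInput S.predictors),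
          g = S.algInput s β N cover (S.epsHat s N cover φ ε C' C'') Bξ
            (κB * (n : ℝ) ^ φ) (κν * (n : ℝ) ^ (-φ)) bestH →
          g.IsBestResponse →
          ∀ t : ℕ, g.StopsAt t →
            (∃ (ξ : ℝ) (Q : PMF S.predictors) (lam : Fin 3 → ℝ),
              g.output t = some (ξ, Q, lam) ∧
              mean Q S.loss ≤ ε + polylog K m n δ * (n : ℝ) ^ (-φ) ∧
              ∀ Q' : PMF S.predictors, S.Feasible ε Q' →
                |mean Q (S.disp β)| ≤ |mean Q' (S.disp β)|
                  + polylog K m n δ * (max 1 (S.eventCount s 0) : ℝ) ^ (-φ)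
                  + polylog K m n δ * (max 1 (S.eventCount s 1) : ℝ) ^ (-φ)) ∨
            (g.output t = none ∧ ¬ ∃ Q' : PMF S.predictors, S.Feasible ε Q') := by
  refine ⟨rateConstant εmax Bξ κν κB M, rateConstant_pos hBξ.le hκν.le hκB.le, r,
    fun δ hδ hδ' C'' hC'' => ?_⟩
  obtain ⟨n₀, hn₀⟩ := exists_sample_size hφ hκ₁ hδ hκB (2 * C + 2)
    (2 * confidenceRadius δ + 1 / κ₁ + C'') (1 + κν / Bξ) M r
  refine ⟨n₀, fun 𝒳 _ S hS hR ε hε hε' n hn N hκN cover hcover C' hC' hC'M => ?_⟩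
  obtain ⟨hn, hBl, hlarge⟩ := hn₀ n hn
  obtain ⟨hC'_ge, hC'_le⟩ := hlarge N hκN C' hC' hC'M
  have hC'_dev : 2 * C + 2 * confidenceRadius δ + 1 / κ₁ + C'' ≤ C' := by linarith
  have hN := pos_of_mul_rpow_le hn hκ₁ hκN
  have hdev : 0 ≤ 2 * C + 2 * confidenceRadius δ := by
    linarith [S.nonneg_of_rademacher_le hR, one_le_confidenceRadius hδ hδ'.le]
  have hslack := slack_mem_Icc hn hκ₁ hκN hφ' hdev hC'' hC'_dev hC'_le
  have hBl_one : 1 ≤ κB * (n : ℝ) ^ φ :=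
    (le_add_of_nonneg_right (div_nonneg hκν.le hBξ.le)).trans hBl
  constructor
  · exact fun s bestH g hg hbest => Setting.exists_stopsAt_le hn hN hBξ hφ.le hβ hκν hκB
      ((le_add_of_nonneg_left zero_le_one).trans hBl) (Setting.abs_epsHat_le s hε hε' hslack)
      hg hbest
  · obtain ⟨G, hG, hprob, hrep⟩ := Setting.exists_measurableSet_isRepresentative hS hR hφ.le hφ'
      hn hN hκ₁ hκN hcover hδ hδ'.le hC'' hC'_dev
    refine ⟨G, hG, hprob, fun s hs bestH g hg hbest t ht => ?_⟩
    rw [Setting.epsHat_eq] at hg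
    refine ((hrep s hs).output_spec hN hBξ.le hβ hBl_one hg hbest ht).imp_left ?_
    rintro ⟨ξ, Q, lam, hout, hloss, hdisp⟩
    refine ⟨ξ, Q, lam, hout, hloss.trans (add_le_add_right ?_ ε), fun Q' hQ' => ?_⟩
    · exact loss_slack_le hφ.le hn hδ hδ'.le hBξ.le hκν.le hκB.le hC'' hC'M
    · rw [add_assoc]
      exact (hdisp Q' hQ').trans <| add_le_add_right (disparity_slack_le hφ.le hn
        (Setting.eventCount_le s) hδ hδ'.le (abs_apply_le hβ) hκν.le hκB.le hC'M) _

theorem theorem3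
    (φ C εmax Bξ κν κB κ₁ κ₂ M : ℝ) (r : ℕ) (β : Fin 2 → ℝ)
    (hφ : 0 < φ) (hφ' : φ ≤ 1 / 2) (hC : 0 < C) (hBξ : 0 < Bξ)
    (hβ : ∀ p ∈ Icc (0 : ℝ) 1, ∀ q ∈ Icc (0 : ℝ) 1, |β 0 * p + β 1 * q| ≤ Bξ)
    (hκν : 0 < κν) (hκB : 0 < κB) (hκ₁ : 0 < κ₁) :
    ∃ K : ℝ, 0 < K ∧ ∃ m : ℕ,
      ∀ δ : ℝ, 0 < δ → δ < 1 →
      ∀ C'' : ℝ, 0 < C'' → √(-Real.log (δ / 8) / 2) ≤ C'' →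
      ∃ n₀ : ℕ,
      ∀ (𝒳 : Type u) [MeasurableSpace 𝒳] (S : Setting 𝒳), S.SupMeasurable →
      (∀ k : ℕ, 1 ≤ k → S.rademacher k ≤ C * (k : ℝ) ^ (-φ)) →
      ∀ ε : ℝ, 0 ≤ ε → ε ≤ εmax →
      ∀ n : ℕ, n₀ ≤ n →
      ∀ N : ℕ, κ₁ * (n : ℝ) ^ φ ≤ N → (N : ℝ) ≤ κ₂ * (n : ℝ) ^ φ →
      ∀ cover : Finset S.outcomes, S.IsCover N cover →
      ∀ C' : ℝ, 2 * C + 2 + √(2 * Real.log (8 * N / δ)) ≤ C' → C' ≤ polylog M r n δ →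
      -- termination, for every sample and every exact best-response procedure
      (∀ (s : Fin n → S.Obs) (bestH : (Fin 3 → ℝ) → S.predictors) (g : AlgInput S.predictors),
        g = S.algInput s β N cover (S.epsHat s N cover φ ε C' C'') Bξ
          (κB * (n : ℝ) ^ φ) (κν * (n : ℝ) ^ (-φ)) bestH →
        g.IsBestResponse →
        ∃ t : ℕ, g.StopsAt t ∧ ((t + 1 : ℕ) : ℝ) ≤ K * (n : ℝ) ^ (4 * φ)) ∧
      -- quality of the output, for all samples in an event of probability at least `1 - δ`
      ∃ G : Set (Fin n → S.Obs), MeasurableSet G ∧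
        ENNReal.ofReal (1 - δ) ≤ Measure.pi (fun _ : Fin n => S.law) G ∧
        ∀ s ∈ G, ∀ (bestH : (Fin 3 → ℝ) → S.predictors) (g : AlgInput S.predictors),
          g = S.algInput s β N cover (S.epsHat s N cover φ ε C' C'') Bξ
            (κB * (n : ℝ) ^ φ) (κν * (n : ℝ) ^ (-φ)) bestH →
          g.IsBestResponse →
          ∀ t : ℕ, g.StopsAt t →
            (∃ (ξ : ℝ) (Q : PMF S.predictors) (lam : Fin 3 → ℝ),
              g.output t = some (ξ, Q, lam) ∧
              mean Q S.loss ≤ ε + polylog K m n δ * (n : ℝ) ^ (-φ) ∧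
              ∀ Q' : PMF S.predictors, S.Feasible ε Q' →
                |mean Q (S.disp β)| ≤ |mean Q' (S.disp β)|
                  + polylog K m n δ * (max 1 (S.eventCount s 0) : ℝ) ^ (-φ)
                  + polylog K m n δ * (max 1 (S.eventCount s 1) : ℝ) ^ (-φ)) ∨
            (g.output t = none ∧ ¬ ∃ Q' : PMF S.predictors, S.Feasible ε Q') := by
  obtain ⟨K, hK, m, h⟩ := theorem3_general φ C εmax Bξ κν κB κ₁ M r β hφ hφ' hBξ hβ hκν hκB hκ₁
  exact ⟨K, hK, m, fun δ hδ hδ' C'' hC'' _ => (h δ hδ hδ' C'' hC''.le).imp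
    fun _ h _ _ S hS hR ε hε hε' n hn N hN _ => h _ S hS hR ε hε hε' n hn N hN⟩
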